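/- All algebras are associative, unital, over $\mathbb{C}$; ideals are two-sided; $H$ is a Hopf algebra with invertible antipode $S$; $I$ is a finite set. A family of ideals $(J_i)_{i\in I}$ of an algebra $R$ is a covering if $\bigcap_i J_i=0$; its covering completion is $R_c=\{(x_i)\in\prod_i R/J_i : x_i=x_j \text{ in } R/(J_i+J_j)\ \forall i,j\}$, and the covering is complete if $R\to R_c$ is bijective. **Bundle.** A locally trivial quantum principal fibre bundle (QPFB) consists of an algebra $B$ with a complete covering $(J_i)_{i\in I}$, a right $H$-comodule algebra $(P,\Delta_P)$, surjective homomorphisms $\chi_i:P\to B_i\otimes H$, where $B_i=B/J_i$, and an injective homomorphism $\iota:B\to P$ such that $(\mathrm{id}\otimes\Delta)\chi_i=(\chi_i\otimes\mathrm{id})\Delta_P$, $\chi_i(\iota(a))=\pi_i(a)\otimes 1$ with $\pi_i : B\to B_i$ the projection, $(\ker\chi_i)_i$ is a complete covering of $P$, and $\iota(B)=\{f:\Delta_P(f)=f\otimes1\}$. Put $B_{ij}=B/(J_i+J_j)$, with projections $\pi^i_j:B_i\to B_{ij}$. A family of transition functions consists of homomorphisms $\tau_{ij}:H\to B_{ij}$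 with $(\pi^i_j\otimes\mathrm{id})\chi_i=\phi_{ij}(\pi^j_i\otimes\mathrm{id})\chi_j$ for all $i,j$, where $\phi_{ij}(a\otimes h)=\sum a\,\tau_{ji}(h_1)\otimes h_2$. **Differential structure.** A differential calculus over an algebra $A$ is an $\mathbb{N}$-graded differential algebra $\Gamma(A)$ with $\Gamma^0(A)=A$, generated by the elements $a$, $da$. Let differential calculi $\Gamma(B_i)$ and a right covariant differential calculus $\Gamma(H)$ (with coaction $\Delta^\Gamma$) be given, and let $R=\{r\in\ker\varepsilon:\sum S^{-1}(r_2)dr_1=0\}$ be the right ideal of $H$ that corresponds to $\Gamma(H)$. With the skew tensor product $\Gamma(B_i)\hat\otimes\Gamma(H)$, let $\Gamma(P)$ be the (unique) differential calculus over $P$ such that every $\chi_i$ extends to a homomorphism of differential algebras $\chi_{i}:\Gamma(P)\to\Gamma(B_i)\hat\otimes\Gamma(H)$ and the kernels $K_i$ of these extensions satisfy $\bigcap_iK_i=0$. Let $\Gamma_c(P)$ be the covering completion of $\Gamma(P)$ with respect to $(K_i)_i$; $\chi_i$ also denotes the induced map on $\Gamma_c(P)$. The right $H$-coaction $\Delta^{\Gamma_c}$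 on $\Gamma_c(P)$ is determined by $(\chi_i\otimes\mathrm{id})\Delta^{\Gamma_c}=(\mathrm{id}\otimes\Delta^\Gamma)\chi_i$ for all $i$. Let $\mathrm{hor}\,\Gamma^1_c(P)=\{\gamma\in\Gamma^1_c(P):\chi_i(\gamma)\in\Gamma(B_i)\hat\otimes H\ \forall i\}$. **Connections.** A left (right) connection is a surjective left (right) $P$-module homomorphism $\mathrm{hor}:\Gamma_c^1(P)\to\mathrm{hor}\,\Gamma_c^1(P)$ with $\mathrm{hor}^2=\mathrm{hor}$, $(\mathrm{hor}\otimes\mathrm{id})\Delta^{\Gamma_c}=\Delta^{\Gamma_c}\mathrm{hor}$ and $\mathrm{hor}(\ker\chi_i)\subset\ker\chi_i$ for all $i$. Its local connection maps are $A_i:H\to\Gamma^1(B_i)$, $A_i(h)=-(\mathrm{id}\otimes\varepsilon)\,\mathrm{hor}_i(1\otimes dh)$, where $\mathrm{hor}_i\circ\chi_i=\chi_i\circ\mathrm{hor}$ and $\varepsilon$ is extended by $0$ to forms of positive degree. **Proposition 13.** For every locally trivial QPFB with a differential structure as above: 1. There is exactly one bijection from the left connections to the right connections under which the local connection maps $A_{l,i}$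 of a left connection and $A_{r,i}$ of the corresponding right connection satisfy $A_{r,i}=-A_{l,i}\circ S$ for all $i\in I$. 2. There is exactly one family of transition functions $(\tau_{ij})$. The families of local connection maps of left (right) connections are exactly the families of linear maps $A_i:H\to\Gamma^1(B_i)$ such that $A_i(1)=0$, the compatibility condition $$\pi^i_j(A_i(h))=\sum\tau_{ij}(h_1)\,\pi^j_i(A_j(h_2))\,\tau_{ji}(h_3)+\sum\tau_{ij}(h_1)\,d\tau_{ji}(h_2)$$ holds in $\Gamma(P)/(K_i+K_j)$ for all $i,j$ and $h\in H$ (where $\pi^i_j(\gamma)$ is the class of any $\rho\in\Gamma(P)$ with $\chi_i(\rho)=\gamma\otimes1$, $\pi^j_i(\gamma)$ is the class of any $\rho$ with $\chi_j(\rho)=\gamma\otimes 1$, and $B_{ij}$ is mapped there by $\iota$), and $R\subset\ker A_i$ (respectively $S^{-1}(R)\subset\ker A_i$) for all $i$. 3. The assignment $(A_i)_i\mapsto(-A_i\circ S)_i$ preserves these conditions: for every family of linear maps $A_i:H\to\Gamma(B_i)$, the family $(A_i)$ takes values in one-forms and vanishes at $1$ if and only if $(-A_i\circ S)$ does; $(A_i)$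 satisfies the compatibility condition if and only if $(-A_i\circ S)$ does; and $R\subset\ker A_i$ for all $i$ if and only if $S^{-1}(R)\subset\ker(-A_i\circ S)$ for all $i$. -/

import Mathlib

open scoped TensorProduct

noncomputable section

/-! ### Coverings of algebras by two-sided ideals -/

section Covering

variable {I R : Type*} [Ring R] [Algebra ℂ R]

instance isTwoSided_sup (J K : Ideal R) [J.IsTwoSided] [K.IsTwoSided] : (J ⊔ K).IsTwoSided where
  mul_mem_of_left b ha := by
    obtain ⟨y, hy, z, hz, rfl⟩ := Submodule.mem_sup.1 ha
    rw [add_mul]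
    exact Submodule.add_mem_sup (J.mul_mem_right b hy) (K.mul_mem_right b hz)

/-- The ideals `J i` cover `R`: their intersection is zero. -/
def IsCovering (J : I → Ideal R) : Prop := ⨅ i, J i = ⊥

/-- The covering completion: families `x i` in `R / J i` whose members agree in `R / (J i + J j)`. -/
def coveringCompletion (J : I → Ideal R) [∀ i, (J i).IsTwoSided] :
    Subalgebra ℂ (∀ i, R ⧸ J i) where
  carrier := {x | ∀ i j,
    Ideal.Quotient.factorₐ ℂ (le_sup_left : J i ≤ J i ⊔ J j) (x i) =
      Ideal.Quotient.factorₐ ℂ (le_sup_right : J j ≤ J i ⊔ J j) (x j)}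
  mul_mem' {x y} hx hy i j := by
    rw [Pi.mul_apply, Pi.mul_apply, map_mul, map_mul, hx i j, hy i j]
  add_mem' {x y} hx hy i j := by
    rw [Pi.add_apply, Pi.add_apply, map_add, map_add, hx i j, hy i j]
  algebraMap_mem' r i j := by
    rw [Pi.algebraMap_apply, Pi.algebraMap_apply, AlgHom.commutes, AlgHom.commutes]

/-- The canonical map of `R` into its covering completion. -/
def toCompletion (J : I → Ideal R) [∀ i, (J i).IsTwoSided] : R →ₐ[ℂ] coveringCompletion J :=
  AlgHom.codRestrict (AlgHom.pi fun i => Ideal.Quotient.mkₐ ℂ (J i)) (coveringCompletion J)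
    (fun _ _ _ => rfl)

/-- A covering is complete if the canonical map onto the covering completion is onto
(it is injective because the intersection of the ideals is zero). -/
def IsCompleteCovering (J : I → Ideal R) [∀ i, (J i).IsTwoSided] : Prop :=
  IsCovering J ∧ Function.Surjective (toCompletion J)

end Covering

/-! ### Right comodule algebras and locally trivial bundles -/

section Hopf

variable {H : Type*} [Ring H] [HopfAlgebra ℂ H]

/-- `Δ` makes the algebra `A` a right `H`-comodule algebra. -/
def IsRightCoaction {A : Type*} [Ring A] [Algebra ℂ A] (Δ : A →ₐ[ℂ] A ⊗[ℂ] H) : Prop :=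
  (∀ a, TensorProduct.assoc ℂ A H H (Δ.toLinearMap.rTensor H (Δ a)) =
      (Coalgebra.comul (R := ℂ) (A := H)).lTensor A (Δ a)) ∧
  (∀ a, TensorProduct.rid ℂ A ((Coalgebra.counit (R := ℂ) (A := H)).lTensor A (Δ a)) = a)

/-- The inverse of the antipode, for a Hopf algebra with invertible antipode. -/
def antipodeInv (hS : Function.Bijective (HopfAlgebra.antipode ℂ : H →ₗ[ℂ] H)) : H →ₗ[ℂ] H :=
  (LinearEquiv.ofBijective (HopfAlgebra.antipode ℂ : H →ₗ[ℂ] H) hS).symm.toLinearMap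

/-- Convolution `h ↦ ∑ f (h₁) * g (h₂)`. -/
def convolve {A : Type*} [Ring A] [Algebra ℂ A] (f g : H →ₗ[ℂ] A) : H →ₗ[ℂ] A :=
  LinearMap.mul' ℂ A ∘ₗ TensorProduct.map f g ∘ₗ Coalgebra.comul

end Hopf

/-- A locally trivial quantum principal fibre bundle with total space `P`, base `B`, structure
group `H`, covering `J`, embedding `ι` of the base and local trivializations `χ`. -/
structure LocallyTrivialQPFB (I H B P : Type*) [Ring H] [HopfAlgebra ℂ H] [Ring B] [Algebra ℂ B]
    [Ring P] [Algebra ℂ P] where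
  J : I → Ideal B
  [twoSided : ∀ i, (J i).IsTwoSided]
  complete_base : IsCompleteCovering J
  coact : P →ₐ[ℂ] P ⊗[ℂ] H
  isRightCoaction : IsRightCoaction coact
  χ : ∀ i, P →ₐ[ℂ] (B ⧸ J i) ⊗[ℂ] H
  χ_surjective : ∀ i, Function.Surjective (χ i)
  ι : B →ₐ[ℂ] P
  ι_injective : Function.Injective ι
  χ_covariant : ∀ i p,
    (Coalgebra.comul (R := ℂ) (A := H)).lTensor (B ⧸ J i) (χ i p) =
      TensorProduct.assoc ℂ (B ⧸ J i) H H ((χ i).toLinearMap.rTensor H (coact p))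
  χ_ι : ∀ i b, χ i (ι b) = Ideal.Quotient.mk (J i) b ⊗ₜ[ℂ] (1 : H)
  complete_total : IsCompleteCovering fun i => RingHom.ker (χ i)
  range_ι : ∀ p, p ∈ Set.range ι ↔ coact p = p ⊗ₜ[ℂ] (1 : H)

attribute [instance] LocallyTrivialQPFB.twoSided

namespace LocallyTrivialQPFB

variable {I H B P : Type*} [Ring H] [HopfAlgebra ℂ H] [Ring B] [Algebra ℂ B]
  [Ring P] [Algebra ℂ P] (X : LocallyTrivialQPFB I H B P)

/-- The local algebra `B_i = B / J_i`. -/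
abbrev Loc (i : I) : Type _ := B ⧸ X.J i

/-- The overlap algebra `B_ij = B / (J_i + J_j)`. -/
abbrev Overlap (i j : I) : Type _ := B ⧸ (X.J i ⊔ X.J j)

/-- The projection `B_i → B_ij`. -/
def resLeft (i j : I) : X.Loc i →ₐ[ℂ] X.Overlap i j :=
  Ideal.Quotient.factorₐ ℂ le_sup_left

/-- The projection `B_j → B_ij`. -/
def resRight (i j : I) : X.Loc j →ₐ[ℂ] X.Overlap i j :=
  Ideal.Quotient.factorₐ ℂ le_sup_right

/-- The identification `B_ji = B_ij`. -/
def overlapSwap (i j : I) : X.Overlap j i →ₐ[ℂ] X.Overlap i j :=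
  Ideal.Quotient.factorₐ ℂ (le_of_eq (sup_comm _ _))

/-- The map `a ⊗ h ↦ ∑ a t(h₁) ⊗ h₂`. -/
def twist {A : Type*} [Ring A] [Algebra ℂ A] (t : H →ₐ[ℂ] A) : A ⊗[ℂ] H →ₗ[ℂ] A ⊗[ℂ] H :=
  (LinearMap.mul' ℂ A).rTensor H ∘ₗ (TensorProduct.assoc ℂ A A H).symm.toLinearMap ∘ₗ
    (t.toLinearMap.rTensor H ∘ₗ Coalgebra.comul).lTensor A

/-- `τ` is the family of transition functions `τ i j : H → B_ij` of the bundle: the change of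
trivialization `φ_ij`, which satisfies `(π^i_j ⊗ id) ∘ χ_i = φ_ij ∘ (π^j_i ⊗ id) ∘ χ_j`, is
`a ⊗ h ↦ ∑ a τ_ji(h₁) ⊗ h₂`. -/
def IsTransition (τ : ∀ i j, H →ₐ[ℂ] X.Overlap i j) : Prop :=
  ∀ i j p, (X.resLeft i j).toLinearMap.rTensor H (X.χ i p) =
    twist ((X.overlapSwap i j).comp (τ j i))
      ((X.resRight i j).toLinearMap.rTensor H (X.χ j p))

end LocallyTrivialQPFB

/-! ### Differential calculi -/

/-- A differential calculus over `B`: an `ℕ`-graded differential algebra with degree zero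
part `B`, generated as an algebra by the elements `b` and `d b`. -/
structure DifferentialCalculus.{u, v} (B : Type u) [Ring B] [Algebra ℂ B] where
  carrier : Type v
  [ring : Ring carrier]
  [algebra : Algebra ℂ carrier]
  deg : ℕ → Submodule ℂ carrier
  [graded : GradedAlgebra deg]
  incl : B →ₐ[ℂ] carrier
  incl_injective : Function.Injective incl
  range_incl : LinearMap.range incl.toLinearMap = deg 0
  d : carrier →ₗ[ℂ] carrier
  d_mem : ∀ n, ∀ x ∈ deg n, d x ∈ deg (n + 1)
  d_d : ∀ x, d (d x) = 0
  leibniz : ∀ n, ∀ x ∈ deg n, ∀ y, d (x * y) = d x * y + (-1 : ℂ) ^ n • (x * d y)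
  generated : Algebra.adjoin ℂ (Set.range incl ∪ Set.range fun b => d (incl b)) = ⊤

attribute [instance] DifferentialCalculus.ring DifferentialCalculus.algebra
  DifferentialCalculus.graded

namespace DifferentialCalculus

section One

variable {B : Type*} [Ring B] [Algebra ℂ B] (Γ : DifferentialCalculus B)

/-- The universal first order map `b ↦ d b`. -/
def dB : B →ₗ[ℂ] Γ.carrier := Γ.d ∘ₗ Γ.incl.toLinearMap

/-- The grading involution `γ ↦ (-1)^n γ` for `γ` of degree `n`. -/
def sign : Γ.carrier →ₗ[ℂ] Γ.carrier :=
  DirectSum.toModule ℂ ℕ Γ.carrier (fun n => (-1 : ℂ) ^ n • (Γ.deg n).subtype) ∘ₗ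
    (DirectSum.decomposeLinearEquiv Γ.deg).toLinearMap

/-- The identification of `B` with the forms of degree zero. -/
def zeroEquiv : B ≃ₗ[ℂ] Γ.deg 0 :=
  (LinearEquiv.ofInjective Γ.incl.toLinearMap Γ.incl_injective).trans
    (LinearEquiv.ofEq _ _ Γ.range_incl)

/-- The degree zero component of a form, as an element of `B`. -/
def zeroPart : Γ.carrier →ₗ[ℂ] B :=
  Γ.zeroEquiv.symm.toLinearMap ∘ₗ DirectSum.component ℂ ℕ (fun n => Γ.deg n) 0 ∘ₗ
    (DirectSum.decomposeLinearEquiv Γ.deg).toLinearMap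

theorem incl_mem (b : B) : Γ.incl b ∈ Γ.deg 0 := by
  rw [← Γ.range_incl]
  exact ⟨b, rfl⟩

theorem d_one : Γ.d 1 = 0 := by
  have h := Γ.leibniz 0 1 (SetLike.one_mem_graded Γ.deg) 1
  simpa using h

theorem sign_of_mem {n : ℕ} {x : Γ.carrier} (hx : x ∈ Γ.deg n) :
    Γ.sign x = (-1 : ℂ) ^ n • x := by
  lift x to Γ.deg n using hx
  simp [sign]

end One

section Two

variable {A B : Type*} [Ring A] [Algebra ℂ A] [Ring B] [Algebra ℂ B]
  (Γ : DifferentialCalculus A) (Λ : DifferentialCalculus B)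

/-- The skew tensor product of two differential calculi, with the product
`(γ ⊗ ρ)(ω ⊗ τ) = (-1)^(mn) γω ⊗ ρτ` for `ω` of degree `n` and `ρ` of degree `m`. -/
abbrev Skew : Type _ := GradedTensorProduct ℂ Γ.deg Λ.deg

/-- The differential `d (γ ⊗ ρ) = dγ ⊗ ρ + (-1)^n γ ⊗ dρ` for `γ` of degree `n`. -/
def skewD : Skew Γ Λ →ₗ[ℂ] Skew Γ Λ :=
  (GradedTensorProduct.of ℂ Γ.deg Λ.deg).toLinearMap ∘ₗ
    (TensorProduct.map Γ.d LinearMap.id + TensorProduct.map Γ.sign Λ.d) ∘ₗ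
      (GradedTensorProduct.of ℂ Γ.deg Λ.deg).symm.toLinearMap

/-- The embedding of `A ⊗ B` as the forms of degree zero. -/
def skewIncl : A ⊗[ℂ] B →ₗ[ℂ] Skew Γ Λ :=
  (GradedTensorProduct.of ℂ Γ.deg Λ.deg).toLinearMap ∘ₗ
    TensorProduct.map Γ.incl.toLinearMap Λ.incl.toLinearMap

/-- The embedding `γ ↦ γ ⊗ 1`. -/
def inLeft : Γ.carrier →ₐ[ℂ] Skew Γ Λ := GradedTensorProduct.includeLeft Γ.deg Λ.deg

/-- The subspace `Γ(A) ⊗ B` of horizontal forms. -/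
def horizontal : Submodule ℂ (Skew Γ Λ) :=
  LinearMap.range ((GradedTensorProduct.of ℂ Γ.deg Λ.deg).toLinearMap ∘ₗ
    Λ.incl.toLinearMap.lTensor Γ.carrier)

theorem skewD_left (a : A) : skewD Γ Λ (skewIncl Γ Λ (a ⊗ₜ 1)) = inLeft Γ Λ (Γ.d (Γ.incl a)) := by
  simp [skewD, skewIncl, inLeft, d_one, GradedTensorProduct.includeLeft_apply]

theorem skewD_right (b : B) : skewD Γ Λ (skewIncl Γ Λ (1 ⊗ₜ b)) =
    GradedTensorProduct.includeRight Γ.deg Λ.deg (Λ.d (Λ.incl b)) := by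
  have h : Γ.sign 1 = 1 := by simpa using Γ.sign_of_mem (SetLike.one_mem_graded Γ.deg)
  simp [skewD, skewIncl, d_one, h]

end Two

end DifferentialCalculus

open DifferentialCalculus

/-- A right covariant differential calculus over a Hopf algebra: the coaction is determined by
`Δ^Γ (h₀ d h₁ ⋯ d hₙ) = Δ(h₀) (d ⊗ id)Δ(h₁) ⋯ (d ⊗ id)Δ(hₙ)`. -/
structure RightCovariantCalculus.{u, v} (H : Type u) [Ring H] [HopfAlgebra ℂ H] extends
    DifferentialCalculus.{u, v} H where
  coact : carrier →ₐ[ℂ] carrier ⊗[ℂ] H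
  isRightCoaction : IsRightCoaction coact
  coact_incl : ∀ h : H, coact (incl h) =
    incl.toLinearMap.rTensor H (Coalgebra.comul (R := ℂ) h)
  coact_d : ∀ h : H, coact (d (incl h)) =
    (toDifferentialCalculus.dB).rTensor H (Coalgebra.comul (R := ℂ) h)

namespace RightCovariantCalculus

variable {H : Type*} [Ring H] [HopfAlgebra ℂ H] (Γ : RightCovariantCalculus H)
  (hS : Function.Bijective (HopfAlgebra.antipode ℂ : H →ₗ[ℂ] H))

/-- The map `η(h) = ∑ S⁻¹(h₂) d h₁`. -/
def eta : H →ₗ[ℂ] Γ.carrier :=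
  LinearMap.mul' ℂ Γ.carrier ∘ₗ
    TensorProduct.map (Γ.incl.toLinearMap ∘ₗ antipodeInv hS) Γ.toDifferentialCalculus.dB ∘ₗ
      (TensorProduct.comm ℂ H H).toLinearMap ∘ₗ Coalgebra.comul

/-- The right ideal `R = ker η ∩ ker ε` of `H` that corresponds to the calculus. -/
def rightIdeal : Submodule ℂ H :=
  LinearMap.ker (Γ.eta hS) ⊓ LinearMap.ker (Coalgebra.counit (R := ℂ) (A := H))

/-- The counit of `H`, extended by zero to the forms of positive degree. -/
def counitΓ : Γ.carrier →ₗ[ℂ] ℂ := Coalgebra.counit ∘ₗ Γ.toDifferentialCalculus.zeroPart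

end RightCovariantCalculus

/-! ### Differential structures on a bundle -/

/-- A differential structure on a locally trivial bundle: differential calculi `Γ(B_i)`, a right
covariant differential calculus `Γ(H)`, and the differential calculus `Γ(P)` that is adapted to
the covering `ker χ_i` and the calculi `Γ(B_i) ⊗ Γ(H)`, i.e. each `χ_i` extends to a homomorphism
of differential algebras and the kernels of the extensions have intersection zero. -/
structure DifferentialStructure.{uI, uH, uB, uP, vH, vB, vP} {I : Type uI} {H : Type uH}
    {B : Type uB} {P : Type uP} [Ring H] [HopfAlgebra ℂ H] [Ring B] [Algebra ℂ B]
    [Ring P] [Algebra ℂ P] (X : LocallyTrivialQPFB I H B P) where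
  ΓB : ∀ i, DifferentialCalculus.{uB, vB} (X.Loc i)
  ΓH : RightCovariantCalculus.{uH, vH} H
  ΓP : DifferentialCalculus.{uP, vP} P
  χΓ : ∀ i, ΓP.carrier →ₐ[ℂ] Skew (ΓB i) ΓH.toDifferentialCalculus
  χΓ_incl : ∀ i p, χΓ i (ΓP.incl p) = skewIncl (ΓB i) ΓH.toDifferentialCalculus (X.χ i p)
  χΓ_d : ∀ i x, χΓ i (ΓP.d x) = skewD (ΓB i) ΓH.toDifferentialCalculus (χΓ i x)
  covering : IsCovering fun i => RingHom.ker (χΓ i)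

namespace DifferentialStructure

variable {I H B P : Type*} [Ring H] [HopfAlgebra ℂ H] [Ring B] [Algebra ℂ B]
  [Ring P] [Algebra ℂ P] {X : LocallyTrivialQPFB I H B P} (D : DifferentialStructure X)

/-- The local calculus `Γ(B_i) ⊗ Γ(H)`. -/
abbrev Local (i : I) : Type _ := Skew (D.ΓB i) D.ΓH.toDifferentialCalculus

theorem χΓ_surjective (i : I) : Function.Surjective (D.χΓ i) := by
  have h0 : ∀ z, skewIncl (D.ΓB i) D.ΓH.toDifferentialCalculus z ∈ (D.χΓ i).range := by
    intro z
    obtain ⟨p, rfl⟩ := X.χ_surjective i z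
    exact ⟨_, D.χΓ_incl i p⟩
  have h1 : ∀ z, skewD (D.ΓB i) D.ΓH.toDifferentialCalculus
      (skewIncl (D.ΓB i) D.ΓH.toDifferentialCalculus z) ∈ (D.χΓ i).range := by
    intro z
    obtain ⟨p, rfl⟩ := X.χ_surjective i z
    exact ⟨D.ΓP.d (D.ΓP.incl p), by
      rw [AlgHom.toRingHom_eq_coe, RingHom.coe_coe, D.χΓ_d, D.χΓ_incl]⟩
  have hL : (D.χΓ i).range.comap (inLeft (D.ΓB i) D.ΓH.toDifferentialCalculus) = ⊤ := by
    rw [eq_top_iff, ← (D.ΓB i).generated]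
    refine Algebra.adjoin_le ?_
    rintro _ (⟨b, rfl⟩ | ⟨b, rfl⟩)
    · have h := h0 (b ⊗ₜ 1)
      simpa [skewIncl, inLeft, GradedTensorProduct.includeLeft_apply] using h
    · have h := h1 (b ⊗ₜ 1)
      rw [skewD_left] at h
      exact h
  have hR : (D.χΓ i).range.comap
      (GradedTensorProduct.includeRight (D.ΓB i).deg D.ΓH.deg) = ⊤ := by
    rw [eq_top_iff, ← D.ΓH.generated]
    refine Algebra.adjoin_le ?_
    rintro _ (⟨b, rfl⟩ | ⟨b, rfl⟩)
    · have h := h0 (1 ⊗ₜ b)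
      simp only [skewIncl, LinearMap.comp_apply, TensorProduct.map_tmul,
        AlgHom.toLinearMap_apply, map_one] at h
      exact h
    · have h := h1 (1 ⊗ₜ b)
      rw [skewD_right] at h
      exact h
  intro y
  change y ∈ (D.χΓ i).range
  induction y using TensorProduct.induction_on with
  | zero => exact zero_mem _
  | add x y hx hy => exact add_mem hx hy
  | tmul a b =>
    have ha : a ∈ (D.χΓ i).range.comap (inLeft (D.ΓB i) D.ΓH.toDifferentialCalculus) :=
      hL ▸ Algebra.mem_top
    have hb : b ∈ (D.χΓ i).range.comap
        (GradedTensorProduct.includeRight (D.ΓB i).deg D.ΓH.deg) := hR ▸ Algebra.mem_top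
    have h := mul_mem ((Subalgebra.mem_comap _ _ _).1 ha) ((Subalgebra.mem_comap _ _ _).1 hb)
    have e : inLeft (D.ΓB i) D.ΓH.toDifferentialCalculus a *
        GradedTensorProduct.includeRight (D.ΓB i).deg D.ΓH.deg b =
          GradedTensorProduct.tmul ℂ a b :=
      GradedTensorProduct.tmul_one_mul_one_tmul _ _ a b
    rw [e] at h
    exact h

/-- The kernel of the extension of `χ_i`, an ideal of `Γ(P)`. -/
abbrev kerχ (i : I) : Ideal D.ΓP.carrier := RingHom.ker (D.χΓ i)

/-- The covering completion `Γ_c(P)` of `Γ(P)`. -/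
abbrev Completed : Subalgebra ℂ (∀ i, D.ΓP.carrier ⧸ D.kerχ i) := coveringCompletion D.kerχ

/-- The one-forms `Γ_c¹(P)`. -/
def forms : Submodule ℂ (∀ i, D.ΓP.carrier ⧸ D.kerχ i) :=
  Subalgebra.toSubmodule D.Completed ⊓
    ⨅ i, ((D.ΓP.deg 1).map (Ideal.Quotient.mkₐ ℂ (D.kerχ i)).toLinearMap).comap
      (LinearMap.proj i)

theorem mem_forms {x : ∀ i, D.ΓP.carrier ⧸ D.kerχ i} : x ∈ D.forms ↔
    x ∈ D.Completed ∧ ∀ i, ∃ y ∈ D.ΓP.deg 1, Ideal.Quotient.mk (D.kerχ i) y = x i := by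
  simp [forms]

/-- The extension of `χ_i` to the one-forms of the completion, with values in
`Γ(B_i) ⊗ Γ(H)`. -/
def χc (i : I) : D.forms →ₗ[ℂ] D.Local i :=
  (Ideal.kerLiftAlg (D.χΓ i)).toLinearMap ∘ₗ LinearMap.proj i ∘ₗ D.forms.subtype

/-- The horizontal one-forms `hor Γ_c¹(P)`: all `χ_i(γ)` lie in `Γ(B_i) ⊗ H`. -/
def horForms : Submodule ℂ D.forms :=
  ⨅ i, (horizontal (D.ΓB i) D.ΓH.toDifferentialCalculus).comap (D.χc i)

/-- The left action of `P` on the one-forms. -/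
def leftMul (p : P) : D.forms →ₗ[ℂ] D.forms :=
  (LinearMap.mulLeft ℂ (toCompletion D.kerχ (D.ΓP.incl p) :
    ∀ i, D.ΓP.carrier ⧸ D.kerχ i)).restrict (by
      intro x hx
      rw [mem_forms] at hx ⊢
      refine ⟨mul_mem (toCompletion D.kerχ (D.ΓP.incl p)).2 hx.1, fun i => ?_⟩
      obtain ⟨y, hy, e⟩ := hx.2 i
      refine ⟨D.ΓP.incl p * y, ?_, ?_⟩
      · simpa using SetLike.mul_mem_graded (D.ΓP.incl_mem p) hy
      · rw [map_mul, e]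
        rfl)

/-- The right action of `P` on the one-forms. -/
def rightMul (p : P) : D.forms →ₗ[ℂ] D.forms :=
  (LinearMap.mulRight ℂ (toCompletion D.kerχ (D.ΓP.incl p) :
    ∀ i, D.ΓP.carrier ⧸ D.kerχ i)).restrict (by
      intro x hx
      rw [mem_forms] at hx ⊢
      refine ⟨mul_mem hx.1 (toCompletion D.kerχ (D.ΓP.incl p)).2, fun i => ?_⟩
      obtain ⟨y, hy, e⟩ := hx.2 i
      refine ⟨y * D.ΓP.incl p, ?_, ?_⟩
      · simpa using SetLike.mul_mem_graded hy (D.ΓP.incl_mem p)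
      · rw [map_mul, e]
        rfl)

/-- The differential `p ↦ d p`, with values in the one-forms of the completion. -/
def dP : P →ₗ[ℂ] D.forms :=
  LinearMap.codRestrict D.forms
    (D.Completed.val.toLinearMap ∘ₗ (toCompletion D.kerχ).toLinearMap ∘ₗ D.ΓP.dB)
    (fun p => D.mem_forms.2 ⟨(toCompletion D.kerχ (D.ΓP.dB p)).2, fun _ =>
      ⟨D.ΓP.dB p, D.ΓP.d_mem 0 _ (D.ΓP.incl_mem p), rfl⟩⟩)

/-- The right coaction `id ⊗ Δ^Γ` on `Γ(B_i) ⊗ Γ(H)`. -/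
def localCoact (i : I) : D.Local i →ₗ[ℂ] D.Local i ⊗[ℂ] H :=
  (GradedTensorProduct.of ℂ (D.ΓB i).deg D.ΓH.deg).toLinearMap.rTensor H ∘ₗ
    (TensorProduct.assoc ℂ (D.ΓB i).carrier D.ΓH.carrier H).symm.toLinearMap ∘ₗ
      D.ΓH.coact.toLinearMap.lTensor (D.ΓB i).carrier ∘ₗ
        (GradedTensorProduct.of ℂ (D.ΓB i).deg D.ΓH.deg).symm.toLinearMap

/-- `t = Δ^{Γ_c}(γ)`. The coaction of `H` on the completion is the unique map with
`(χ_i ⊗ id) ∘ Δ^{Γ_c} = (id ⊗ Δ^Γ) ∘ χ_i` for all `i`. -/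
def IsCoactionOf (γ : D.forms) (t : D.forms ⊗[ℂ] H) : Prop :=
  ∀ i, (D.χc i).rTensor H t = D.localCoact i (D.χc i γ)

/-- `(f ⊗ id) ∘ Δ^{Γ_c} = Δ^{Γ_c} ∘ f`. -/
def IsCovariant (f : D.forms →ₗ[ℂ] D.forms) : Prop :=
  ∀ γ, ∃ t, D.IsCoactionOf γ t ∧ D.IsCoactionOf (f γ) (f.rTensor H t)

/-! ### Connections -/

/-- The conditions common to left and right connections: a covariant projection of the one-forms
onto the horizontal one-forms that respects the kernels of the `χ_i`. -/
structure IsProjection (f : D.forms →ₗ[ℂ] D.forms) : Prop where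
  range_eq : LinearMap.range f = D.horForms
  idem : ∀ γ, f (f γ) = f γ
  covariant : D.IsCovariant f
  ker_le : ∀ i γ, D.χc i γ = 0 → D.χc i (f γ) = 0

/-- A left connection. -/
structure LeftConnection where
  hor : D.forms →ₗ[ℂ] D.forms
  isProjection : D.IsProjection hor
  map_leftMul : ∀ p γ, hor (D.leftMul p γ) = D.leftMul p (hor γ)

/-- A right connection. -/
structure RightConnection where
  hor : D.forms →ₗ[ℂ] D.forms
  isProjection : D.IsProjection hor
  map_rightMul : ∀ p γ, hor (D.rightMul p γ) = D.rightMul p (hor γ)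

/-- The map `id ⊗ ε` on `Γ(B_i) ⊗ Γ(H)`. -/
def idCounit (i : I) : D.Local i →ₗ[ℂ] (D.ΓB i).carrier :=
  (TensorProduct.rid ℂ (D.ΓB i).carrier).toLinearMap ∘ₗ
    D.ΓH.counitΓ.lTensor (D.ΓB i).carrier ∘ₗ
      (GradedTensorProduct.of ℂ (D.ΓB i).deg D.ΓH.deg).symm.toLinearMap

variable (X) in
/-- A linear map `H → P` with `χ_i(p) = 1 ⊗ h` for the value `p` at `h`. -/
def liftH (i : I) : H →ₗ[ℂ] P :=
  ((X.χ i).toLinearMap.exists_rightInverse_of_surjective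
    (LinearMap.range_eq_top.2 (X.χ_surjective i))).choose ∘ₗ
      TensorProduct.mk ℂ (X.Loc i) H 1

variable (X) in
theorem χ_liftH (i : I) (h : H) : X.χ i (liftH X i h) = 1 ⊗ₜ h :=
  LinearMap.congr_fun ((X.χ i).toLinearMap.exists_rightInverse_of_surjective
    (LinearMap.range_eq_top.2 (X.χ_surjective i))).choose_spec (1 ⊗ₜ h)

/-- The local connection map `A_i(h) = -(id ⊗ ε) hor_i(1 ⊗ d h)`, where `hor_i` is the map that
`hor` induces on the one-forms of `Γ(B_i) ⊗ Γ(H)`, so that `hor_i ∘ χ_i = χ_i ∘ hor`. The one-form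
`d p` with `χ_i(p) = 1 ⊗ h` is used as a preimage of `1 ⊗ d h`; see `localMap_eq`. -/
def localMap (hor : D.forms →ₗ[ℂ] D.forms) (i : I) : H →ₗ[ℂ] (D.ΓB i).carrier :=
  -(D.idCounit i ∘ₗ D.χc i ∘ₗ hor ∘ₗ D.dP ∘ₗ liftH X i)

theorem χc_dP_liftH (i : I) (h : H) : D.χc i (D.dP (liftH X i h)) =
    GradedTensorProduct.includeRight (D.ΓB i).deg D.ΓH.deg (D.ΓH.d (D.ΓH.incl h)) := by
  have e : D.χc i (D.dP (liftH X i h)) = D.χΓ i (D.ΓP.d (D.ΓP.incl (liftH X i h))) := rfl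
  rw [e, D.χΓ_d, D.χΓ_incl, χ_liftH, skewD_right]

/-- The local connection map does not depend on the choice of the preimage of `1 ⊗ d h`. -/
theorem localMap_eq {hor : D.forms →ₗ[ℂ] D.forms} (hh : D.IsProjection hor) (i : I) (h : H)
    (γ : D.forms) (hγ : D.χc i γ =
      GradedTensorProduct.includeRight (D.ΓB i).deg D.ΓH.deg (D.ΓH.d (D.ΓH.incl h))) :
    D.localMap hor i h = -D.idCounit i (D.χc i (hor γ)) := by
  have h0 := hh.ker_le i (D.dP (liftH X i h) - γ) (by rw [map_sub, χc_dP_liftH, hγ, sub_self])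
  rw [map_sub, map_sub, sub_eq_zero] at h0
  simp [localMap, h0]

/-! ### Conditions on local connection maps -/

/-- The calculus `Γ(P) / (ker χ_i + ker χ_j)` over the overlap, which contains `Γ_m(B_ij)` as the
subalgebra generated by `b` and `d b`, `b ∈ B_ij`. -/
abbrev OverlapForms (i j : I) : Type _ := D.ΓP.carrier ⧸ (D.kerχ i ⊔ D.kerχ j)

/-- The projection `(π^i_j ⊗ id)_Γ` of `Γ(B_i) ⊗ Γ(H) = Γ(P) / ker χ_i`. -/
def projLeft (i j : I) : D.Local i →ₐ[ℂ] D.OverlapForms i j :=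
  (Ideal.Quotient.factorₐ ℂ (le_sup_left : D.kerχ i ≤ D.kerχ i ⊔ D.kerχ j)).comp
    (Ideal.quotientKerAlgEquivOfSurjective (D.χΓ_surjective i)).symm.toAlgHom

/-- The projection `(π^j_i ⊗ id)_Γ` of `Γ(B_j) ⊗ Γ(H) = Γ(P) / ker χ_j`. -/
def projRight (i j : I) : D.Local j →ₐ[ℂ] D.OverlapForms i j :=
  (Ideal.Quotient.factorₐ ℂ (le_sup_right : D.kerχ j ≤ D.kerχ i ⊔ D.kerχ j)).comp
    (Ideal.quotientKerAlgEquivOfSurjective (D.χΓ_surjective j)).symm.toAlgHom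

theorem d_mem_ker {i j : I} {x : D.ΓP.carrier} (hx : x ∈ D.kerχ i ⊔ D.kerχ j) :
    D.ΓP.d x ∈ D.kerχ i ⊔ D.kerχ j := by
  obtain ⟨y, hy, z, hz, rfl⟩ := Submodule.mem_sup.1 hx
  rw [map_add]
  refine Submodule.add_mem_sup ?_ ?_
  · rw [RingHom.mem_ker] at hy ⊢
    rw [D.χΓ_d, hy, map_zero]
  · rw [RingHom.mem_ker] at hz ⊢
    rw [D.χΓ_d, hz, map_zero]

/-- The differential of the calculus over the overlap. -/
def overlapD (i j : I) : D.OverlapForms i j →ₗ[ℂ] D.OverlapForms i j :=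
  (Submodule.Quotient.restrictScalarsEquiv ℂ (D.kerχ i ⊔ D.kerχ j)).toLinearMap ∘ₗ
    Submodule.mapQ _ _ D.ΓP.d (fun _ hx => D.d_mem_ker hx) ∘ₗ
      (Submodule.Quotient.restrictScalarsEquiv ℂ (D.kerχ i ⊔ D.kerχ j)).symm.toLinearMap

theorem incl_ι_mem_ker {i : I} {b : B} (hb : b ∈ X.J i) : D.ΓP.incl (X.ι b) ∈ D.kerχ i := by
  rw [RingHom.mem_ker, D.χΓ_incl, X.χ_ι, Ideal.Quotient.eq_zero_iff_mem.2 hb,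
    TensorProduct.zero_tmul, map_zero]

/-- The embedding of `B_ij` into the calculus over the overlap, induced by `ι`. -/
def overlapIncl (i j : I) : X.Overlap i j →ₐ[ℂ] D.OverlapForms i j :=
  Ideal.Quotient.liftₐ _ ((Ideal.Quotient.mkₐ ℂ (D.kerχ i ⊔ D.kerχ j)).comp
    (D.ΓP.incl.comp X.ι)) (by
      intro b hb
      obtain ⟨y, hy, z, hz, rfl⟩ := Submodule.mem_sup.1 hb
      refine Ideal.Quotient.eq_zero_iff_mem.2 ?_
      change D.ΓP.incl (X.ι (y + z)) ∈ _
      rw [map_add, map_add]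
      exact Submodule.add_mem_sup (D.incl_ι_mem_ker hy) (D.incl_ι_mem_ker hz))

/-- The compatibility condition
`π^i_j(A_i(h)) = ∑ τ_ij(h₁) π^j_i(A_j(h₂)) τ_ji(h₃) + ∑ τ_ij(h₁) d τ_ji(h₂)`. -/
def IsCompatible (τ : ∀ i j, H →ₐ[ℂ] X.Overlap i j)
    (A : ∀ i, H →ₗ[ℂ] (D.ΓB i).carrier) : Prop :=
  ∀ i j,
    (D.projLeft i j).toLinearMap ∘ₗ (inLeft _ _).toLinearMap ∘ₗ A i =
      convolve
        (convolve ((D.overlapIncl i j).comp (τ i j)).toLinearMap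
          ((D.projRight i j).toLinearMap ∘ₗ (inLeft _ _).toLinearMap ∘ₗ A j))
        ((D.overlapIncl i j).comp ((X.overlapSwap i j).comp (τ j i))).toLinearMap +
      convolve ((D.overlapIncl i j).comp (τ i j)).toLinearMap
        (D.overlapD i j ∘ₗ
          ((D.overlapIncl i j).comp ((X.overlapSwap i j).comp (τ j i))).toLinearMap)

/-- The kernel condition `R ⊆ ker A_i` of left connections. -/
def LeftKernel (hS : Function.Bijective (HopfAlgebra.antipode ℂ : H →ₗ[ℂ] H))
    (A : ∀ i, H →ₗ[ℂ] (D.ΓB i).carrier) : Prop :=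
  ∀ i, D.ΓH.rightIdeal hS ≤ LinearMap.ker (A i)

/-- The kernel condition `S⁻¹(R) ⊆ ker A_i` of right connections. -/
def RightKernel (hS : Function.Bijective (HopfAlgebra.antipode ℂ : H →ₗ[ℂ] H))
    (A : ∀ i, H →ₗ[ℂ] (D.ΓB i).carrier) : Prop :=
  ∀ i, (D.ΓH.rightIdeal hS).map (antipodeInv hS) ≤ LinearMap.ker (A i)

/-- The maps `A_i` take values in the one-forms of `B_i` and vanish at `1`. -/
def IsNormalized (A : ∀ i, H →ₗ[ℂ] (D.ΓB i).carrier) : Prop :=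
  (∀ i h, A i h ∈ (D.ΓB i).deg 1) ∧ ∀ i, A i 1 = 0

/-- The family `-A_i ∘ S`. -/
def negAntipode (A : ∀ i, H →ₗ[ℂ] (D.ΓB i).carrier) : ∀ i, H →ₗ[ℂ] (D.ΓB i).carrier :=
  fun i => -(A i ∘ₗ (HopfAlgebra.antipode ℂ : H →ₗ[ℂ] H))

end DifferentialStructure

end

/-!
Through `χ_i`, a projection `hor` is given by maps `hor_i` on `Γ(B_i) ⊗̂ Γ(H)`. Covariance forces
`hor_i (1 ⊗ dh) = -∑ A_i(h₁) ⊗ h₂`, so a left connection satisfies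
`hor_i (d (a ⊗ h)) = da ⊗ h - ∑ a A_i(h₁) ⊗ h₂`, and a right connection has `A_i(h₁) a` in place of
`a A_i(h₁)`. Hence the local connection maps determine the connection. Conversely, these formulas
define a map on the one-forms of `Γ(H)` exactly when `A_i` kills `R`, respectively `S⁻¹(R)`, and the
maps obtained over `i` and `j` glue exactly when the difference of the two sides over the overlap,
which is the convolution of an invertible map with the defect of the compatibility condition,
vanishes.

The transition function `τ_ji` is read off from `(π^i_j ⊗ id) χ_i` once this map is known to kill
`ker χ_j`. An element `p` of `ker χ_j` is replaced by its averages `∑ p₀ n(p₁)`, where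
`χ_i (n(h)) = 1 ⊗ ∑ S(h₁) φ(h₂)` for a functional `φ`: they stay in `ker χ_j` and become coinvariant
modulo `ker χ_i`, so that they come from the base up to elements of `ker χ_i ∩ ker χ_j`.
-/

noncomputable section

/-! ### Convolution and contraction of tensor products -/

theorem existsUnique_equiv_of_mem_range_iff {L R α : Type*} {f : L → α} {g : R → α} {N : α → α}
    (hf : Function.Injective f) (hg : Function.Injective g) (hN : Function.Bijective N)
    (h : ∀ a, a ∈ Set.range f ↔ N a ∈ Set.range g) : ∃! Φ : L ≃ R, ∀ l, g (Φ l) = N (f l) := by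
  choose φ hφ using fun l => (h (f l)).1 ⟨l, rfl⟩
  have bijective : Function.Bijective φ := by
    refine ⟨fun l l' eq => hf (hN.1 ((hφ l).symm.trans (eq ▸ hφ l'))), fun r => ?_⟩
    obtain ⟨a, ha⟩ := hN.2 (g r)
    obtain ⟨l, rfl⟩ := (h a).2 ⟨r, ha.symm⟩
    exact ⟨l, hg ((hφ l).trans ha)⟩
  exact ⟨Equiv.ofBijective φ bijective, hφ,
    fun Ψ hΨ => Equiv.ext fun l => hg ((hΨ l).trans (hφ l).symm)⟩

section Convolution

open Coalgebra HopfAlgebra WithConv LinearMap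

theorem sum_counit_smul_left {k H : Type*} [CommSemiring k] [AddCommMonoid H] [Module k H]
    [Coalgebra k H] {h : H} {ι : Type*} (r : Repr k h ι) :
    ∑ i ∈ r.index, counit (R := k) (r.right i) • r.left i = h := by
  simpa only [map_sum, TensorProduct.rid_tmul, one_smul] using
    congr(TensorProduct.rid k H $(sum_tmul_counit_eq (R := k) r))

variable {k H A : Type*} [CommSemiring k] [Semiring H] [HopfAlgebra k H] [Semiring A] [Algebra k A]

theorem toConv_algHom_mul_comp_antipode (f : H →ₐ[k] A) :
    toConv f.toLinearMap * toConv (f.toLinearMap ∘ₗ antipode k) = 1 := by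
  ext h
  rw [(ℛ k h).convMul_apply]
  simp [← map_mul, ← map_sum, sum_mul_antipode_eq_algebraMap_counit]

theorem toConv_comp_antipode_mul_algHom (f : H →ₐ[k] A) :
    toConv (f.toLinearMap ∘ₗ antipode k) * toConv f.toLinearMap = 1 := by
  ext h
  rw [(ℛ k h).convMul_apply]
  simp [← map_mul, ← map_sum, sum_antipode_mul_eq_algebraMap_counit]

theorem isUnit_toConv_algHom (f : H →ₐ[k] A) : IsUnit (toConv f.toLinearMap) :=
  ⟨⟨_, _, toConv_algHom_mul_comp_antipode f, toConv_comp_antipode_mul_algHom f⟩, rfl⟩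

theorem comp_antipode_eq_of_mul_eq_one {f g : H →ₐ[k] A}
    (h : toConv f.toLinearMap * toConv g.toLinearMap = 1) :
    f.toLinearMap ∘ₗ antipode k = g.toLinearMap :=
  toConv_injective (left_inv_eq_right_inv (toConv_comp_antipode_mul_algHom f) h)

-- Both sides are convolution inverses of `Δ = l * r`, where `l h = h ⊗ 1` and `r h = 1 ⊗ h`.
theorem comul_comp_antipode : (comul : H →ₗ[k] H ⊗[k] H) ∘ₗ antipode k =
    TensorProduct.map (antipode k) (antipode k) ∘ₗ (TensorProduct.comm k H H).toLinearMap ∘ₗ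
      comul := by
  let l : H →ₐ[k] H ⊗[k] H := Algebra.TensorProduct.includeLeft
  let r : H →ₐ[k] H ⊗[k] H := Algebra.TensorProduct.includeRight
  have comul_eq : toConv (comul : H →ₗ[k] H ⊗[k] H) =
      toConv l.toLinearMap * toConv r.toLinearMap := by
    ext h
    rw [(ℛ k h).convMul_apply]
    simp [l, r, (ℛ k h).eq]
  have flip_eq : toConv (TensorProduct.map (antipode k) (antipode k) ∘ₗ
      (TensorProduct.comm k H H).toLinearMap ∘ₗ comul) =
      toConv (r.toLinearMap ∘ₗ antipode k) * toConv (l.toLinearMap ∘ₗ antipode k) := by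
    ext h
    rw [(ℛ k h).convMul_apply]
    simp [l, r, ← (ℛ k h).eq]
  refine toConv_injective (left_inv_eq_right_inv
    (toConv_comp_antipode_mul_algHom (Bialgebra.comulAlgHom k H)) ?_)
  change toConv (comul : H →ₗ[k] H ⊗[k] H) * _ = 1
  rw [comul_eq, flip_eq, mul_assoc, ← mul_assoc (toConv r.toLinearMap),
    toConv_algHom_mul_comp_antipode, one_mul, toConv_algHom_mul_comp_antipode]

end Convolution

section Antipode

open Coalgebra HopfAlgebra WithConv

variable {H A : Type*} [Ring H] [HopfAlgebra ℂ H] [Ring A] [Algebra ℂ A]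

theorem toConv_convolve (f g : H →ₗ[ℂ] A) : toConv (convolve f g) = toConv f * toConv g := rfl

theorem convolve_repr {h : H} {ι : Type*} (r : Repr ℂ h ι) (f g : H →ₗ[ℂ] A) :
    convolve f g h = ∑ i ∈ r.index, f (r.left i) * g (r.right i) := by
  simp [convolve, ← r.eq]

theorem convolve_comp_antipode {f g : H →ₗ[ℂ] A} (hc : ∀ x y, Commute (f x) (g y)) :
    convolve f g ∘ₗ antipode ℂ = convolve (g ∘ₗ antipode ℂ) (f ∘ₗ antipode ℂ) := by
  ext h
  have comul_antipode := LinearMap.congr_fun (comul_comp_antipode (k := ℂ) (H := H)) h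
  rw [LinearMap.comp_apply] at comul_antipode
  rw [convolve_repr (ℛ ℂ h)]
  simp only [convolve, LinearMap.comp_apply, comul_antipode, ← (ℛ ℂ h).eq, map_sum]
  exact Finset.sum_congr rfl fun i _ => hc _ _

variable (hS : Function.Bijective (antipode ℂ : H →ₗ[ℂ] H))

@[simp]
theorem antipode_antipodeInv (h : H) : antipode ℂ (antipodeInv hS h) = h :=
  (LinearEquiv.ofBijective (antipode ℂ : H →ₗ[ℂ] H) hS).apply_symm_apply h

@[simp]
theorem antipodeInv_antipode (h : H) : antipodeInv hS (antipode ℂ h) = h :=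
  (LinearEquiv.ofBijective (antipode ℂ : H →ₗ[ℂ] H) hS).symm_apply_apply h

@[simp]
theorem counit_antipodeInv (h : H) : counit (R := ℂ) (antipodeInv hS h) = counit (R := ℂ) h := by
  conv_rhs => rw [← antipode_antipodeInv hS h, counit_antipode]

theorem antipodeInv_mul (x y : H) :
    antipodeInv hS (x * y) = antipodeInv hS y * antipodeInv hS x :=
  hS.1 (by simp only [antipode_mul_antidistrib, antipode_antipodeInv])

theorem sum_antipodeInv_mul {h : H} {ι : Type*} (r : Repr ℂ h ι) :
    ∑ i ∈ r.index, antipodeInv hS (r.right i) * r.left i = algebraMap ℂ H (counit (R := ℂ) h) := by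
  apply hS.1
  simp only [map_sum, antipode_mul_antidistrib, antipode_antipodeInv]
  rw [sum_antipode_mul_eq_algebraMap_counit, Algebra.algebraMap_eq_smul_one, map_smul, antipode_one]

end Antipode

section Contraction

variable {k V W M : Type*} [CommSemiring k] [AddCommMonoid V] [Module k V] [AddCommMonoid W]
  [Module k W] [AddCommMonoid M] [Module k M]

/-- The contraction `v ⊗ m ↦ φ(m) v` of the second tensor factor with a functional. -/
def contract (φ : M →ₗ[k] k) : V ⊗[k] M →ₗ[k] V :=
  (TensorProduct.rid k V).toLinearMap ∘ₗ φ.lTensor V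

@[simp]
theorem contract_tmul (φ : M →ₗ[k] k) (v : V) (m : M) : contract φ (v ⊗ₜ[k] m) = φ m • v := by
  simp [contract]

theorem contract_rTensor (φ : M →ₗ[k] k) (f : V →ₗ[k] W) (t : V ⊗[k] M) :
    contract φ (f.rTensor M t) = f (contract φ t) := by
  induction t with
  | zero => simp only [map_zero]
  | add x y hx hy => simp only [map_add, hx, hy]
  | tmul v m => simp

end Contraction

section CofreeCoaction

open Coalgebra

variable {k H V W : Type*} [CommSemiring k] [AddCommMonoid H] [Module k H] [Coalgebra k H]
  [AddCommMonoid V] [Module k V] [AddCommMonoid W] [Module k W]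

variable (k H V) in
/-- The coaction `id ⊗ Δ` of the cofree right comodule `V ⊗ H`. -/
def cofreeCoact : V ⊗[k] H →ₗ[k] (V ⊗[k] H) ⊗[k] H :=
  (TensorProduct.assoc k V H H).symm.toLinearMap ∘ₗ comul.lTensor V

theorem cofreeCoact_tmul (v : V) {h : H} {ι : Type*} (r : Repr k h ι) :
    cofreeCoact k H V (v ⊗ₜ h) = ∑ i ∈ r.index, (v ⊗ₜ r.left i) ⊗ₜ r.right i := by
  simp [cofreeCoact, ← r.eq, TensorProduct.tmul_sum]

theorem contract_counit_cofreeCoact (t : V ⊗[k] H) :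
    contract counit (cofreeCoact k H V t) = t := by
  induction t with
  | zero => simp only [map_zero]
  | add x y hx hy => simp only [map_add, hx, hy]
  | tmul v h =>
    simp only [cofreeCoact_tmul v (ℛ k h), map_sum, contract_tmul, ← TensorProduct.tmul_smul,
      ← TensorProduct.tmul_sum, sum_counit_smul_left]

theorem rTensor_rTensor_cofreeCoact (f : V →ₗ[k] W) (t : V ⊗[k] H) :
    (f.rTensor H).rTensor H (cofreeCoact k H V t) = cofreeCoact k H W (f.rTensor H t) := by
  induction t with
  | zero => simp only [map_zero]
  | add x y hx hy => simp only [map_add, hx, hy]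
  | tmul v h => simp [cofreeCoact_tmul _ (ℛ k h)]

theorem rTensor_contract_counit_cofreeCoact (t : V ⊗[k] H) :
    (contract counit).rTensor H (cofreeCoact k H V t) = t := by
  induction t with
  | zero => simp only [map_zero]
  | add x y hx hy => simp only [map_add, hx, hy]
  | tmul v h =>
    simp only [cofreeCoact_tmul v (ℛ k h), map_sum, LinearMap.rTensor_tmul, contract_tmul,
      TensorProduct.smul_tmul, ← TensorProduct.tmul_sum, sum_counit_smul]

theorem eq_of_rTensor_cofreeCoact {f : V ⊗[k] H →ₗ[k] W ⊗[k] H}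
    (hf : ∀ t, f.rTensor H (cofreeCoact k H V t) = cofreeCoact k H W (f t)) (t : V ⊗[k] H) :
    f t = (contract counit ∘ₗ f).rTensor H (cofreeCoact k H V t) := by
  rw [LinearMap.rTensor_comp_apply, hf, rTensor_contract_counit_cofreeCoact]

theorem cofreeCoact_cofreeCoact (t : V ⊗[k] H) :
    cofreeCoact k H (V ⊗[k] H) (cofreeCoact k H V t) =
      (cofreeCoact k H V).rTensor H (cofreeCoact k H V t) := by
  induction t with
  | zero => simp only [map_zero]
  | add x y hx hy => simp only [map_add, hx, hy]
  | tmul v h =>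
    have coassoc := congrArg
      (fun t : H ⊗[k] (H ⊗[k] H) => (TensorProduct.assoc k (V ⊗[k] H) H H).symm
        ((TensorProduct.mk k V H v).rTensor (H ⊗[k] H) t))
      (sum_tmul_tmul_eq (ℛ k h) (fun _ => ℛ k _) (fun _ => ℛ k _))
    simp only [map_sum, LinearMap.rTensor_tmul, TensorProduct.mk_apply,
      TensorProduct.assoc_symm_tmul] at coassoc
    simp only [cofreeCoact_tmul _ (ℛ k _), map_sum, LinearMap.rTensor_tmul, TensorProduct.sum_tmul,
      coassoc]

end CofreeCoaction

section Subspace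

variable {k V W M : Type*} [Field k] [AddCommGroup V] [Module k V] [AddCommGroup W] [Module k W]
  [AddCommGroup M] [Module k M]

theorem equivFinsuppOfBasisRight_apply_eq_contract {ι : Type*} [DecidableEq ι]
    (b : Module.Basis ι k M) (j : ι) (t : V ⊗[k] M) :
    TensorProduct.equivFinsuppOfBasisRight b t j = contract (b.coord j) t := by
  induction t with
  | zero => simp
  | add x y hx hy => simp [hx, hy]
  | tmul v m => simp

theorem exists_comp_eq_of_ker_le {f : V →ₗ[k] W} {g : V →ₗ[k] M}
    (h : LinearMap.ker f ≤ LinearMap.ker g) : ∃ F : W →ₗ[k] M, F ∘ₗ f = g := by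
  obtain ⟨l, hl⟩ := ((LinearMap.ker f).liftQ f le_rfl).exists_leftInverse_of_injective
    ((LinearMap.ker f).ker_liftQ_eq_bot f le_rfl le_rfl)
  refine ⟨(LinearMap.ker f).liftQ g h ∘ₗ l, LinearMap.ext fun v => ?_⟩
  exact congrArg ((LinearMap.ker f).liftQ g h) (LinearMap.congr_fun hl (Submodule.Quotient.mk v))

variable (M) in
/-- The subspace `K ⊗ M` of `V ⊗ M` spanned by a subspace `K` of `V`. -/
def rTensorSubmodule (K : Submodule k V) : Submodule k (V ⊗[k] M) :=
  LinearMap.range (K.subtype.rTensor M)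

theorem rTensorSubmodule_le {K : Submodule k V} {N : Submodule k (V ⊗[k] M)} :
    rTensorSubmodule M K ≤ N ↔ ∀ v ∈ K, ∀ m, v ⊗ₜ m ∈ N := by
  refine ⟨fun h v hv m => h ⟨(⟨v, hv⟩ : K) ⊗ₜ m, rfl⟩, ?_⟩
  rintro h _ ⟨s, rfl⟩
  induction s with
  | zero => simp
  | add x y hx hy => simpa using add_mem hx hy
  | tmul v m => exact h v v.2 m

theorem mem_rTensorSubmodule_iff_contract {K : Submodule k V} {t : V ⊗[k] M} :
    t ∈ rTensorSubmodule M K ↔ ∀ φ : M →ₗ[k] k, contract φ t ∈ K := by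
  constructor
  · intro ht φ
    exact rTensorSubmodule_le (N := K.comap (contract φ)).2
      (fun v hv m => by simpa using K.smul_mem _ hv) ht
  · intro ht
    classical
    let b := Module.Basis.ofVectorSpace k M
    let e := TensorProduct.equivFinsuppOfBasisRight (M := V) b
    refine ⟨∑ j ∈ (e t).support, (⟨contract (b.coord j) t, ht _⟩ : K) ⊗ₜ b j, e.injective ?_⟩
    ext l
    simp only [e, equivFinsuppOfBasisRight_apply_eq_contract, map_sum]
    simp +contextual [Finsupp.single_apply, equivFinsuppOfBasisRight_apply_eq_contract, eq_comm]

theorem rTensorSubmodule_inf (K L : Submodule k V) :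
    rTensorSubmodule M (K ⊓ L) = rTensorSubmodule M K ⊓ rTensorSubmodule M L := by
  ext t
  simp only [Submodule.mem_inf, mem_rTensorSubmodule_iff_contract, forall_and]

theorem eq_zero_of_contract {t : V ⊗[k] M} (ht : ∀ φ : M →ₗ[k] k, contract φ t = 0) : t = 0 := by
  have hle : rTensorSubmodule M (⊥ : Submodule k V) ≤ ⊥ :=
    rTensorSubmodule_le.2 fun v hv m => by simp [(Submodule.mem_bot k).1 hv]
  exact hle (mem_rTensorSubmodule_iff_contract.2 ht)

theorem mem_rTensorSubmodule_ker {f : V →ₗ[k] W} {t : V ⊗[k] M} :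
    t ∈ rTensorSubmodule M (LinearMap.ker f) ↔ f.rTensor M t = 0 := by
  simp only [mem_rTensorSubmodule_iff_contract, LinearMap.mem_ker, ← contract_rTensor]
  exact ⟨eq_zero_of_contract, fun h φ => by rw [h, map_zero]⟩

theorem rTensorSubmodule_range (f : V →ₗ[k] W) :
    rTensorSubmodule M (LinearMap.range f) = LinearMap.range (f.rTensor M) := by
  conv_rhs => rw [← f.subtype_comp_codRestrict (LinearMap.range f) f.mem_range_self]
  rw [LinearMap.rTensor_comp, LinearMap.range_comp_of_range_eq_top]
  · rfl
  · exact LinearMap.range_eq_top.2 (LinearMap.rTensor_surjective M f.surjective_rangeRestrict)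

theorem exists_rTensor_eq {ι : Type*} [Finite ι] {U : ι → Type*} [∀ i, AddCommGroup (U i)]
    [∀ i, Module k (U i)] (f : ∀ i, V →ₗ[k] U i) (u : ∀ i, U i ⊗[k] M)
    (hu : ∀ φ : M →ₗ[k] k, ∃ v, ∀ i, f i v = contract φ (u i)) :
    ∃ t : V ⊗[k] M, ∀ i, (f i).rTensor M t = u i := by
  classical
  have := Fintype.ofFinite ι
  have hmem : ∑ i, (LinearMap.single k U i).rTensor M (u i) ∈
      LinearMap.range ((LinearMap.pi f).rTensor M) := by
    rw [← rTensorSubmodule_range, mem_rTensorSubmodule_iff_contract]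
    intro φ
    obtain ⟨v, hv⟩ := hu φ
    refine ⟨v, funext fun i => ?_⟩
    simp [contract_rTensor, hv]
  obtain ⟨t, ht⟩ := hmem
  refine ⟨t, fun i => ?_⟩
  have h := congrArg ((LinearMap.proj i).rTensor M) ht
  rw [← LinearMap.rTensor_comp_apply, LinearMap.proj_pi, map_sum] at h
  rw [h, Finset.sum_eq_single i]
  · rw [← LinearMap.rTensor_comp_apply, LinearMap.proj_comp_single_same]
    simp
  · intro j _ hj
    rw [← LinearMap.rTensor_comp_apply, LinearMap.proj_comp_single_ne _ _ _ _ hj.symm]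
    simp
  · simp

end Subspace

section TensorAlgebra

variable {k A M : Type*} [Field k] [Ring A] [Algebra k A]

theorem mul_mem_rTensorSubmodule [Ring M] [Algebra k M] {K L N : Submodule k A}
    (h : ∀ x ∈ K, ∀ y ∈ L, x * y ∈ N) {s t : A ⊗[k] M} (hs : s ∈ rTensorSubmodule M K)
    (ht : t ∈ rTensorSubmodule M L) : s * t ∈ rTensorSubmodule M N := by
  refine rTensorSubmodule_le (N := (rTensorSubmodule M N).comap (LinearMap.mulRight k t)).2
    (fun x hx m => ?_) hs
  refine rTensorSubmodule_le (N := (rTensorSubmodule M N).comap (LinearMap.mulLeft k (x ⊗ₜ m))).2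
    (fun y hy n => ?_) ht
  exact ⟨(⟨x * y, h x hx y hy⟩ : N) ⊗ₜ (m * n), by simp⟩

theorem commute_rTensor_tmul_one {V : Type*} [AddCommGroup V] [Module k V] [Ring M] [Algebra k M]
    {f : V →ₗ[k] A} {a : A} (h : ∀ v, Commute (f v) a) (t : V ⊗[k] M) :
    Commute (f.rTensor M t) (a ⊗ₜ 1) := by
  induction t with
  | zero => simp
  | add x y hx hy => rw [map_add]; exact hx.add_left hy
  | tmul v m => simp [Commute, SemiconjBy, (h v).eq]

theorem tmul_one_injective {H V : Type*} [Ring H] [HopfAlgebra ℂ H] [AddCommGroup V]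
    [Module ℂ V] :
    Function.Injective fun v : V => v ⊗ₜ[ℂ] (1 : H) := fun v w h => by
  simpa using congr(contract (Coalgebra.counit (R := ℂ) (A := H)) $h)

end TensorAlgebra

/-! ### Averaging, and the kernels of the trivializations -/

section Averaging

variable {H A : Type*} [Ring H] [HopfAlgebra ℂ H] [Ring A] [Algebra ℂ A]

/-- A subspace of a comodule algebra that is stable under right multiplication and under the
coaction `Δ`. -/
structure IsHopfSubmodule (Δ : A →ₐ[ℂ] A ⊗[ℂ] H) (K : Submodule ℂ A) : Prop where
  mul_mem : ∀ k ∈ K, ∀ a, k * a ∈ K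
  coact_mem : ∀ k ∈ K, Δ k ∈ rTensorSubmodule H K

/-- The elements of a comodule algebra that become coinvariant modulo the subspace `K`. -/
def coinvariantsModulo (Δ : A →ₐ[ℂ] A ⊗[ℂ] H) (K : Submodule ℂ A) : Submodule ℂ A :=
  (rTensorSubmodule H K).comap (Δ.toLinearMap - (TensorProduct.mk ℂ A H).flip 1)

/-- The map `a ↦ ∑ a₀ n(a₁)`, where `∑ a₀ ⊗ a₁` is the coaction `Δ` at `a`. -/
def average (Δ : A →ₐ[ℂ] A ⊗[ℂ] H) (n : H →ₗ[ℂ] A) : A →ₗ[ℂ] A :=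
  LinearMap.mul' ℂ A ∘ₗ n.lTensor A ∘ₗ Δ.toLinearMap

variable {Δ : A →ₐ[ℂ] A ⊗[ℂ] H} {K L : Submodule ℂ A}

theorem mem_coinvariantsModulo {a : A} :
    a ∈ coinvariantsModulo Δ K ↔ Δ a - a ⊗ₜ 1 ∈ rTensorSubmodule H K := Iff.rfl

theorem mem_coinvariantsModulo_bot {a : A} : a ∈ coinvariantsModulo Δ ⊥ ↔ Δ a = a ⊗ₜ 1 := by
  rw [mem_coinvariantsModulo, ← LinearMap.ker_id, mem_rTensorSubmodule_ker, LinearMap.rTensor_id,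
    LinearMap.id_apply, sub_eq_zero]

theorem coinvariantsModulo_inf :
    coinvariantsModulo Δ (K ⊓ L) = coinvariantsModulo Δ K ⊓ coinvariantsModulo Δ L := by
  rw [coinvariantsModulo, rTensorSubmodule_inf, Submodule.comap_inf]
  rfl

theorem lTensor_mul_mem (hK : ∀ k ∈ K, ∀ a, k * a ∈ K) (n : H →ₗ[ℂ] A) {t : A ⊗[ℂ] H}
    (ht : t ∈ rTensorSubmodule H K) : LinearMap.mul' ℂ A (n.lTensor A t) ∈ K :=
  rTensorSubmodule_le (N := K.comap (LinearMap.mul' ℂ A ∘ₗ n.lTensor A)).2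
    (fun k hk h => by simpa using hK k hk (n h)) ht

namespace IsHopfSubmodule

theorem inf (hK : IsHopfSubmodule Δ K) (hL : IsHopfSubmodule Δ L) :
    IsHopfSubmodule Δ (K ⊓ L) where
  mul_mem k hk a := ⟨hK.mul_mem k hk.1 a, hL.mul_mem k hk.2 a⟩
  coact_mem k hk := by
    rw [rTensorSubmodule_inf]
    exact ⟨hK.coact_mem k hk.1, hL.coact_mem k hk.2⟩

theorem le_coinvariantsModulo (hK : IsHopfSubmodule Δ K) : K ≤ coinvariantsModulo Δ K :=
  fun k hk => sub_mem (hK.coact_mem k hk) (rTensorSubmodule_le.1 le_rfl k hk 1)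

theorem average_mem (hK : IsHopfSubmodule Δ K) (n : H →ₗ[ℂ] A) {k : A} (hk : k ∈ K) :
    average Δ n k ∈ K :=
  lTensor_mul_mem hK.mul_mem n (hK.coact_mem k hk)

theorem average_sub_mem (hK : IsHopfSubmodule Δ K) {n : H →ₗ[ℂ] A} (hn : n 1 = 1) {a : A}
    (ha : a ∈ coinvariantsModulo Δ K) : average Δ n a - a ∈ K := by
  simpa [average, hn] using lTensor_mul_mem hK.mul_mem n (mem_coinvariantsModulo.1 ha)

end IsHopfSubmodule

end Averaging

namespace LocallyTrivialQPFB

open Coalgebra HopfAlgebra WithConv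

variable {I H B P : Type*} [Ring H] [HopfAlgebra ℂ H] [Ring B] [Algebra ℂ B]
  [Ring P] [Algebra ℂ P] (X : LocallyTrivialQPFB I H B P)

theorem χ_rTensor_coact (i : I) (p : P) : (X.χ i).toLinearMap.rTensor H (X.coact p) =
    cofreeCoact ℂ H (X.Loc i) (X.χ i p) := by
  rw [cofreeCoact, LinearMap.comp_apply, X.χ_covariant, LinearEquiv.coe_coe,
    LinearEquiv.symm_apply_apply]

theorem isHopfSubmodule_ker (i : I) :
    IsHopfSubmodule X.coact (LinearMap.ker (X.χ i).toLinearMap) where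
  mul_mem k hk p := by
    rw [LinearMap.mem_ker, AlgHom.toLinearMap_apply] at hk ⊢
    rw [map_mul, hk, zero_mul]
  coact_mem k hk := by
    rw [LinearMap.mem_ker, AlgHom.toLinearMap_apply] at hk
    rw [mem_rTensorSubmodule_ker, χ_rTensor_coact, hk, map_zero]

theorem mem_coinvariantsModulo_ker {i : I} {p : P} {a : X.Loc i} (hp : X.χ i p = a ⊗ₜ 1) :
    p ∈ coinvariantsModulo X.coact (LinearMap.ker (X.χ i).toLinearMap) := by
  rw [mem_coinvariantsModulo, mem_rTensorSubmodule_ker, map_sub, χ_rTensor_coact, hp]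
  simp [cofreeCoact, Algebra.TensorProduct.one_def, hp]

theorem χ_average {i : I} {n : H →ₗ[ℂ] P} {m : H →ₗ[ℂ] H} (hn : ∀ h, X.χ i (n h) = 1 ⊗ₜ m h)
    (p : P) : X.χ i (average X.coact n p) =
      (convolve LinearMap.id m).lTensor (X.Loc i) (X.χ i p) := by
  let f : X.Loc i ⊗[ℂ] H →ₗ[ℂ] H →ₗ[ℂ] X.Loc i ⊗[ℂ] H :=
    (LinearMap.mul ℂ (X.Loc i ⊗[ℂ] H)).compl₂ (TensorProduct.mk ℂ (X.Loc i) H 1 ∘ₗ m)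
  have hχ : (X.χ i).toLinearMap ∘ₗ LinearMap.mul' ℂ P ∘ₗ n.lTensor P =
      TensorProduct.lift f ∘ₗ (X.χ i).toLinearMap.rTensor H := by
    ext p h
    simp [f, hn]
  have hf : TensorProduct.lift f ∘ₗ cofreeCoact ℂ H (X.Loc i) =
      (convolve LinearMap.id m).lTensor (X.Loc i) := by
    refine TensorProduct.ext' fun a h => ?_
    rw [LinearMap.lTensor_tmul, convolve_repr (ℛ ℂ h), LinearMap.comp_apply,
      cofreeCoact_tmul a (ℛ ℂ h)]
    simp [f, TensorProduct.tmul_sum]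
  calc X.χ i (average X.coact n p)
      = TensorProduct.lift f ((X.χ i).toLinearMap.rTensor H (X.coact p)) :=
        LinearMap.congr_fun hχ (X.coact p)
    _ = _ := by
        rw [χ_rTensor_coact]
        exact LinearMap.congr_fun hf (X.χ i p)

-- The averaging map is built on `n(h) = ∑ S(h₁) φ(h₂)`, for which `id * n = φ`.
theorem exists_average (i : I) (φ : H →ₗ[ℂ] ℂ) : ∃ n : H →ₗ[ℂ] P,
    n 1 = algebraMap ℂ P (φ 1) ∧ ∀ p, X.χ i (average X.coact n p) = contract φ (X.χ i p) ⊗ₜ 1 := by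
  let m : H →ₗ[ℂ] H := convolve (antipode ℂ) (Algebra.linearMap ℂ H ∘ₗ φ)
  have id_mul_m : convolve LinearMap.id m = Algebra.linearMap ℂ H ∘ₗ φ := by
    apply toConv_injective
    rw [toConv_convolve, toConv_convolve, ← mul_assoc, LinearMap.id_mul_antipode, one_mul]
  have m_one : m 1 = algebraMap ℂ H (φ 1) := by
    simp [m, convolve, Algebra.TensorProduct.one_def]
  let l : H →ₗ[ℂ] P := DifferentialStructure.liftH X i ∘ₗ m
  let n : H →ₗ[ℂ] P := l + LinearMap.toSpanSingleton ℂ P (algebraMap ℂ P (φ 1) - l 1) ∘ₗ counit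
  have χ_n (h : H) : X.χ i (n h) = 1 ⊗ₜ m h := by
    simp [n, l, DifferentialStructure.χ_liftH, m_one, Algebra.algebraMap_eq_smul_one,
      Algebra.TensorProduct.one_def]
  refine ⟨n, by simp [n], fun p => ?_⟩
  rw [X.χ_average χ_n, id_mul_m]
  induction X.χ i p with
  | zero => simp
  | add x y hx hy => simp only [map_add, hx, hy, TensorProduct.add_tmul]
  | tmul a h => simp [Algebra.algebraMap_eq_smul_one, TensorProduct.smul_tmul]

-- Averaging over one trivialization after the other makes an element coinvariant without
-- changing it modulo `K`.
theorem exists_mem_coinvariantsModulo {K : Submodule ℂ P} (hK : IsHopfSubmodule X.coact K)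
    {p : P} (hp : p ∈ coinvariantsModulo X.coact K) (s : Finset I) :
    ∃ q, p - q ∈ K ∧ q ∈ coinvariantsModulo X.coact
      (s.inf (fun i => LinearMap.ker (X.χ i).toLinearMap) ⊓ K) := by
  classical
  have hopf (s : Finset I) : IsHopfSubmodule X.coact
      (s.inf (fun i => LinearMap.ker (X.χ i).toLinearMap) ⊓ K) := by
    induction s using Finset.induction_on with
    | empty => simpa using hK
    | insert i s _ ih => simpa [inf_assoc] using (X.isHopfSubmodule_ker i).inf ih
  induction s using Finset.induction_on with
  | empty => exact ⟨p, by simp, by simpa using hp⟩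
  | insert i s _ ih =>
    obtain ⟨q, hpq, hq⟩ := ih
    obtain ⟨n, n_one, χ_avg⟩ := X.exists_average i counit
    have avg_sub := (hopf s).average_sub_mem (n_one.trans (by simp)) hq
    refine ⟨average X.coact n q, ?_, ?_⟩
    · simpa using sub_mem hpq avg_sub.2
    · rw [Finset.inf_insert, inf_assoc, coinvariantsModulo_inf]
      refine ⟨X.mem_coinvariantsModulo_ker (χ_avg q), ?_⟩
      simpa using add_mem ((hopf s).le_coinvariantsModulo avg_sub) hq

theorem exists_coinvariant [Finite I] {K : Submodule ℂ P} (hK : IsHopfSubmodule X.coact K) {p : P}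
    (hp : p ∈ coinvariantsModulo X.coact K) : ∃ b, p - X.ι b ∈ K := by
  have := Fintype.ofFinite I
  obtain ⟨q, hpq, hq⟩ := X.exists_mem_coinvariantsModulo hK hp Finset.univ
  have inf_ker : Finset.univ.inf (fun i => LinearMap.ker (X.χ i).toLinearMap) = ⊥ := by
    rw [Finset.inf_univ_eq_iInf, eq_bot_iff]
    intro k hk
    have hk' : k ∈ (⊥ : Ideal P) := by
      rw [← X.complete_total.1]
      simpa using hk
    exact hk'
  rw [inf_ker, bot_inf_eq, mem_coinvariantsModulo_bot] at hq
  obtain ⟨b, rfl⟩ := (X.range_ι q).2 hq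
  exact ⟨b, hpq⟩

theorem mem_sup_of_χ_eq [Finite I] {i j : I} {p : P} {b : B} (hj : X.χ j p = 0)
    (hi : X.χ i p = Ideal.Quotient.mk (X.J i) b ⊗ₜ 1) : b ∈ X.J i ⊔ X.J j := by
  have coinv : p ∈ coinvariantsModulo X.coact
      (LinearMap.ker (X.χ i).toLinearMap ⊓ LinearMap.ker (X.χ j).toLinearMap) := by
    rw [coinvariantsModulo_inf]
    exact ⟨X.mem_coinvariantsModulo_ker hi, (X.isHopfSubmodule_ker j).le_coinvariantsModulo hj⟩
  obtain ⟨c, hci, hcj⟩ := X.exists_coinvariant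
    ((X.isHopfSubmodule_ker i).inf (X.isHopfSubmodule_ker j)) coinv
  rw [SetLike.mem_coe, LinearMap.mem_ker, AlgHom.toLinearMap_apply, map_sub, χ_ι,
    sub_eq_zero] at hci hcj
  rw [hi] at hci
  rw [hj] at hcj
  have hbc : b - c ∈ X.J i := Ideal.Quotient.eq.1 (tmul_one_injective hci)
  have hc : c ∈ X.J j := Ideal.Quotient.eq_zero_iff_mem.1
    (tmul_one_injective (H := H) (by simpa using hcj.symm))
  simpa using Submodule.add_mem_sup hbc hc

theorem resLeft_χ_eq_zero [Finite I] {i j : I} {p : P} (hj : X.χ j p = 0) :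
    (X.resLeft i j).toLinearMap.rTensor H (X.χ i p) = 0 := by
  refine eq_zero_of_contract fun φ => ?_
  obtain ⟨n, -, χ_avg⟩ := X.exists_average i φ
  obtain ⟨b, hb⟩ := Ideal.Quotient.mk_surjective (contract φ (X.χ i p))
  have avg_mem := (X.isHopfSubmodule_ker j).average_mem n (k := p) hj
  rw [contract_rTensor, ← hb]
  exact Ideal.Quotient.eq_zero_iff_mem.2
    (X.mem_sup_of_χ_eq avg_mem ((χ_avg p).trans (by rw [← hb])))

end LocallyTrivialQPFB

/-! ### Transition functions -/

namespace LocallyTrivialQPFB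

open Coalgebra HopfAlgebra WithConv

section Twist

variable {H A : Type*} [Ring H] [HopfAlgebra ℂ H] [Ring A] [Algebra ℂ A]

theorem twist_tmul (t : H →ₐ[ℂ] A) (a : A) {h : H} {ι : Type*} (r : Repr ℂ h ι) :
    twist t (a ⊗ₜ h) = ∑ k ∈ r.index, (a * t (r.left k)) ⊗ₜ[ℂ] r.right k := by
  simp [twist, ← r.eq, TensorProduct.tmul_sum]

theorem twist_eq_rTensor_cofreeCoact (t : H →ₐ[ℂ] A) (z : A ⊗[ℂ] H) :
    twist t z =
      (LinearMap.mul' ℂ A ∘ₗ t.toLinearMap.lTensor A).rTensor H (cofreeCoact ℂ H A z) := by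
  induction z with
  | zero => simp only [map_zero]
  | add x y hx hy => simp only [map_add, hx, hy]
  | tmul a h => simp [twist_tmul t a (ℛ ℂ h), cofreeCoact_tmul a (ℛ ℂ h)]

theorem contract_counit_twist (t : H →ₐ[ℂ] A) (z : A ⊗[ℂ] H) :
    contract counit (twist t z) = LinearMap.mul' ℂ A (t.toLinearMap.lTensor A z) := by
  rw [twist_eq_rTensor_cofreeCoact, contract_rTensor, contract_counit_cofreeCoact]
  rfl

theorem contract_counit_twist_twist (s t : H →ₐ[ℂ] A) (h : H) :
    contract counit (twist t (twist s (1 ⊗ₜ h))) = convolve s.toLinearMap t.toLinearMap h := by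
  rw [contract_counit_twist, twist_tmul _ _ (ℛ ℂ h), convolve_repr (ℛ ℂ h)]
  simp

end Twist

variable {I H B P : Type*} [Ring H] [HopfAlgebra ℂ H] [Ring B] [Algebra ℂ B]
  [Ring P] [Algebra ℂ P] (X : LocallyTrivialQPFB I H B P)

theorem overlapSwap_comp_overlapSwap (i j : I) :
    (X.overlapSwap i j).comp (X.overlapSwap j i) = AlgHom.id ℂ (X.Overlap i j) := by
  ext x
  obtain ⟨b, rfl⟩ := Ideal.Quotient.mk_surjective x
  rfl

theorem overlapSwap_comp_comp (i j : I) (t : H →ₐ[ℂ] X.Overlap i j) :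
    (X.overlapSwap i j).comp ((X.overlapSwap j i).comp t) = t := by
  rw [← AlgHom.comp_assoc, overlapSwap_comp_overlapSwap, AlgHom.id_comp]

theorem exists_changeOfTrivialization [Finite I] (i j : I) :
    ∃ Ψ : X.Loc j ⊗[ℂ] H →ₐ[ℂ] X.Overlap i j ⊗[ℂ] H,
      ∀ p, Ψ (X.χ j p) = (X.resLeft i j).toLinearMap.rTensor H (X.χ i p) := by
  let F : P →ₐ[ℂ] X.Overlap i j ⊗[ℂ] H :=
    (Algebra.TensorProduct.map (X.resLeft i j) (AlgHom.id ℂ H)).comp (X.χ i)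
  have F_ker : ∀ p ∈ RingHom.ker (X.χ j), F p = 0 := fun p hp => X.resLeft_χ_eq_zero hp
  let e := Ideal.quotientKerAlgEquivOfSurjective (X.χ_surjective j)
  refine ⟨(Ideal.Quotient.liftₐ (RingHom.ker (X.χ j)) F F_ker).comp e.symm.toAlgHom, fun p => ?_⟩
  have e_symm : e.symm (X.χ j p) = Ideal.Quotient.mk _ p := e.symm_apply_eq.2 rfl
  change Ideal.Quotient.liftₐ (RingHom.ker (X.χ j)) F F_ker (e.symm (X.χ j p)) = _
  rw [e_symm]
  rfl

section ChangeOfTrivialization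

variable {X} {i j : I} {Ψ : X.Loc j ⊗[ℂ] H →ₐ[ℂ] X.Overlap i j ⊗[ℂ] H}
  (hΨ : ∀ p, Ψ (X.χ j p) = (X.resLeft i j).toLinearMap.rTensor H (X.χ i p))

include hΨ

theorem changeOfTrivialization_covariant (z : X.Loc j ⊗[ℂ] H) :
    Ψ.toLinearMap.rTensor H (cofreeCoact ℂ H (X.Loc j) z) =
      cofreeCoact ℂ H (X.Overlap i j) (Ψ z) := by
  obtain ⟨p, rfl⟩ := X.χ_surjective j z
  have Ψ_comp_χ : Ψ.toLinearMap ∘ₗ (X.χ j).toLinearMap =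
      (X.resLeft i j).toLinearMap.rTensor H ∘ₗ (X.χ i).toLinearMap := LinearMap.ext hΨ
  rw [hΨ, ← rTensor_rTensor_cofreeCoact, ← χ_rTensor_coact, ← χ_rTensor_coact,
    ← LinearMap.rTensor_comp_apply, ← LinearMap.rTensor_comp_apply, Ψ_comp_χ]

theorem changeOfTrivialization_tmul_one (a : X.Loc j) :
    Ψ (a ⊗ₜ 1) = X.resRight i j a ⊗ₜ 1 := by
  obtain ⟨b, rfl⟩ := Ideal.Quotient.mk_surjective a
  rw [← X.χ_ι, hΨ, X.χ_ι]
  rfl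

theorem exists_twist_eq_changeOfTrivialization : ∃ t : H →ₐ[ℂ] X.Overlap i j,
    ∀ z, Ψ z = twist t ((X.resRight i j).toLinearMap.rTensor H z) := by
  let ev : X.Overlap i j ⊗[ℂ] H →ₐ[ℂ] X.Overlap i j :=
    (Algebra.TensorProduct.rid ℂ ℂ (X.Overlap i j)).toAlgHom.comp
      (Algebra.TensorProduct.map (AlgHom.id ℂ _) (Bialgebra.counitAlgHom ℂ H))
  have ev_eq : ev.toLinearMap = contract counit := TensorProduct.ext' fun a h => by simp [ev]
  let t : H →ₐ[ℂ] X.Overlap i j := (ev.comp Ψ).comp Algebra.TensorProduct.includeRight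
  have counit_Ψ : contract counit ∘ₗ Ψ.toLinearMap = (LinearMap.mul' ℂ (X.Overlap i j) ∘ₗ
      t.toLinearMap.lTensor _) ∘ₗ (X.resRight i j).toLinearMap.rTensor H := by
    rw [← ev_eq]
    refine TensorProduct.ext' fun a h => ?_
    change ev (Ψ (a ⊗ₜ h)) = X.resRight i j a * ev (Ψ (1 ⊗ₜ h))
    rw [← mul_one a, ← one_mul h, ← Algebra.TensorProduct.tmul_mul_tmul, map_mul, map_mul,
      changeOfTrivialization_tmul_one hΨ]
    simp [ev]
  refine ⟨t, fun z => ?_⟩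
  rw [twist_eq_rTensor_cofreeCoact, ← rTensor_rTensor_cofreeCoact, ← LinearMap.rTensor_comp_apply,
    ← counit_Ψ]
  exact eq_of_rTensor_cofreeCoact (changeOfTrivialization_covariant hΨ) z

end ChangeOfTrivialization

theorem exists_isTransition [Finite I] :
    ∃ τ : ∀ i j, H →ₐ[ℂ] X.Overlap i j, X.IsTransition τ := by
  choose Ψ hΨ using X.exists_changeOfTrivialization
  choose t ht using fun i j => exists_twist_eq_changeOfTrivialization (hΨ i j)
  refine ⟨fun i j => (X.overlapSwap i j).comp (t j i), fun i j p => ?_⟩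
  rw [overlapSwap_comp_comp, ← ht, hΨ]

variable {X} {τ τ' : ∀ i j, H →ₐ[ℂ] X.Overlap i j}

theorem IsTransition.overlapSwap_apply (hτ : X.IsTransition τ) {i j : I} {p : P} {h : H}
    (hp : X.χ j p = 1 ⊗ₜ h) : X.overlapSwap i j (τ j i h) =
      contract counit ((X.resLeft i j).toLinearMap.rTensor H (X.χ i p)) := by
  rw [hτ, hp, contract_counit_twist]
  simp

theorem IsTransition.unique (hτ : X.IsTransition τ) (hτ' : X.IsTransition τ') : τ = τ' := by
  funext j i
  rw [← overlapSwap_comp_comp X j i (τ j i), ← overlapSwap_comp_comp X j i (τ' j i)]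
  congr 1
  ext h
  obtain ⟨p, hp⟩ := X.χ_surjective j (1 ⊗ₜ h)
  exact (hτ.overlapSwap_apply hp).trans (hτ'.overlapSwap_apply hp).symm

variable (X) in
theorem existsUnique_isTransition [Finite I] :
    ∃! τ : ∀ i j, H →ₐ[ℂ] X.Overlap i j, X.IsTransition τ :=
  let ⟨τ, hτ⟩ := X.exists_isTransition
  ⟨τ, hτ, fun _ hτ' => hτ'.unique hτ⟩

theorem rTensor_overlapSwap_twist {i j : I} (t : H →ₐ[ℂ] X.Overlap j i) (z : X.Overlap j i ⊗[ℂ] H) :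
    (X.overlapSwap i j).toLinearMap.rTensor H (twist t z) =
      twist ((X.overlapSwap i j).comp t) ((X.overlapSwap i j).toLinearMap.rTensor H z) := by
  induction z with
  | zero => simp only [map_zero]
  | add x y hx hy => simp only [map_add, hx, hy]
  | tmul a h => simp [twist_tmul _ _ (ℛ ℂ h)]

theorem IsTransition.resRight_χ (hτ : X.IsTransition τ) (i j : I) (p : P) :
    (X.resRight i j).toLinearMap.rTensor H (X.χ j p) =
      twist (τ i j) ((X.resLeft i j).toLinearMap.rTensor H (X.χ i p)) := by
  have swap_left : (X.overlapSwap i j).toLinearMap ∘ₗ (X.resLeft j i).toLinearMap =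
      (X.resRight i j).toLinearMap :=
    LinearMap.ext fun a => a.inductionOn' fun _ => rfl
  have swap_right : (X.overlapSwap i j).toLinearMap ∘ₗ (X.resRight j i).toLinearMap =
      (X.resLeft i j).toLinearMap :=
    LinearMap.ext fun a => a.inductionOn' fun _ => rfl
  rw [← swap_left, LinearMap.rTensor_comp_apply, hτ j i p, rTensor_overlapSwap_twist,
    ← LinearMap.rTensor_comp_apply, swap_right, overlapSwap_comp_comp]

theorem IsTransition.mul_eq_one (hτ : X.IsTransition τ) (i j : I) :
    toConv (τ i j).toLinearMap * toConv ((X.overlapSwap i j).comp (τ j i)).toLinearMap = 1 := by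
  ext h
  obtain ⟨p, hp⟩ := X.χ_surjective i (1 ⊗ₜ h)
  have cocycle := congr(contract counit $(hτ i j p))
  rw [hτ.resRight_χ, hp, LinearMap.rTensor_tmul, AlgHom.toLinearMap_apply, map_one,
    contract_counit_twist_twist, contract_tmul] at cocycle
  rw [LinearMap.convOne_apply, Algebra.algebraMap_eq_smul_one, cocycle]
  rfl

theorem IsTransition.swap_mul_eq_one (hτ : X.IsTransition τ) (i j : I) :
    toConv ((X.overlapSwap i j).comp (τ j i)).toLinearMap * toConv (τ i j).toLinearMap = 1 := by
  have swap := congr((X.overlapSwap i j).toLinearMap ∘ₗ ($(hτ.mul_eq_one j i)).ofConv)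
  rw [LinearMap.algHom_comp_convMul_distrib] at swap
  apply ofConv_injective
  rw [← overlapSwap_comp_comp X i j (τ i j)]
  exact swap.trans (by ext h; simp)

end LocallyTrivialQPFB

/-! ### Graded algebras and differential calculi -/

section Side

/-- The side on which an algebra acts on a bimodule; it lets left and right connections share
their proofs. -/
inductive Side
  | left
  | right

variable {k A A' : Type*} [CommSemiring k] [Semiring A] [Algebra k A] [Semiring A'] [Algebra k A']

variable (k) in
/-- Multiplication `y ↦ x * y` from the left, or `y ↦ y * x` from the right. -/
def sideMul : Side → A →ₗ[k] A →ₗ[k] A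
  | .left => LinearMap.mul k A
  | .right => (LinearMap.mul k A).flip

@[simp]
theorem sideMul_left (x y : A) : sideMul k .left x y = x * y := rfl

@[simp]
theorem sideMul_right (x y : A) : sideMul k .right x y = y * x := rfl

theorem map_sideMul (s : Side) (f : A →ₐ[k] A') (x y : A) :
    f (sideMul k s x y) = sideMul k s (f x) (f y) := by
  cases s <;> simp

theorem sideMul_sideMul (s : Side) (x y z : A) :
    sideMul k s (sideMul k s x y) z = sideMul k s x (sideMul k s y z) := by
  cases s <;> simp [mul_assoc]

theorem sideMul_one (s : Side) (x : A) : sideMul k s x 1 = x := by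
  cases s <;> simp

theorem one_sideMul (s : Side) (x : A) : sideMul k s 1 x = x := by
  cases s <;> simp

theorem sideMul_tmul_tmul (s : Side) (x y : A) (x' y' : A') :
    sideMul k s (x ⊗ₜ[k] x') (y ⊗ₜ[k] y') = sideMul k s x y ⊗ₜ sideMul k s x' y' := by
  cases s <;> simp

theorem rTensor_sideMul {H V W : Type*} [Semiring H] [Algebra k H] [AddCommMonoid V] [Module k V]
    [AddCommMonoid W] [Module k W]
    {s : Side} {g : A →ₗ[k] A} {o : V →ₗ[k] A} {f f' : W →ₗ[k] A}
    (h : ∀ v w, g (sideMul k s (o v) (f w)) = sideMul k s (o v) (f' w))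
    (t : V ⊗[k] H) (u : W ⊗[k] H) :
    g.rTensor H (sideMul k s (o.rTensor H t) (f.rTensor H u)) =
      sideMul k s (o.rTensor H t) (f'.rTensor H u) := by
  induction t with
  | zero => simp only [map_zero, LinearMap.zero_apply]
  | add x y hx hy => simp only [map_add, LinearMap.add_apply, hx, hy]
  | tmul v l =>
    induction u with
    | zero => simp only [map_zero]
    | add x y hx hy => simp only [map_add, hx, hy]
    | tmul w m => simp only [LinearMap.rTensor_tmul, sideMul_tmul_tmul, h]

end Side

section Grading

open Polynomial

variable {k A : Type*} [CommSemiring k] [Semiring A] [Algebra k A] (𝒜 : ℕ → Submodule k A)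
  [GradedAlgebra 𝒜]

/-- The grading of an `ℕ`-graded algebra as the homomorphism `x ↦ ∑ xₙ Xⁿ` to the polynomials, by
which homogeneous components of products are read off from the product of polynomials. -/
def gradingHom : A →ₐ[k] A[X] :=
  (DirectSum.toAlgebra k (fun n => 𝒜 n)
    (fun n => (monomial n).restrictScalars k ∘ₗ (𝒜 n).subtype)
    rfl (fun x y => (monomial_mul_monomial _ _ (x : A) (y : A)).symm)).comp
      (DirectSum.decomposeAlgEquiv 𝒜).toAlgHom

theorem gradingHom_of_mem {n : ℕ} {x : A} (hx : x ∈ 𝒜 n) :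
    gradingHom 𝒜 x = monomial n x := by
  lift x to 𝒜 n using hx
  change DirectSum.toModule k ℕ A[X] (fun n => (monomial n).restrictScalars k ∘ₗ (𝒜 n).subtype)
    (DirectSum.decompose 𝒜 (x : A)) = _
  rw [DirectSum.decompose_coe]
  exact DirectSum.toModule_lof (M := fun n => 𝒜 n) k n x

theorem gradedProj_of_mem {n : ℕ} {x : A} (hx : x ∈ 𝒜 n) : GradedAlgebra.proj 𝒜 n x = x :=
  DirectSum.decompose_of_mem_same _ hx

theorem gradedProj_of_mem_ne {m n : ℕ} {x : A} (hx : x ∈ 𝒜 m) (h : m ≠ n) :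
    GradedAlgebra.proj 𝒜 n x = 0 :=
  DirectSum.decompose_of_mem_ne _ hx h

theorem gradedProj_mem (n : ℕ) (x : A) : GradedAlgebra.proj 𝒜 n x ∈ 𝒜 n := SetLike.coe_mem _

theorem coeff_gradingHom (x : A) (n : ℕ) :
    (gradingHom 𝒜 x).coeff n = GradedAlgebra.proj 𝒜 n x := by
  induction x using DirectSum.Decomposition.inductionOn 𝒜 with
  | zero => simp only [map_zero, coeff_zero]
  | add x y hx hy => simp only [map_add, coeff_add, hx, hy]
  | @homogeneous m x =>
    rw [gradingHom_of_mem 𝒜 x.2, coeff_monomial]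
    split_ifs with h
    · rw [gradedProj_of_mem 𝒜 (h ▸ x.2)]
    · rw [gradedProj_of_mem_ne 𝒜 x.2 h]

theorem gradedProj_zero_mul (x y : A) :
    GradedAlgebra.proj 𝒜 0 (x * y) = GradedAlgebra.proj 𝒜 0 x * GradedAlgebra.proj 𝒜 0 y := by
  simp only [← coeff_gradingHom, map_mul, mul_coeff_zero]

theorem gradedProj_one_mul (x y : A) : GradedAlgebra.proj 𝒜 1 (x * y) =
    GradedAlgebra.proj 𝒜 0 x * GradedAlgebra.proj 𝒜 1 y +
      GradedAlgebra.proj 𝒜 1 x * GradedAlgebra.proj 𝒜 0 y := by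
  simp only [← coeff_gradingHom, map_mul, mul_coeff_one]

end Grading

namespace DifferentialCalculus

section One

variable {B : Type*} [Ring B] [Algebra ℂ B] (Γ : DifferentialCalculus B)

theorem exists_incl_of_mem {x : Γ.carrier} (hx : x ∈ Γ.deg 0) : ∃ b, Γ.incl b = x := by
  rw [← Γ.range_incl] at hx
  exact hx

theorem dB_mem (b : B) : Γ.dB b ∈ Γ.deg 1 := Γ.d_mem 0 _ (Γ.incl_mem b)

theorem dB_mul (a b : B) : Γ.dB (a * b) = Γ.dB a * Γ.incl b + Γ.incl a * Γ.dB b := by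
  have h := Γ.leibniz 0 _ (Γ.incl_mem a) (Γ.incl b)
  simpa [dB] using h

@[simp]
theorem dB_one : Γ.dB 1 = 0 := by simp [dB, d_one]

@[elab_as_elim]
theorem induction_generated {p : Γ.carrier → Prop} (x : Γ.carrier) (incl : ∀ b, p (Γ.incl b))
    (dB : ∀ b, p (Γ.dB b)) (add : ∀ x y, p x → p y → p (x + y))
    (mul : ∀ x y, p x → p y → p (x * y)) : p x := by
  have hx : x ∈ Algebra.adjoin ℂ (Set.range Γ.incl ∪ Set.range fun b => Γ.d (Γ.incl b)) := by
    rw [Γ.generated]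
    exact Algebra.mem_top
  induction hx using Algebra.adjoin_induction with
  | mem x hx =>
    rcases hx with ⟨b, rfl⟩ | ⟨b, rfl⟩
    · exact incl b
    · exact dB b
  | algebraMap r => simpa using incl (algebraMap ℂ B r)
  | add x y _ _ hx hy => exact add x y hx hy
  | mul x y _ _ hx hy => exact mul x y hx hy

/-- The span of the one-forms `p d q`, or of the one-forms `d q p`. -/
def exactSpan (s : Side) : Submodule ℂ Γ.carrier :=
  Submodule.span ℂ {x | ∃ p q, sideMul ℂ s (Γ.incl p) (Γ.dB q) = x}

theorem sideMul_dB_mem_exactSpan (s : Side) (p q : B) :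
    sideMul ℂ s (Γ.incl p) (Γ.dB q) ∈ Γ.exactSpan s :=
  Submodule.subset_span ⟨p, q, rfl⟩

theorem incl_mul_mem_exactSpan {x : Γ.carrier} (hx : x ∈ Γ.exactSpan .left) (b : B) :
    Γ.incl b * x ∈ Γ.exactSpan .left := by
  refine Submodule.span_le (p := (Γ.exactSpan .left).comap (LinearMap.mulLeft ℂ (Γ.incl b))).2
    ?_ hx
  rintro _ ⟨p, q, rfl⟩
  simpa [mul_assoc] using Γ.sideMul_dB_mem_exactSpan .left (b * p) q

theorem mul_incl_mem_exactSpan {x : Γ.carrier} (hx : x ∈ Γ.exactSpan .left) (b : B) :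
    x * Γ.incl b ∈ Γ.exactSpan .left := by
  refine Submodule.span_le (p := (Γ.exactSpan .left).comap (LinearMap.mulRight ℂ (Γ.incl b))).2
    ?_ hx
  rintro _ ⟨p, q, rfl⟩
  simpa [dB_mul, mul_add, mul_assoc] using
    sub_mem (Γ.sideMul_dB_mem_exactSpan .left p (q * b))
      (Γ.sideMul_dB_mem_exactSpan .left (p * q) b)

theorem exactSpan_left_le_right : Γ.exactSpan .left ≤ Γ.exactSpan .right := by
  refine Submodule.span_le.2 ?_
  rintro _ ⟨p, q, rfl⟩
  simpa [dB_mul] using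
    sub_mem (Γ.sideMul_dB_mem_exactSpan .right 1 (p * q)) (Γ.sideMul_dB_mem_exactSpan .right q p)

theorem deg_one_le_exactSpan (s : Side) : Γ.deg 1 ≤ Γ.exactSpan s := by
  have proj_mem (x : Γ.carrier) : GradedAlgebra.proj Γ.deg 1 x ∈ Γ.exactSpan .left := by
    induction x using Γ.induction_generated with
    | incl b => simp [gradedProj_of_mem_ne Γ.deg (Γ.incl_mem b) zero_ne_one]
    | dB b =>
      rw [gradedProj_of_mem Γ.deg (Γ.dB_mem b)]
      simpa using Γ.sideMul_dB_mem_exactSpan .left 1 b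
    | add x y hx hy => rw [map_add]; exact add_mem hx hy
    | mul x y hx hy =>
      obtain ⟨a, ha⟩ := Γ.exists_incl_of_mem (gradedProj_mem Γ.deg 0 x)
      obtain ⟨b, hb⟩ := Γ.exists_incl_of_mem (gradedProj_mem Γ.deg 0 y)
      rw [gradedProj_one_mul, ← ha, ← hb]
      exact add_mem (Γ.incl_mul_mem_exactSpan hy a) (Γ.mul_incl_mem_exactSpan hx b)
  intro x hx
  have hleft : x ∈ Γ.exactSpan .left := gradedProj_of_mem Γ.deg hx ▸ proj_mem x
  cases s with
  | left => exact hleft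
  | right => exact Γ.exactSpan_left_le_right hleft

theorem sideMul_incl_mem (s : Side) {n : ℕ} {x : Γ.carrier} (hx : x ∈ Γ.deg n) (b : B) :
    sideMul ℂ s (Γ.incl b) x ∈ Γ.deg n := by
  cases s
  · exact zero_add n ▸ SetLike.mul_mem_graded (Γ.incl_mem b) hx
  · exact add_zero n ▸ SetLike.mul_mem_graded hx (Γ.incl_mem b)

theorem zeroPart_incl (b : B) : Γ.zeroPart (Γ.incl b) = b :=
  Γ.zeroEquiv.symm_apply_eq.2 (Subtype.ext (gradedProj_of_mem Γ.deg (Γ.incl_mem b)))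

theorem zeroPart_of_mem {n : ℕ} (hn : n ≠ 0) {x : Γ.carrier} (hx : x ∈ Γ.deg n) :
    Γ.zeroPart x = 0 :=
  Γ.zeroEquiv.symm_apply_eq.2 <| by
    rw [map_zero]
    exact Subtype.ext (gradedProj_of_mem_ne Γ.deg hx hn)

end One

section Two

open Polynomial

variable {A B : Type*} [Ring A] [Algebra ℂ A] [Ring B] [Algebra ℂ B]
  (Γ : DifferentialCalculus A) (Λ : DifferentialCalculus B)

/-- The embedding `ρ ↦ 1 ⊗ ρ`. -/
def inRight : Λ.carrier →ₐ[ℂ] Skew Γ Λ := GradedTensorProduct.includeRight Γ.deg Λ.deg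

theorem of_tmul (γ : Γ.carrier) (ω : Λ.carrier) :
    GradedTensorProduct.of ℂ Γ.deg Λ.deg (γ ⊗ₜ ω) = inLeft Γ Λ γ * inRight Γ Λ ω :=
  (GradedTensorProduct.tmul_one_mul_one_tmul Γ.deg Λ.deg γ ω).symm

theorem of_symm_mul (γ : Γ.carrier) (ω : Λ.carrier) :
    (GradedTensorProduct.of ℂ Γ.deg Λ.deg).symm (inLeft Γ Λ γ * inRight Γ Λ ω) = γ ⊗ₜ ω := by
  rw [← of_tmul, GradedTensorProduct.of_symm_of]

@[elab_as_elim]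
theorem skew_induction {p : Skew Γ Λ → Prop} (x : Skew Γ Λ)
    (mul : ∀ γ ω, p (inLeft Γ Λ γ * inRight Γ Λ ω)) (add : ∀ x y, p x → p y → p (x + y)) :
    p x := by
  induction x using TensorProduct.induction_on with
  | zero => exact (by simpa only [map_zero, zero_mul] using mul 0 0 : p 0)
  | add x y hx hy => exact add x y hx hy
  | tmul γ ω => exact (by simpa only [← of_tmul] using mul γ ω :
      p (GradedTensorProduct.of ℂ Γ.deg Λ.deg (γ ⊗ₜ ω)))

theorem inRight_mul_inLeft {m n : ℕ} {ω : Λ.carrier} (hω : ω ∈ Λ.deg m) {γ : Γ.carrier}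
    (hγ : γ ∈ Γ.deg n) :
    inRight Γ Λ ω * inLeft Γ Λ γ = (-1 : ℤˣ) ^ (m * n) • (inLeft Γ Λ γ * inRight Γ Λ ω) := by
  have h := GradedTensorProduct.tmul_coe_mul_coe_tmul (R := ℂ) Γ.deg Λ.deg 1 ⟨ω, hω⟩ ⟨γ, hγ⟩ 1
  rw [one_mul, mul_one] at h
  exact h.trans (congrArg _ (of_tmul Γ Λ γ ω))

theorem commute_inRight_incl_inLeft (b : B) (γ : Γ.carrier) :
    Commute (inRight Γ Λ (Λ.incl b)) (inLeft Γ Λ γ) := by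
  induction γ using DirectSum.Decomposition.inductionOn Γ.deg with
  | zero => simp
  | add x y hx hy => rw [map_add]; exact hx.add_right hy
  | homogeneous γ =>
    simpa using! inRight_mul_inLeft Γ Λ (Λ.incl_mem b) γ.2

theorem commute_inRight_inLeft_incl (ω : Λ.carrier) (a : A) :
    Commute (inRight Γ Λ ω) (inLeft Γ Λ (Γ.incl a)) := by
  induction ω using DirectSum.Decomposition.inductionOn Λ.deg with
  | zero => simp
  | add x y hx hy => rw [map_add]; exact hx.add_left hy
  | homogeneous ω =>
    simpa using! inRight_mul_inLeft Γ Λ ω.2 (Γ.incl_mem a)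

theorem skewIncl_tmul (a : A) (b : B) :
    skewIncl Γ Λ (a ⊗ₜ b) = inLeft Γ Λ (Γ.incl a) * inRight Γ Λ (Λ.incl b) :=
  of_tmul Γ Λ _ _

theorem skewD_skewIncl_tmul (a : A) (b : B) : skewD Γ Λ (skewIncl Γ Λ (a ⊗ₜ b)) =
    inLeft Γ Λ (Γ.dB a) * inRight Γ Λ (Λ.incl b) +
      inLeft Γ Λ (Γ.incl a) * inRight Γ Λ (Λ.dB b) := by
  rw [← of_tmul, ← of_tmul]
  simp [skewD, skewIncl, Γ.sign_of_mem (Γ.incl_mem a), dB]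

theorem skewIncl_mul (x y : A ⊗[ℂ] B) :
    skewIncl Γ Λ (x * y) = skewIncl Γ Λ x * skewIncl Γ Λ y := by
  induction x with
  | zero => simp
  | add x x' hx hx' => simp only [add_mul, map_add, hx, hx']
  | tmul a b =>
    induction y with
    | zero => simp
    | add y y' hy hy' => simp only [mul_add, map_add, hy, hy']
    | tmul a' b' =>
      simp only [Algebra.TensorProduct.tmul_mul_tmul, skewIncl_tmul, map_mul,
        (commute_inRight_incl_inLeft Γ Λ b _).mul_mul_mul_comm]

/-- The total grading of the skew tensor product, in the form of `gradingHom`. -/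
def skewGradingHom : Skew Γ Λ →ₐ[ℂ] (Skew Γ Λ)[X] :=
  GradedTensorProduct.lift Γ.deg Λ.deg
    ((mapAlgHom (inLeft Γ Λ)).comp (gradingHom Γ.deg))
    ((mapAlgHom (inRight Γ Λ)).comp (gradingHom Λ.deg)) (by
      intro m n γ ω
      simp only [AlgHom.comp_apply, coe_mapAlgHom, gradingHom_of_mem _ (SetLike.coe_mem _),
        map_monomial, monomial_mul_monomial, add_comm m n, RingHom.coe_coe,
        inRight_mul_inLeft Γ Λ ω.2 γ.2]
      rcases Int.units_eq_one_or ((-1 : ℤˣ) ^ (n * m)) with h | h <;> simp [h])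

theorem skewGradingHom_inLeft (γ : Γ.carrier) :
    skewGradingHom Γ Λ (inLeft Γ Λ γ) = mapAlgHom (inLeft Γ Λ) (gradingHom Γ.deg γ) := by
  refine (GradedTensorProduct.lift_tmul Γ.deg Λ.deg _ _ _ γ 1).trans ?_
  rw [map_one, mul_one]
  rfl

theorem skewGradingHom_inRight (ω : Λ.carrier) :
    skewGradingHom Γ Λ (inRight Γ Λ ω) = mapAlgHom (inRight Γ Λ) (gradingHom Λ.deg ω) := by
  refine (GradedTensorProduct.lift_tmul Γ.deg Λ.deg _ _ _ 1 ω).trans ?_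
  rw [map_one, one_mul]
  rfl

/-- The projection of the skew tensor product onto the forms of total degree `n`. -/
def skewProj (n : ℕ) : Skew Γ Λ →ₗ[ℂ] Skew Γ Λ :=
  (lcoeff (Skew Γ Λ) n).restrictScalars ℂ ∘ₗ (skewGradingHom Γ Λ).toLinearMap

theorem skewProj_apply (n : ℕ) (x : Skew Γ Λ) :
    skewProj Γ Λ n x = (skewGradingHom Γ Λ x).coeff n :=
  rfl

theorem skewGradingHom_skewIncl (z : A ⊗[ℂ] B) :
    skewGradingHom Γ Λ (skewIncl Γ Λ z) = C (skewIncl Γ Λ z) := by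
  induction z with
  | zero => simp only [map_zero]
  | add x y hx hy => simp only [map_add, hx, hy]
  | tmul a b =>
    simp [skewIncl_tmul, skewGradingHom_inLeft, skewGradingHom_inRight,
      gradingHom_of_mem _ (incl_mem _ _)]

theorem skewGradingHom_skewD_skewIncl (z : A ⊗[ℂ] B) :
    skewGradingHom Γ Λ (skewD Γ Λ (skewIncl Γ Λ z)) = monomial 1 (skewD Γ Λ (skewIncl Γ Λ z)) := by
  induction z with
  | zero => simp only [map_zero]
  | add x y hx hy => simp only [map_add, hx, hy]
  | tmul a b =>
    simp [skewD_skewIncl_tmul, skewGradingHom_inLeft, skewGradingHom_inRight,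
      gradingHom_of_mem _ (incl_mem _ _), gradingHom_of_mem _ (dB_mem _ _), monomial_mul_C,
      C_mul_monomial]

end Two

end DifferentialCalculus

/-! ### Horizontal parts of differentials -/

theorem eq_conj_add_iff {R : Type*} [Ring R] {t s : R} (hts : t * s = 1) (hst : s * t = 1)
    (a b d : R) : a = t * b * s + t * d ↔ s * a - d - b * s = 0 := by
  rw [sub_sub, sub_eq_zero]
  constructor
  · rintro rfl
    rw [mul_add, ← mul_assoc, ← mul_assoc, ← mul_assoc, hst, one_mul, one_mul, add_comm]
  · intro e
    rw [← one_mul a, ← hts, mul_assoc, e, mul_add, mul_assoc, add_comm]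

section Convolution

open Coalgebra HopfAlgebra WithConv

variable {H A A' : Type*} [Ring H] [HopfAlgebra ℂ H] [Ring A] [Algebra ℂ A] [Ring A'] [Algebra ℂ A']

theorem algHom_comp_convolve (F : A →ₐ[ℂ] A') (f g : H →ₗ[ℂ] A) :
    F.toLinearMap ∘ₗ convolve f g = convolve (F.toLinearMap ∘ₗ f) (F.toLinearMap ∘ₗ g) :=
  LinearMap.algHom_comp_convMul_distrib F (toConv f) (toConv g)

theorem convolve_assoc (f g k : H →ₗ[ℂ] A) :
    convolve (convolve f g) k = convolve f (convolve g k) :=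
  toConv_injective (mul_assoc (toConv f) (toConv g) (toConv k))

theorem sub_convolve (f g k : H →ₗ[ℂ] A) : convolve (f - g) k = convolve f k - convolve g k :=
  toConv_injective (sub_mul (toConv f) (toConv g) (toConv k))

theorem convolve_neg (f g : H →ₗ[ℂ] A) : convolve f (-g) = -convolve f g :=
  toConv_injective (mul_neg (toConv f) (toConv g))

theorem neg_convolve (f g : H →ₗ[ℂ] A) : convolve (-f) g = -convolve f g :=
  toConv_injective (neg_mul (toConv f) (toConv g))

theorem zero_convolve (g : H →ₗ[ℂ] A) : convolve 0 g = 0 :=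
  toConv_injective (zero_mul (toConv g))

theorem eq_zero_of_convolve_algHom (x : H →ₐ[ℂ] A) {f : H →ₗ[ℂ] A}
    (h : convolve f x.toLinearMap = 0) : f = 0 :=
  toConv_injective ((isUnit_toConv_algHom x).mul_left_eq_zero.1 (congrArg toConv h))

theorem commute_convolve {z : A} {f g : H →ₗ[ℂ] A} (hf : ∀ h, Commute z (f h))
    (hg : ∀ h, Commute z (g h)) (h : H) : Commute z (convolve f g h) := by
  rw [convolve_repr (ℛ ℂ h)]
  exact Commute.sum_right _ _ _ fun _ _ => (hf _).mul_right (hg _)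

/-- The constant `z`, as an element `h ↦ ε(h) z` of the convolution algebra. -/
def convConst (z : A) : WithConv (H →ₗ[ℂ] A) := toConv (LinearMap.toSpanSingleton ℂ A z ∘ₗ counit)

theorem convConst_mul (z : A) (f : H →ₗ[ℂ] A) :
    convConst z * toConv f = toConv (LinearMap.mulLeft ℂ z ∘ₗ f) := by
  ext h
  rw [(ℛ ℂ h).convMul_apply]
  simp only [convConst, LinearMap.comp_apply, LinearMap.toSpanSingleton_apply, smul_mul_assoc,
    ← mul_smul_comm, ← map_smul, ← Finset.mul_sum, ← map_sum]
  change z * f _ = z * f h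
  rw [sum_counit_smul]

theorem mul_convConst (z : A) (f : H →ₗ[ℂ] A) :
    toConv f * convConst z = toConv (LinearMap.mulRight ℂ z ∘ₗ f) := by
  ext h
  rw [(ℛ ℂ h).convMul_apply]
  simp only [convConst, LinearMap.comp_apply, LinearMap.toSpanSingleton_apply, mul_smul_comm,
    ← smul_mul_assoc, ← map_smul, ← Finset.sum_mul, ← map_sum]
  change f _ * z = f h * z
  rw [sum_counit_smul_left]

theorem commute_convConst_iff {z : A} {f : H →ₗ[ℂ] A} :
    Commute (toConv f) (convConst z) ↔ ∀ h, Commute (f h) z := by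
  rw [Commute, SemiconjBy, convConst_mul, mul_convConst, toConv_injective.eq_iff,
    LinearMap.ext_iff]
  rfl

end Convolution

section HorDiff

open Coalgebra

variable {H V V' Q Q' : Type*} [Ring H] [HopfAlgebra ℂ H] [AddCommGroup V] [Module ℂ V]
  [AddCommGroup V'] [Module ℂ V'] [Ring Q] [Algebra ℂ Q] [Ring Q'] [Algebra ℂ Q']

/-- The map `v ⊗ h ↦ δ(v) x(h) - ∑ o(v) a(h₁) x(h₂)`, where `o(v)` acts from the side `s`. It gives
the horizontal part of the differential of `v ⊗ h`, both in the local calculi and over overlaps. -/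
def horDiff (s : Side) (δ o : V →ₗ[ℂ] Q) (x a : H →ₗ[ℂ] Q) : V ⊗[ℂ] H →ₗ[ℂ] Q :=
  LinearMap.mul' ℂ Q ∘ₗ TensorProduct.map δ x -
    TensorProduct.lift ((sideMul ℂ s).compl₁₂ o (convolve a x))

@[simp]
theorem horDiff_tmul (s : Side) (δ o : V →ₗ[ℂ] Q) (x a : H →ₗ[ℂ] Q) (v : V) (h : H) :
    horDiff s δ o x a (v ⊗ₜ h) = δ v * x h - sideMul ℂ s (o v) (convolve a x h) := by
  simp [horDiff]

theorem algHom_horDiff (F : Q →ₐ[ℂ] Q') (s : Side) (δ o : V →ₗ[ℂ] Q) (x a : H →ₗ[ℂ] Q)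
    (z : V ⊗[ℂ] H) : F (horDiff s δ o x a z) =
      horDiff s (F.toLinearMap ∘ₗ δ) (F.toLinearMap ∘ₗ o) (F.toLinearMap ∘ₗ x)
        (F.toLinearMap ∘ₗ a) z := by
  induction z with
  | zero => simp only [map_zero]
  | add y z hy hz => simp only [map_add, hy, hz]
  | tmul v h => simp [map_sideMul, ← algHom_comp_convolve]

theorem horDiff_rTensor (s : Side) (δ o : V →ₗ[ℂ] Q) (x a : H →ₗ[ℂ] Q) (r : V' →ₗ[ℂ] V)
    (z : V' ⊗[ℂ] H) : horDiff s δ o x a (r.rTensor H z) = horDiff s (δ ∘ₗ r) (o ∘ₗ r) x a z := by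
  induction z with
  | zero => simp only [map_zero]
  | add y z hy hz => simp only [map_add, hy, hz]
  | tmul v h => simp

section Twist

open LocallyTrivialQPFB

variable {C : Type*} [Ring C] [Algebra ℂ C] (s : Side) {δ : C →ₗ[ℂ] Q} {o : C →ₐ[ℂ] Q}
  {t : H →ₐ[ℂ] C} {x : H →ₐ[ℂ] Q} {a : H →ₗ[ℂ] Q}

theorem mul'_map_twist (hδ : ∀ c c', δ (c * c') = δ c * o c' + o c * δ c')
    (hx : ∀ h c, Commute (x h) (o c)) (hδt : ∀ h c, Commute (δ (t h)) (o c)) (c : C) (h : H) :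
    LinearMap.mul' ℂ Q (TensorProduct.map δ x.toLinearMap (twist t (c ⊗ₜ h))) =
      δ c * convolve (o.comp t).toLinearMap x.toLinearMap h +
        sideMul ℂ s (o c) (convolve (δ ∘ₗ t.toLinearMap) x.toLinearMap h) := by
  have comm_c : Commute (o c) (convolve (δ ∘ₗ t.toLinearMap) x.toLinearMap h) :=
    commute_convolve (fun k => (hδt k c).symm) (fun k => (hx k c).symm) h
  have side_eq : sideMul ℂ s (o c) (convolve (δ ∘ₗ t.toLinearMap) x.toLinearMap h) =
      o c * convolve (δ ∘ₗ t.toLinearMap) x.toLinearMap h := by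
    cases s with
    | left => rfl
    | right => exact comm_c.eq.symm
  rw [side_eq, twist_tmul _ _ (ℛ ℂ h), convolve_repr (ℛ ℂ h), convolve_repr (ℛ ℂ h)]
  simp [hδ, add_mul, mul_assoc, Finset.mul_sum, Finset.sum_add_distrib]

theorem lift_sideMul_twist {w : H →ₗ[ℂ] Q} (ht : ∀ h c, Commute (o (t h)) (o c))
    (hw : ∀ h k, Commute (o (t h)) (w k)) (c : C) (h : H) :
    TensorProduct.lift ((sideMul ℂ s).compl₁₂ o.toLinearMap w) (twist t (c ⊗ₜ h)) =
      sideMul ℂ s (o c) (convolve (o.comp t).toLinearMap w h) := by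
  rw [twist_tmul _ _ (ℛ ℂ h), convolve_repr (ℛ ℂ h), map_sum, map_sum]
  refine Finset.sum_congr rfl fun m _ => ?_
  cases s with
  | left => simp [mul_assoc]
  | right =>
    have swap := (ht ((ℛ ℂ h).left m) c).eq
    simp [← swap, ← mul_assoc, (hw _ _).eq]

theorem horDiff_sub_horDiff_twist (a' : H →ₗ[ℂ] Q)
    (hδ : ∀ c c', δ (c * c') = δ c * o c' + o c * δ c')
    (ht : ∀ h c, Commute (o (t h)) (o c)) (hta : ∀ h k, Commute (o (t h)) (a k))
    (hx : ∀ h c, Commute (x h) (o c)) (hδt : ∀ h c, Commute (δ (t h)) (o c)) (c : C) (h : H) :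
    horDiff s δ o.toLinearMap (convolve (o.comp t).toLinearMap x.toLinearMap) a' (c ⊗ₜ h) -
      horDiff s δ o.toLinearMap x.toLinearMap a (twist t (c ⊗ₜ h)) =
      sideMul ℂ s (o c) (convolve (convolve (o.comp t).toLinearMap a - δ ∘ₗ t.toLinearMap -
        convolve a' (o.comp t).toLinearMap) x.toLinearMap h) := by
  have hw : ∀ k l, Commute (o (t k)) (convolve a x.toLinearMap l) := fun k =>
    commute_convolve (hta k) fun l => (hx l (t k)).symm
  rw [horDiff_tmul, horDiff, LinearMap.sub_apply, LinearMap.comp_apply, mul'_map_twist s hδ hx hδt,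
    lift_sideMul_twist s ht hw, sub_convolve, sub_convolve, convolve_assoc, convolve_assoc,
    LinearMap.sub_apply, LinearMap.sub_apply, map_sub, map_sub, AlgHom.toLinearMap_apply]
  abel

end Twist

end HorDiff

/-! ### The coaction on the covering completion -/

namespace DifferentialStructure

open Coalgebra DifferentialCalculus

variable {I H B P : Type*} [Ring H] [HopfAlgebra ℂ H] [Ring B] [Algebra ℂ B]
  [Ring P] [Algebra ℂ P] {X : LocallyTrivialQPFB I H B P} (D : DifferentialStructure X)

/-- The embedding of `Γ(B_i)` into the local calculus. -/
abbrev inL (i : I) : (D.ΓB i).carrier →ₐ[ℂ] D.Local i :=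
  inLeft (D.ΓB i) D.ΓH.toDifferentialCalculus

/-- The embedding of `Γ(H)` into the local calculus. -/
abbrev inR (i : I) : D.ΓH.carrier →ₐ[ℂ] D.Local i :=
  inRight (D.ΓB i) D.ΓH.toDifferentialCalculus

/-- The embedding of `H` into the local calculus. -/
def inH (i : I) : H →ₐ[ℂ] D.Local i := (D.inR i).comp D.ΓH.incl

theorem inR_incl (i : I) (h : H) : D.inR i (D.ΓH.incl h) = D.inH i h := rfl

/-- The embedding of `B_i ⊗ H` into the local calculus. -/
abbrev inZero (i : I) : X.Loc i ⊗[ℂ] H →ₗ[ℂ] D.Local i :=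
  skewIncl (D.ΓB i) D.ΓH.toDifferentialCalculus

/-- The differential of the local calculus on `B_i ⊗ H`. -/
def dLoc (i : I) : X.Loc i ⊗[ℂ] H →ₗ[ℂ] D.Local i :=
  skewD (D.ΓB i) D.ΓH.toDifferentialCalculus ∘ₗ D.inZero i

theorem inZero_tmul (i : I) (a : X.Loc i) (h : H) :
    D.inZero i (a ⊗ₜ h) = D.inL i ((D.ΓB i).incl a) * D.inH i h :=
  skewIncl_tmul _ _ _ _

theorem dLoc_tmul (i : I) (a : X.Loc i) (h : H) : D.dLoc i (a ⊗ₜ h) =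
    D.inL i ((D.ΓB i).dB a) * D.inH i h + D.inL i ((D.ΓB i).incl a) * D.inR i (D.ΓH.dB h) :=
  skewD_skewIncl_tmul _ _ _ _

theorem χΓ_dB (i : I) (p : P) : D.χΓ i (D.ΓP.dB p) = D.dLoc i (X.χ i p) := by
  rw [dB, LinearMap.comp_apply, D.χΓ_d, AlgHom.toLinearMap_apply, D.χΓ_incl]
  rfl

theorem map_gradingHom_χΓ (i : I) (y : D.ΓP.carrier) :
    Polynomial.mapAlgHom (D.χΓ i) (gradingHom D.ΓP.deg y) =
      skewGradingHom (D.ΓB i) D.ΓH.toDifferentialCalculus (D.χΓ i y) := by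
  induction y using D.ΓP.induction_generated with
  | incl p =>
    rw [gradingHom_of_mem _ (D.ΓP.incl_mem p), D.χΓ_incl, skewGradingHom_skewIncl]
    simp [D.χΓ_incl]
  | dB p =>
    rw [gradingHom_of_mem _ (D.ΓP.dB_mem p), χΓ_dB]
    refine .trans ?_ (skewGradingHom_skewD_skewIncl _ _ (X.χ i p)).symm
    simp [χΓ_dB, dLoc]
  | add x y hx hy => simp only [map_add, hx, hy]
  | mul x y hx hy => simp only [map_mul, hx, hy]

theorem χΓ_proj (i : I) (n : ℕ) (y : D.ΓP.carrier) :
    D.χΓ i (GradedAlgebra.proj D.ΓP.deg n y) =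
      skewProj (D.ΓB i) D.ΓH.toDifferentialCalculus n (D.χΓ i y) := by
  rw [skewProj_apply, ← map_gradingHom_χΓ, ← coeff_gradingHom]
  simp

section Forms

theorem χc_eq {i : I} {γ : D.forms} {y : D.ΓP.carrier} (h : Ideal.Quotient.mk _ y = γ.1 i) :
    D.χc i γ = D.χΓ i y := by
  change Ideal.kerLiftAlg (D.χΓ i) (γ.1 i) = _
  rw [← h]
  rfl

theorem forms_ext {γ γ' : D.forms} (h : ∀ i, D.χc i γ = D.χc i γ') : γ = γ' :=
  Subtype.ext (funext fun i => Ideal.kerLiftAlg_injective (D.χΓ i) (h i))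

theorem exists_common_lift (γ : D.forms) (i j : I) :
    ∃ y ∈ D.ΓP.deg 1, D.χΓ i y = D.χc i γ ∧ D.χΓ j y = D.χc j γ := by
  obtain ⟨hc, hd⟩ := D.mem_forms.1 γ.2
  obtain ⟨y, hy, hyi⟩ := hd i
  obtain ⟨z, hz, hzj⟩ := hd j
  have hyz := hc i j
  rw [← hyi, ← hzj] at hyz
  obtain ⟨k, hk, l, hl, hkl⟩ := Submodule.mem_sup.1 (Ideal.Quotient.eq.1 hyz)
  have hproj : GradedAlgebra.proj D.ΓP.deg 1 k + GradedAlgebra.proj D.ΓP.deg 1 l = y - z := by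
    rw [← map_add, hkl, map_sub, gradedProj_of_mem _ hy, gradedProj_of_mem _ hz]
  refine ⟨y - GradedAlgebra.proj D.ΓP.deg 1 k, sub_mem hy (gradedProj_mem _ _ _), ?_, ?_⟩
  · rw [map_sub, χΓ_proj, RingHom.mem_ker.1 hk, map_zero, sub_zero, D.χc_eq hyi]
  · rw [sub_eq_iff_eq_add.2 (eq_add_of_sub_eq hproj.symm |>.trans (by abel) :
        y = z + GradedAlgebra.proj D.ΓP.deg 1 l + GradedAlgebra.proj D.ΓP.deg 1 k), map_add,
      χΓ_proj, RingHom.mem_ker.1 hl, map_zero, add_zero, D.χc_eq hzj]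

theorem exists_lift (γ : D.forms) (i : I) : ∃ y ∈ D.ΓP.deg 1, D.χΓ i y = D.χc i γ :=
  let ⟨y, hy, h, _⟩ := D.exists_common_lift γ i i
  ⟨y, hy, h⟩

theorem exists_forms (w : ∀ i, D.Local i)
    (h : ∀ i j, ∃ y ∈ D.ΓP.deg 1, D.χΓ i y = w i ∧ D.χΓ j y = w j) :
    ∃ γ : D.forms, ∀ i, D.χc i γ = w i := by
  choose y hy hyi hyj using h
  let x : ∀ i, D.ΓP.carrier ⧸ D.kerχ i := fun i => Ideal.Quotient.mk _ (y i i)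
  refine ⟨⟨x, D.mem_forms.2 ⟨fun i j => ?_, fun i => ⟨y i i, hy i i, rfl⟩⟩⟩, fun i => ?_⟩
  · refine Ideal.Quotient.eq.2 (sub_add_sub_cancel (y i i) (y i j) (y j j) ▸ ?_)
    exact Submodule.add_mem_sup (by rw [RingHom.mem_ker, map_sub, hyi, hyi, sub_self])
      (by rw [RingHom.mem_ker, map_sub, hyj, hyi, sub_self])
  · rw [D.χc_eq (y := y i i) rfl, hyi]

theorem χc_dP (i : I) (p : P) : D.χc i (D.dP p) = D.dLoc i (X.χ i p) := by
  rw [D.χc_eq (y := D.ΓP.dB p) rfl, χΓ_dB]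

/-- The left or right action of `P` on one-forms. -/
def sideAct : Side → P → D.forms →ₗ[ℂ] D.forms
  | .left => D.leftMul
  | .right => D.rightMul

theorem χc_sideAct (s : Side) (i : I) (p : P) (γ : D.forms) :
    D.χc i (D.sideAct s p γ) = sideMul ℂ s (D.inZero i (X.χ i p)) (D.χc i γ) := by
  rw [← D.χΓ_incl]
  cases s with
  | left => exact map_mul (Ideal.kerLiftAlg (D.χΓ i)) (Ideal.Quotient.mk _ (D.ΓP.incl p)) (γ.1 i)
  | right => exact map_mul (Ideal.kerLiftAlg (D.χΓ i)) (γ.1 i) (Ideal.Quotient.mk _ (D.ΓP.incl p))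

end Forms

section Horizontal

/-- The embedding of the horizontal forms `Γ(B_i) ⊗ H` into the local calculus. Forms of `Γ(B_i)`
commute with elements of `H`, so the skew product restricts to the usual one. -/
def horIncl (i : I) : (D.ΓB i).carrier ⊗[ℂ] H →ₐ[ℂ] D.Local i :=
  Algebra.TensorProduct.lift (D.inL i) (D.inH i)
    fun γ h => (commute_inRight_incl_inLeft _ _ h γ).symm

theorem horIncl_tmul (i : I) (γ : (D.ΓB i).carrier) (h : H) :
    D.horIncl i (γ ⊗ₜ h) = D.inL i γ * D.inH i h :=
  Algebra.TensorProduct.lift_tmul _ _ _ _ _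

theorem mem_horizontal {i : I} {w : D.Local i} :
    w ∈ horizontal (D.ΓB i) D.ΓH.toDifferentialCalculus ↔ ∃ z, D.horIncl i z = w := by
  have hf : (GradedTensorProduct.of ℂ (D.ΓB i).deg D.ΓH.deg).toLinearMap ∘ₗ
      D.ΓH.incl.toLinearMap.lTensor (D.ΓB i).carrier = (D.horIncl i).toLinearMap :=
    TensorProduct.ext' fun γ h => (of_tmul _ _ _ _).trans (D.horIncl_tmul i γ h).symm
  rw [horizontal, hf]
  rfl

theorem horIncl_rTensor_incl (i : I) (z : X.Loc i ⊗[ℂ] H) :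
    D.horIncl i ((D.ΓB i).incl.toLinearMap.rTensor H z) = D.inZero i z := by
  induction z with
  | zero => simp only [map_zero]
  | add x y hx hy => simp only [map_add, hx, hy]
  | tmul a h => rw [LinearMap.rTensor_tmul, horIncl_tmul, inZero_tmul, AlgHom.toLinearMap_apply]

theorem sideMul_inZero_horIncl (s : Side) (i : I) (x : X.Loc i ⊗[ℂ] H)
    (z : (D.ΓB i).carrier ⊗[ℂ] H) : sideMul ℂ s (D.inZero i x) (D.horIncl i z) =
      D.horIncl i (sideMul ℂ s ((D.ΓB i).incl.toLinearMap.rTensor H x) z) := by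
  rw [map_sideMul, horIncl_rTensor_incl]

theorem counitΓ_incl (h : H) : D.ΓH.counitΓ (D.ΓH.incl h) = counit h := by
  rw [RightCovariantCalculus.counitΓ, LinearMap.comp_apply, zeroPart_incl]

theorem counitΓ_of_mem {ω : D.ΓH.carrier} (hω : ω ∈ D.ΓH.deg 1) : D.ΓH.counitΓ ω = 0 := by
  rw [RightCovariantCalculus.counitΓ, LinearMap.comp_apply, zeroPart_of_mem _ one_ne_zero hω,
    map_zero]

theorem idCounit_mul (i : I) (γ : (D.ΓB i).carrier) (ω : D.ΓH.carrier) :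
    D.idCounit i (D.inL i γ * D.inR i ω) = D.ΓH.counitΓ ω • γ := by
  simp only [idCounit, LinearMap.comp_apply, LinearEquiv.coe_coe]
  rw [of_symm_mul]
  simp

theorem idCounit_horIncl (i : I) (z : (D.ΓB i).carrier ⊗[ℂ] H) :
    D.idCounit i (D.horIncl i z) = contract counit z := by
  induction z with
  | zero => simp only [map_zero]
  | add x y hx hy => simp only [map_add, hx, hy]
  | tmul γ h => rw [horIncl_tmul, ← inR_incl, idCounit_mul, counitΓ_incl, contract_tmul]

end Horizontal

section LocalCoaction

theorem localCoact_mul (i : I) (γ : (D.ΓB i).carrier) (ω : D.ΓH.carrier) :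
    D.localCoact i (D.inL i γ * D.inR i ω) =
      (D.inL i γ ⊗ₜ 1) * (D.inR i).toLinearMap.rTensor H (D.ΓH.coact ω) := by
  simp only [localCoact, LinearMap.comp_apply, LinearEquiv.coe_coe]
  rw [of_symm_mul, LinearMap.lTensor_tmul, AlgHom.toLinearMap_apply]
  induction D.ΓH.coact ω with
  | zero => simp
  | add x y hx hy => simp only [TensorProduct.tmul_add, map_add, mul_add, hx, hy]
  | tmul ρ h => simp [of_tmul]

theorem rTensor_coact_incl (i : I) (h : H) :
    (D.inR i).toLinearMap.rTensor H (D.ΓH.coact (D.ΓH.incl h)) =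
      (D.inH i).toLinearMap.rTensor H (comul (R := ℂ) h) := by
  rw [D.ΓH.coact_incl, ← LinearMap.rTensor_comp_apply]
  rfl

theorem rTensor_coact_mul (i : I) (ω ρ : D.ΓH.carrier) :
    (D.inR i).toLinearMap.rTensor H (D.ΓH.coact (ω * ρ)) =
      (D.inR i).toLinearMap.rTensor H (D.ΓH.coact ω) *
        (D.inR i).toLinearMap.rTensor H (D.ΓH.coact ρ) := by
  rw [map_mul]
  exact map_mul (Algebra.TensorProduct.map (D.inR i) (AlgHom.id ℂ H)) _ _

theorem localCoact_mul_mul (i : I) {γ γ' : (D.ΓB i).carrier} {ω ω' : D.ΓH.carrier}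
    (h : Commute (D.inR i ω) (D.inL i γ'))
    (h' : Commute ((D.inR i).toLinearMap.rTensor H (D.ΓH.coact ω)) (D.inL i γ' ⊗ₜ 1)) :
    D.localCoact i (D.inL i γ * D.inR i ω * (D.inL i γ' * D.inR i ω')) =
      D.localCoact i (D.inL i γ * D.inR i ω) * D.localCoact i (D.inL i γ' * D.inR i ω') := by
  rw [h.mul_mul_mul_comm, ← map_mul, ← map_mul, localCoact_mul, localCoact_mul, localCoact_mul,
    h'.mul_mul_mul_comm, rTensor_coact_mul, map_mul, Algebra.TensorProduct.tmul_mul_tmul, one_mul]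

theorem localCoact_horIncl (i : I) (z : (D.ΓB i).carrier ⊗[ℂ] H) :
    D.localCoact i (D.horIncl i z) =
      (D.horIncl i).toLinearMap.rTensor H (cofreeCoact ℂ H (D.ΓB i).carrier z) := by
  induction z with
  | zero => simp only [map_zero]
  | add x y hx hy => simp only [map_add, hx, hy]
  | tmul γ h =>
    rw [horIncl_tmul, ← inR_incl, localCoact_mul, rTensor_coact_incl,
      cofreeCoact_tmul γ (ℛ ℂ h), ← (ℛ ℂ h).eq]
    simp [horIncl_tmul, Finset.mul_sum]

theorem localCoact_inZero (i : I) (z : X.Loc i ⊗[ℂ] H) : D.localCoact i (D.inZero i z) =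
    (D.inZero i).rTensor H (cofreeCoact ℂ H (X.Loc i) z) := by
  have hf : (D.horIncl i).toLinearMap ∘ₗ (D.ΓB i).incl.toLinearMap.rTensor H = D.inZero i :=
    LinearMap.ext (D.horIncl_rTensor_incl i)
  rw [← horIncl_rTensor_incl, localCoact_horIncl, ← rTensor_rTensor_cofreeCoact,
    ← LinearMap.rTensor_comp_apply, hf]

theorem localCoact_dLoc (i : I) (z : X.Loc i ⊗[ℂ] H) : D.localCoact i (D.dLoc i z) =
    (D.dLoc i).rTensor H (cofreeCoact ℂ H (X.Loc i) z) := by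
  induction z with
  | zero => simp only [map_zero]
  | add x y hx hy => simp only [map_add, hx, hy]
  | tmul a h =>
    have hd : D.ΓH.coact (D.ΓH.dB h) = D.ΓH.dB.rTensor H (comul (R := ℂ) h) := D.ΓH.coact_d h
    rw [dLoc_tmul, map_add, ← inR_incl, localCoact_mul, localCoact_mul, rTensor_coact_incl, hd,
      cofreeCoact_tmul a (ℛ ℂ h), ← (ℛ ℂ h).eq]
    simp [dLoc_tmul, Finset.mul_sum, TensorProduct.add_tmul, Finset.sum_add_distrib]

theorem localCoact_sideMul (s : Side) (i : I) (x : X.Loc i ⊗[ℂ] H) (w : D.Local i) :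
    D.localCoact i (sideMul ℂ s (D.inZero i x) w) =
      sideMul ℂ s (D.localCoact i (D.inZero i x)) (D.localCoact i w) := by
  induction x with
  | zero => simp
  | add x y hx hy => simp only [map_add, LinearMap.add_apply, hx, hy]
  | tmul a h =>
    induction w using skew_induction with
    | add x y hx hy => simp only [map_add, hx, hy]
    | mul γ ω =>
      cases s with
      | left =>
        have hcomm (k : H) : Commute (D.inH i k) (D.inL i γ) := commute_inRight_incl_inLeft _ _ k γ
        rw [sideMul_left, sideMul_left, skewIncl_tmul]
        refine D.localCoact_mul_mul i (hcomm h) ?_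
        rw [rTensor_coact_incl]
        exact commute_rTensor_tmul_one (f := (D.inH i).toLinearMap) hcomm _
      | right =>
        have hcomm (ρ : D.ΓH.carrier) : Commute (D.inR i ρ) (D.inL i ((D.ΓB i).incl a)) :=
          commute_inRight_inLeft_incl _ _ ρ a
        rw [sideMul_right, sideMul_right, skewIncl_tmul]
        exact D.localCoact_mul_mul i (hcomm ω)
          (commute_rTensor_tmul_one (f := (D.inR i).toLinearMap) hcomm _)

theorem horIncl_rTensor_idCounit_localCoact {i : I} {w : D.Local i}
    (hw : w ∈ horizontal (D.ΓB i) D.ΓH.toDifferentialCalculus) :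
    D.horIncl i ((D.idCounit i).rTensor H (D.localCoact i w)) = w := by
  obtain ⟨z, rfl⟩ := D.mem_horizontal.1 hw
  have hf : D.idCounit i ∘ₗ (D.horIncl i).toLinearMap = contract counit :=
    LinearMap.ext (D.idCounit_horIncl i)
  rw [localCoact_horIncl, ← LinearMap.rTensor_comp_apply, hf, rTensor_contract_counit_cofreeCoact]

end LocalCoaction

section Coaction

theorem exists_contract_localCoact (φ : H →ₗ[ℂ] ℂ) {y : D.ΓP.carrier} (hy : y ∈ D.ΓP.deg 1) :
    ∃ z ∈ D.ΓP.deg 1, ∀ i, D.χΓ i z = contract φ (D.localCoact i (D.χΓ i y)) := by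
  suffices h : D.ΓP.exactSpan .left ≤
      ((D.ΓP.deg 1).map (LinearMap.pi fun i => (D.χΓ i).toLinearMap)).comap
        (LinearMap.pi fun i => contract φ ∘ₗ D.localCoact i ∘ₗ (D.χΓ i).toLinearMap) by
    obtain ⟨z, hz, e⟩ := h (D.ΓP.deg_one_le_exactSpan .left hy)
    exact ⟨z, hz, congrFun e⟩
  refine Submodule.span_le.2 ?_
  rintro _ ⟨p, q, rfl⟩
  let u := D.ΓP.incl.toLinearMap.rTensor H (X.coact p)
  let v := D.ΓP.dB.rTensor H (X.coact q)
  have huv : u * v ∈ rTensorSubmodule H (D.ΓP.deg 1) :=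
    mul_mem_rTensorSubmodule
      (fun x hx y hy => by exact zero_add 1 ▸ SetLike.mul_mem_graded hx hy)
      (mem_rTensorSubmodule_iff_contract.2 fun _ => by
        simpa [u, contract_rTensor] using D.ΓP.incl_mem _)
      (mem_rTensorSubmodule_iff_contract.2 fun _ => by
        simpa [v, contract_rTensor] using D.ΓP.dB_mem _)
  refine ⟨contract φ (u * v), mem_rTensorSubmodule_iff_contract.1 huv φ, funext fun i => ?_⟩
  have hu : (D.χΓ i).toLinearMap.rTensor H u = D.localCoact i (D.inZero i (X.χ i p)) := by
    rw [localCoact_inZero, ← X.χ_rTensor_coact, ← LinearMap.rTensor_comp_apply,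
      ← LinearMap.rTensor_comp_apply]
    exact LinearMap.congr_fun (congrArg _ (LinearMap.ext (D.χΓ_incl i))) _
  have hv : (D.χΓ i).toLinearMap.rTensor H v = D.localCoact i (D.dLoc i (X.χ i q)) := by
    rw [localCoact_dLoc, ← X.χ_rTensor_coact, ← LinearMap.rTensor_comp_apply,
      ← LinearMap.rTensor_comp_apply]
    exact LinearMap.congr_fun (congrArg _ (LinearMap.ext (D.χΓ_dB i))) _
  calc D.χΓ i (contract φ (u * v))
      = contract φ ((D.χΓ i).toLinearMap.rTensor H (u * v)) :=
        (contract_rTensor φ (D.χΓ i).toLinearMap (u * v)).symm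
    _ = contract φ (D.localCoact i (D.inZero i (X.χ i p)) *
          D.localCoact i (D.dLoc i (X.χ i q))) := by
        rw [← hu, ← hv]
        exact congrArg _ (map_mul (Algebra.TensorProduct.map (D.χΓ i) (AlgHom.id ℂ H)) u v)
    _ = contract φ (D.localCoact i (D.χΓ i (sideMul ℂ .left (D.ΓP.incl p) (D.ΓP.dB q)))) := by
        rw [map_sideMul, D.χΓ_incl, χΓ_dB, localCoact_sideMul, sideMul_left]

theorem exists_isCoactionOf [Finite I] (γ : D.forms) : ∃ t, D.IsCoactionOf γ t := by
  refine exists_rTensor_eq D.χc (fun i => D.localCoact i (D.χc i γ)) fun φ =>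
    D.exists_forms _ fun i j => ?_
  obtain ⟨y, hy, hi, hj⟩ := D.exists_common_lift γ i j
  obtain ⟨z, hz, hzy⟩ := D.exists_contract_localCoact φ hy
  exact ⟨z, hz, hi ▸ hzy i, hj ▸ hzy j⟩

end Coaction

end DifferentialStructure

/-! ### The overlap calculus -/

namespace DifferentialStructure

open Coalgebra HopfAlgebra WithConv DifferentialCalculus

variable {I H B P : Type*} [Ring H] [HopfAlgebra ℂ H] [Ring B] [Algebra ℂ B]
  [Ring P] [Algebra ℂ P] {X : LocallyTrivialQPFB I H B P} (D : DifferentialStructure X)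

section Overlap

variable (i j : I)

theorem projLeft_χΓ (y : D.ΓP.carrier) :
    D.projLeft i j (D.χΓ i y) = Ideal.Quotient.mk _ y := by
  have symm_χΓ : (Ideal.quotientKerAlgEquivOfSurjective (D.χΓ_surjective i)).symm (D.χΓ i y) =
      Ideal.Quotient.mk _ y := (AlgEquiv.symm_apply_eq _).2 rfl
  exact congr(Ideal.Quotient.factorₐ ℂ
    (le_sup_left : D.kerχ i ≤ D.kerχ i ⊔ D.kerχ j) $symm_χΓ)

theorem projRight_χΓ (y : D.ΓP.carrier) :
    D.projRight i j (D.χΓ j y) = Ideal.Quotient.mk _ y := by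
  have symm_χΓ : (Ideal.quotientKerAlgEquivOfSurjective (D.χΓ_surjective j)).symm (D.χΓ j y) =
      Ideal.Quotient.mk _ y := (AlgEquiv.symm_apply_eq _).2 rfl
  exact congr(Ideal.Quotient.factorₐ ℂ
    (le_sup_right : D.kerχ j ≤ D.kerχ i ⊔ D.kerχ j) $symm_χΓ)

theorem inL_incl_mk (b : B) :
    D.inL i ((D.ΓB i).incl (Ideal.Quotient.mk _ b)) = D.χΓ i (D.ΓP.incl (X.ι b)) := by
  rw [D.χΓ_incl, X.χ_ι, inZero_tmul, map_one, mul_one]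

theorem inL_dB_mk (b : B) :
    D.inL i ((D.ΓB i).dB (Ideal.Quotient.mk _ b)) = D.χΓ i (D.ΓP.dB (X.ι b)) := by
  rw [D.χΓ_dB, X.χ_ι, dLoc_tmul, dB_one, map_one, map_zero, mul_one, mul_zero, add_zero]

theorem projLeft_incl (a : X.Loc i) :
    D.projLeft i j (D.inL i ((D.ΓB i).incl a)) = D.overlapIncl i j (X.resLeft i j a) := by
  obtain ⟨b, rfl⟩ := Ideal.Quotient.mk_surjective a
  rw [inL_incl_mk, projLeft_χΓ]
  rfl

theorem projRight_incl (a : X.Loc j) :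
    D.projRight i j (D.inL j ((D.ΓB j).incl a)) = D.overlapIncl i j (X.resRight i j a) := by
  obtain ⟨b, rfl⟩ := Ideal.Quotient.mk_surjective a
  rw [inL_incl_mk, projRight_χΓ]
  rfl

theorem projLeft_dB (a : X.Loc i) : D.projLeft i j (D.inL i ((D.ΓB i).dB a)) =
    D.overlapD i j (D.overlapIncl i j (X.resLeft i j a)) := by
  obtain ⟨b, rfl⟩ := Ideal.Quotient.mk_surjective a
  rw [inL_dB_mk, projLeft_χΓ]
  rfl

theorem projRight_dB (a : X.Loc j) : D.projRight i j (D.inL j ((D.ΓB j).dB a)) =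
    D.overlapD i j (D.overlapIncl i j (X.resRight i j a)) := by
  obtain ⟨b, rfl⟩ := Ideal.Quotient.mk_surjective a
  rw [inL_dB_mk, projRight_χΓ]
  rfl

theorem overlapD_incl_mul (x y : X.Overlap i j) :
    D.overlapD i j (D.overlapIncl i j (x * y)) =
      D.overlapD i j (D.overlapIncl i j x) * D.overlapIncl i j y +
        D.overlapIncl i j x * D.overlapD i j (D.overlapIncl i j y) := by
  obtain ⟨a, rfl⟩ := Ideal.Quotient.mk_surjective x
  obtain ⟨b, rfl⟩ := Ideal.Quotient.mk_surjective y
  have leibniz := D.ΓP.dB_mul (X.ι a) (X.ι b)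
  rw [← map_mul] at leibniz
  refine congr(Ideal.Quotient.mk (D.kerχ i ⊔ D.kerχ j) $leibniz).trans ?_
  rw [map_add, map_mul (Ideal.Quotient.mk _), map_mul (Ideal.Quotient.mk _)]
  rfl

theorem overlapD_one : D.overlapD i j 1 = 0 := by
  simpa using D.overlapD_incl_mul i j 1 1

/-- The forms on the base in the overlap calculus, i.e. the calculus `Γ_m(B_ij)`. -/
def baseForms : Subalgebra ℂ (D.OverlapForms i j) :=
  ((D.projLeft i j).comp (D.inL i)).range

theorem projLeft_inL_mem (γ : (D.ΓB i).carrier) :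
    D.projLeft i j (D.inL i γ) ∈ D.baseForms i j := ⟨γ, rfl⟩

theorem overlapIncl_mem (x : X.Overlap i j) : D.overlapIncl i j x ∈ D.baseForms i j := by
  obtain ⟨b, rfl⟩ := Ideal.Quotient.mk_surjective x
  exact ⟨(D.ΓB i).incl (Ideal.Quotient.mk _ b), D.projLeft_incl i j _⟩

theorem overlapD_incl_mem (x : X.Overlap i j) :
    D.overlapD i j (D.overlapIncl i j x) ∈ D.baseForms i j := by
  obtain ⟨b, rfl⟩ := Ideal.Quotient.mk_surjective x
  exact ⟨(D.ΓB i).dB (Ideal.Quotient.mk _ b), D.projLeft_dB i j _⟩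

theorem baseForms_eq_range_projRight :
    D.baseForms i j = ((D.projRight i j).comp (D.inL j)).range := by
  apply le_antisymm
  · rintro _ ⟨γ, rfl⟩
    change D.projLeft i j (D.inL i γ) ∈ _
    induction γ using (D.ΓB i).induction_generated with
    | incl a =>
      obtain ⟨b, rfl⟩ := Ideal.Quotient.mk_surjective a
      rw [projLeft_incl]
      exact ⟨(D.ΓB j).incl (Ideal.Quotient.mk _ b), D.projRight_incl i j _⟩
    | dB a =>
      obtain ⟨b, rfl⟩ := Ideal.Quotient.mk_surjective a
      rw [projLeft_dB]
      exact ⟨(D.ΓB j).dB (Ideal.Quotient.mk _ b), D.projRight_dB i j _⟩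
    | add x y hx hy => rw [map_add, map_add]; exact add_mem hx hy
    | mul x y hx hy => rw [map_mul, map_mul]; exact mul_mem hx hy
  · rintro _ ⟨γ, rfl⟩
    change D.projRight i j (D.inL j γ) ∈ _
    induction γ using (D.ΓB j).induction_generated with
    | incl a => rw [projRight_incl]; exact D.overlapIncl_mem i j _
    | dB a => rw [projRight_dB]; exact D.overlapD_incl_mem i j _
    | add x y hx hy => rw [map_add, map_add]; exact add_mem hx hy
    | mul x y hx hy => rw [map_mul, map_mul]; exact mul_mem hx hy

theorem projRight_inL_mem (γ : (D.ΓB j).carrier) :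
    D.projRight i j (D.inL j γ) ∈ D.baseForms i j :=
  D.baseForms_eq_range_projRight i j ▸ ⟨γ, rfl⟩

/-- The image of `H` in the overlap calculus under the trivialization over `i`. -/
def leftH : H →ₐ[ℂ] D.OverlapForms i j := (D.projLeft i j).comp (D.inH i)

/-- The image of `H` in the overlap calculus under the trivialization over `j`. -/
def rightH : H →ₐ[ℂ] D.OverlapForms i j := (D.projRight i j).comp (D.inH j)

variable {i j}

theorem commute_leftH (h : H) {z : D.OverlapForms i j} (hz : z ∈ D.baseForms i j) :
    Commute (D.leftH i j h) z := by
  obtain ⟨γ, rfl⟩ := hz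
  exact (commute_inRight_incl_inLeft _ _ h γ).map (D.projLeft i j)

theorem commute_rightH (h : H) {z : D.OverlapForms i j} (hz : z ∈ D.baseForms i j) :
    Commute (D.rightH i j h) z := by
  rw [baseForms_eq_range_projRight] at hz
  obtain ⟨γ, rfl⟩ := hz
  exact (commute_inRight_incl_inLeft _ _ h γ).map (D.projRight i j)

variable (i j)

theorem projLeft_inZero (z : X.Loc i ⊗[ℂ] H) : D.projLeft i j (D.inZero i z) =
    LinearMap.mul' ℂ _ (TensorProduct.map (D.overlapIncl i j).toLinearMap (D.leftH i j).toLinearMap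
      ((X.resLeft i j).toLinearMap.rTensor H z)) := by
  induction z with
  | zero => simp only [map_zero]
  | add x y hx hy => simp only [map_add, hx, hy]
  | tmul a h =>
    rw [inZero_tmul, map_mul, projLeft_incl]
    rfl

/-- The transition function `τ_ij` with values in the overlap calculus. -/
def trans (τ : ∀ i j, H →ₐ[ℂ] X.Overlap i j) : H →ₐ[ℂ] D.OverlapForms i j :=
  (D.overlapIncl i j).comp (τ i j)

/-- The transition function `τ_ji` with values in the overlap calculus. -/
def transSwap (τ : ∀ i j, H →ₐ[ℂ] X.Overlap i j) : H →ₐ[ℂ] D.OverlapForms i j :=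
  (D.overlapIncl i j).comp ((X.overlapSwap i j).comp (τ j i))

variable {τ : ∀ i j, H →ₐ[ℂ] X.Overlap i j}

theorem trans_mem (h : H) : D.trans i j τ h ∈ D.baseForms i j := D.overlapIncl_mem i j _

variable (hτ : X.IsTransition τ)

include hτ

theorem trans_mul_transSwap :
    toConv (D.trans i j τ).toLinearMap * toConv (D.transSwap i j τ).toLinearMap = 1 := by
  have image := congr((D.overlapIncl i j).toLinearMap ∘ₗ ofConv $(hτ.mul_eq_one i j))
  rw [LinearMap.algHom_comp_convMul_distrib] at image
  exact ofConv_injective (image.trans (by ext; simp))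

theorem transSwap_mul_trans :
    toConv (D.transSwap i j τ).toLinearMap * toConv (D.trans i j τ).toLinearMap = 1 := by
  have image := congr((D.overlapIncl i j).toLinearMap ∘ₗ ofConv $(hτ.swap_mul_eq_one i j))
  rw [LinearMap.algHom_comp_convMul_distrib] at image
  exact ofConv_injective (image.trans (by ext; simp))

theorem trans_comp_antipode :
    (D.trans i j τ).toLinearMap ∘ₗ antipode ℂ = (D.transSwap i j τ).toLinearMap :=
  comp_antipode_eq_of_mul_eq_one (D.trans_mul_transSwap i j hτ)

theorem transSwap_comp_antipode :
    (D.transSwap i j τ).toLinearMap ∘ₗ antipode ℂ = (D.trans i j τ).toLinearMap :=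
  comp_antipode_eq_of_mul_eq_one (D.transSwap_mul_trans i j hτ)

theorem rightH_eq : (D.rightH i j).toLinearMap =
    convolve (D.transSwap i j τ).toLinearMap (D.leftH i j).toLinearMap := by
  ext h
  obtain ⟨p, hp⟩ := X.χ_surjective j (1 ⊗ₜ h)
  have rightH_apply : D.rightH i j h = Ideal.Quotient.mk _ (D.ΓP.incl p) := by
    rw [← projRight_χΓ, D.χΓ_incl, hp, inZero_tmul, map_one, map_one, one_mul]
    rfl
  have left_eq := D.projLeft_inZero i j (X.χ i p)
  rw [← D.χΓ_incl, projLeft_χΓ, ← rightH_apply, hτ, hp, LinearMap.rTensor_tmul,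
    AlgHom.toLinearMap_apply, map_one, LocallyTrivialQPFB.twist_tmul _ _ (ℛ ℂ h)] at left_eq
  rw [convolve_repr (ℛ ℂ h)]
  refine left_eq.trans ?_
  simp [transSwap]

variable {i j}

theorem commute_transSwap (h : H) {z : D.OverlapForms i j} (hz : z ∈ D.baseForms i j) :
    Commute (D.transSwap i j τ h) z := by
  refine commute_convConst_iff (f := (D.transSwap i j τ).toLinearMap).1 ?_ h
  have comm_left : Commute (toConv (D.leftH i j).toLinearMap) (convConst z) :=
    commute_convConst_iff.2 fun k => D.commute_leftH k hz
  have comm_right : Commute (toConv (D.rightH i j).toLinearMap) (convConst z) :=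
    commute_convConst_iff.2 fun k => D.commute_rightH k hz
  rw [D.rightH_eq i j hτ, toConv_convolve] at comm_right
  apply (isUnit_toConv_algHom (D.leftH i j)).mul_right_cancel
  rw [mul_assoc, ← comm_left.eq, ← mul_assoc, comm_right.eq, mul_assoc]

theorem commute_trans (h : H) {z : D.OverlapForms i j} (hz : z ∈ D.baseForms i j) :
    Commute (D.trans i j τ h) z := by
  have trans_apply := LinearMap.congr_fun (D.transSwap_comp_antipode i j hτ) h
  rw [LinearMap.comp_apply, AlgHom.toLinearMap_apply, AlgHom.toLinearMap_apply] at trans_apply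
  exact trans_apply ▸ D.commute_transSwap hτ _ hz

theorem commute_overlapD_transSwap (h : H) (c : X.Overlap i j) :
    Commute (D.overlapD i j (D.transSwap i j τ h)) (D.overlapIncl i j c) := by
  let u := X.overlapSwap i j (τ j i h)
  have comm_dc : Commute (D.overlapIncl i j u) (D.overlapD i j (D.overlapIncl i j c)) :=
    D.commute_transSwap hτ h (D.overlapD_incl_mem i j c)
  have comm_c : D.overlapIncl i j (u * c) = D.overlapIncl i j (c * u) := by
    rw [map_mul, map_mul]
    exact D.commute_transSwap hτ h (D.overlapIncl_mem i j c)
  have d_comm := congr(D.overlapD i j $comm_c)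
  rw [overlapD_incl_mul, overlapD_incl_mul, comm_dc.eq, add_comm] at d_comm
  exact add_left_cancel d_comm

variable (i j)

theorem convolve_trans_overlapD_transSwap :
    convolve (D.trans i j τ).toLinearMap (D.overlapD i j ∘ₗ (D.transSwap i j τ).toLinearMap) =
      -convolve (D.overlapD i j ∘ₗ (D.trans i j τ).toLinearMap)
        (D.transSwap i j τ).toLinearMap := by
  rw [eq_neg_iff_add_eq_zero, add_comm]
  ext h
  have d_one := congr(D.overlapD i j (ofConv $(D.trans_mul_transSwap i j hτ) h))
  rw [← toConv_convolve, ofConv_toConv, convolve_repr (ℛ ℂ h), map_sum] at d_one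
  rw [LinearMap.add_apply, convolve_repr (ℛ ℂ h), convolve_repr (ℛ ℂ h), ← Finset.sum_add_distrib]
  refine .trans (Finset.sum_congr rfl fun k _ => ?_) (d_one.trans ?_)
  · have d_mul := D.overlapD_incl_mul i j (τ i j ((ℛ ℂ h).left k))
      (X.overlapSwap i j (τ j i ((ℛ ℂ h).right k)))
    rw [map_mul] at d_mul
    exact d_mul.symm
  · change D.overlapD i j (algebraMap ℂ _ (counit h)) = 0
    rw [Algebra.algebraMap_eq_smul_one, map_smul, overlapD_one, smul_zero]

end Overlap

end DifferentialStructure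

/-! ### Compatibility of local connection maps -/

namespace DifferentialStructure

open Coalgebra HopfAlgebra WithConv DifferentialCalculus

variable {I H B P : Type*} [Ring H] [HopfAlgebra ℂ H] [Ring B] [Algebra ℂ B]
  [Ring P] [Algebra ℂ P] {X : LocallyTrivialQPFB I H B P} (D : DifferentialStructure X)

section Gluing

/-- The form `hor_i(d z)` for the connection with local connection map `A` that is linear for the
action of `P` from the side `s`. -/
def connForm (s : Side) (i : I) (A : H →ₗ[ℂ] (D.ΓB i).carrier) :
    X.Loc i ⊗[ℂ] H →ₗ[ℂ] D.Local i :=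
  horDiff s ((D.inL i).toLinearMap ∘ₗ (D.ΓB i).dB)
    ((D.inL i).toLinearMap ∘ₗ (D.ΓB i).incl.toLinearMap) (D.inH i).toLinearMap
    ((D.inL i).toLinearMap ∘ₗ A)

/-- The counterpart of `connForm` over an overlap. -/
def overlapForm (s : Side) (i j : I) (x a : H →ₗ[ℂ] D.OverlapForms i j) :
    X.Overlap i j ⊗[ℂ] H →ₗ[ℂ] D.OverlapForms i j :=
  horDiff s (D.overlapD i j ∘ₗ (D.overlapIncl i j).toLinearMap) (D.overlapIncl i j).toLinearMap x a

/-- The local connection map `A` over `i` as a map to the overlap calculus. -/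
def leftA (i j : I) (A : H →ₗ[ℂ] (D.ΓB i).carrier) : H →ₗ[ℂ] D.OverlapForms i j :=
  (D.projLeft i j).toLinearMap ∘ₗ (D.inL i).toLinearMap ∘ₗ A

/-- The local connection map `A` over `j` as a map to the overlap calculus. -/
def rightA (i j : I) (A : H →ₗ[ℂ] (D.ΓB j).carrier) : H →ₗ[ℂ] D.OverlapForms i j :=
  (D.projRight i j).toLinearMap ∘ₗ (D.inL j).toLinearMap ∘ₗ A

theorem leftA_mem (i j : I) (A : H →ₗ[ℂ] (D.ΓB i).carrier) (h : H) :
    D.leftA i j A h ∈ D.baseForms i j := D.projLeft_inL_mem i j _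

theorem rightA_mem (i j : I) (A : H →ₗ[ℂ] (D.ΓB j).carrier) (h : H) :
    D.rightA i j A h ∈ D.baseForms i j := D.projRight_inL_mem i j _

theorem projLeft_connForm (s : Side) (i j : I) (A : H →ₗ[ℂ] (D.ΓB i).carrier)
    (z : X.Loc i ⊗[ℂ] H) : D.projLeft i j (D.connForm s i A z) =
      D.overlapForm s i j (D.leftH i j).toLinearMap (D.leftA i j A)
        ((X.resLeft i j).toLinearMap.rTensor H z) := by
  rw [overlapForm, horDiff_rTensor, connForm, algHom_horDiff]
  congr 2
  · exact LinearMap.ext (D.projLeft_dB i j)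
  · exact LinearMap.ext (D.projLeft_incl i j)

theorem projRight_connForm (s : Side) (i j : I) (A : H →ₗ[ℂ] (D.ΓB j).carrier)
    (z : X.Loc j ⊗[ℂ] H) : D.projRight i j (D.connForm s j A z) =
      D.overlapForm s i j (D.rightH i j).toLinearMap (D.rightA i j A)
        ((X.resRight i j).toLinearMap.rTensor H z) := by
  rw [overlapForm, horDiff_rTensor, connForm, algHom_horDiff]
  congr 2
  · exact LinearMap.ext (D.projRight_dB i j)
  · exact LinearMap.ext (D.projRight_incl i j)

/-- The amount by which local connection maps `a` over `i` and `a'` over `j`, with values in the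
overlap calculus, violate the compatibility condition multiplied by `τ_ji` from the left. -/
def gaugeDefect (τ : ∀ i j, H →ₐ[ℂ] X.Overlap i j) (i j : I)
    (a a' : H →ₗ[ℂ] D.OverlapForms i j) : H →ₗ[ℂ] D.OverlapForms i j :=
  convolve (D.transSwap i j τ).toLinearMap a - D.overlapD i j ∘ₗ (D.transSwap i j τ).toLinearMap -
    convolve a' (D.transSwap i j τ).toLinearMap

variable {τ : ∀ i j, H →ₐ[ℂ] X.Overlap i j} (hτ : X.IsTransition τ)

include hτ

theorem overlapForm_sub_overlapForm_twist (s : Side) {i j : I} {a : H →ₗ[ℂ] D.OverlapForms i j}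
    (ha : ∀ h, a h ∈ D.baseForms i j) (a' : H →ₗ[ℂ] D.OverlapForms i j) (c : X.Overlap i j)
    (h : H) :
    D.overlapForm s i j (D.rightH i j).toLinearMap a' (c ⊗ₜ h) -
      D.overlapForm s i j (D.leftH i j).toLinearMap a
        (LocallyTrivialQPFB.twist ((X.overlapSwap i j).comp (τ j i)) (c ⊗ₜ h)) =
      sideMul ℂ s (D.overlapIncl i j c)
        (convolve (D.gaugeDefect τ i j a a') (D.leftH i j).toLinearMap h) := by
  rw [D.rightH_eq i j hτ]
  exact horDiff_sub_horDiff_twist s (δ := D.overlapD i j ∘ₗ (D.overlapIncl i j).toLinearMap)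
    (o := D.overlapIncl i j) (t := (X.overlapSwap i j).comp (τ j i)) a'
    (D.overlapD_incl_mul i j)
    (fun k c => D.commute_transSwap hτ k (D.overlapIncl_mem i j c))
    (fun k l => D.commute_transSwap hτ k (ha l))
    (fun k c => D.commute_leftH k (D.overlapIncl_mem i j c))
    (D.commute_overlapD_transSwap hτ) c h

theorem isCompatible_iff_gaugeDefect (A : ∀ i, H →ₗ[ℂ] (D.ΓB i).carrier) :
    D.IsCompatible τ A ↔
      ∀ i j, D.gaugeDefect τ i j (D.leftA i j (A i)) (D.rightA i j (A j)) = 0 :=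
  forall₂_congr fun i j => toConv_injective.eq_iff.symm.trans
    ((eq_conj_add_iff (D.trans_mul_transSwap i j hτ) (D.transSwap_mul_trans i j hτ) _ _ _).trans
      toConv_injective.eq_iff)

theorem isCompatible_iff_connForm (s : Side) (A : ∀ i, H →ₗ[ℂ] (D.ΓB i).carrier) :
    D.IsCompatible τ A ↔ ∀ i j p, D.projLeft i j (D.connForm s i (A i) (X.χ i p)) =
      D.projRight i j (D.connForm s j (A j) (X.χ j p)) := by
  rw [D.isCompatible_iff_gaugeDefect hτ]
  refine forall₂_congr fun i j => ?_
  have defect := D.overlapForm_sub_overlapForm_twist hτ s (D.leftA_mem i j (A i))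
    (D.rightA i j (A j))
  constructor
  · intro h0 p
    rw [projLeft_connForm, projRight_connForm, hτ]
    induction (X.resRight i j).toLinearMap.rTensor H (X.χ j p) with
    | zero => simp only [map_zero]
    | add x y hx hy => simp only [map_add, hx, hy]
    | tmul c h =>
      specialize defect c h
      rw [h0, zero_convolve, LinearMap.zero_apply, map_zero] at defect
      exact (sub_eq_zero.1 defect).symm
  · intro glue
    refine eq_zero_of_convolve_algHom (D.leftH i j) (LinearMap.ext fun h => ?_)
    obtain ⟨p, hp⟩ := X.χ_surjective j (1 ⊗ₜ h)
    specialize glue p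
    rw [projLeft_connForm, projRight_connForm, hτ, hp, LinearMap.rTensor_tmul,
      AlgHom.toLinearMap_apply, map_one] at glue
    specialize defect 1 h
    rw [glue, sub_self, map_one, one_sideMul] at defect
    exact defect.symm

end Gluing

section NegAntipode

variable {τ : ∀ i j, H →ₐ[ℂ] X.Overlap i j}

/-- The right hand side of the compatibility condition, as a function of the local connection
map with values in the overlap calculus. -/
def gaugeTransform (τ : ∀ i j, H →ₐ[ℂ] X.Overlap i j) (i j : I) (a : H →ₗ[ℂ] D.OverlapForms i j) :
    H →ₗ[ℂ] D.OverlapForms i j :=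
  convolve (convolve (D.trans i j τ).toLinearMap a) (D.transSwap i j τ).toLinearMap +
    convolve (D.trans i j τ).toLinearMap (D.overlapD i j ∘ₗ (D.transSwap i j τ).toLinearMap)

theorem convolve_trans_comp_antipode (hτ : X.IsTransition τ) {i j : I}
    {a : H →ₗ[ℂ] D.OverlapForms i j} (ha : ∀ h, a h ∈ D.baseForms i j) :
    convolve (convolve (D.trans i j τ).toLinearMap a) (D.transSwap i j τ).toLinearMap ∘ₗ
        antipode ℂ =
      convolve (convolve (D.trans i j τ).toLinearMap (a ∘ₗ antipode ℂ))
        (D.transSwap i j τ).toLinearMap := by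
  have mem : ∀ h, convolve (D.trans i j τ).toLinearMap a h ∈ D.baseForms i j := fun h => by
    rw [convolve_repr (ℛ ℂ h)]
    exact sum_mem fun m _ => mul_mem (D.trans_mem i j _) (ha _)
  rw [convolve_comp_antipode fun x y => (D.commute_transSwap hτ y (mem x)).symm,
    convolve_comp_antipode fun x y => D.commute_trans hτ x (ha y),
    D.trans_comp_antipode i j hτ, D.transSwap_comp_antipode i j hτ, convolve_assoc]

theorem convolve_trans_overlapD_comp_antipode (hτ : X.IsTransition τ) (i j : I) :
    convolve (D.trans i j τ).toLinearMap (D.overlapD i j ∘ₗ (D.transSwap i j τ).toLinearMap) ∘ₗ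
        antipode ℂ =
      -convolve (D.trans i j τ).toLinearMap
        (D.overlapD i j ∘ₗ (D.transSwap i j τ).toLinearMap) := by
  rw [convolve_comp_antipode fun x y => D.commute_trans hτ x (D.overlapD_incl_mem i j _),
    LinearMap.comp_assoc, D.trans_comp_antipode i j hτ, D.transSwap_comp_antipode i j hτ,
    D.convolve_trans_overlapD_transSwap i j hτ, neg_neg]

theorem gaugeTransform_neg_comp_antipode (hτ : X.IsTransition τ) {i j : I}
    {a : H →ₗ[ℂ] D.OverlapForms i j} (ha : ∀ h, a h ∈ D.baseForms i j) :
    D.gaugeTransform τ i j (-(a ∘ₗ antipode ℂ)) =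
      -(D.gaugeTransform τ i j a ∘ₗ antipode ℂ) := by
  rw [gaugeTransform, gaugeTransform, LinearMap.add_comp, D.convolve_trans_comp_antipode hτ ha,
    D.convolve_trans_overlapD_comp_antipode hτ, convolve_neg, neg_convolve, neg_add, neg_neg]

theorem isCompatible_negAntipode (hS : Function.Bijective (antipode ℂ : H →ₗ[ℂ] H))
    (hτ : X.IsTransition τ) (A : ∀ i, H →ₗ[ℂ] (D.ΓB i).carrier) :
    D.IsCompatible τ A ↔ D.IsCompatible τ (D.negAntipode A) := by
  refine forall₂_congr fun i j => ?_
  change D.leftA i j (A i) = D.gaugeTransform τ i j (D.rightA i j (A j)) ↔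
    D.leftA i j (D.negAntipode A i) = D.gaugeTransform τ i j (D.rightA i j (D.negAntipode A j))
  have left_neg : D.leftA i j (D.negAntipode A i) = -(D.leftA i j (A i) ∘ₗ antipode ℂ) := by
    ext h; simp [leftA, negAntipode]
  have right_neg : D.rightA i j (D.negAntipode A j) = -(D.rightA i j (A j) ∘ₗ antipode ℂ) := by
    ext h; simp [rightA, negAntipode]
  rw [left_neg, right_neg, D.gaugeTransform_neg_comp_antipode hτ (D.rightA_mem i j _), neg_inj,
    LinearMap.cancel_right hS.2]

theorem isNormalized_negAntipode (hS : Function.Bijective (antipode ℂ : H →ₗ[ℂ] H))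
    (A : ∀ i, H →ₗ[ℂ] (D.ΓB i).carrier) :
    D.IsNormalized A ↔ D.IsNormalized (D.negAntipode A) := by
  refine and_congr (forall_congr' fun i => ?_) (forall_congr' fun i => ?_)
  · rw [hS.2.forall]
    exact forall_congr' fun h => neg_mem_iff.symm
  · simp [negAntipode]

theorem leftKernel_iff_rightKernel (hS : Function.Bijective (antipode ℂ : H →ₗ[ℂ] H))
    (A : ∀ i, H →ₗ[ℂ] (D.ΓB i).carrier) :
    D.LeftKernel hS A ↔ D.RightKernel hS (D.negAntipode A) := by
  refine forall_congr' fun i => ?_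
  rw [Submodule.map_le_iff_le_comap]
  refine forall₂_congr fun h _ => ?_
  simp [negAntipode]

theorem negAntipode_bijective (hS : Function.Bijective (antipode ℂ : H →ₗ[ℂ] H)) :
    Function.Bijective D.negAntipode := by
  refine ⟨fun A A' e => funext fun i => ?_, fun A => ⟨fun i => -(A i ∘ₗ antipodeInv hS), ?_⟩⟩
  · exact (LinearMap.cancel_right hS.2).1 (neg_injective (congrFun e i))
  · ext i h
    simp [negAntipode]

end NegAntipode

end DifferentialStructure

/-! ### Local connection maps of a connection -/

namespace RightCovariantCalculus

open Coalgebra HopfAlgebra DifferentialCalculus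

variable {H : Type*} [Ring H] [HopfAlgebra ℂ H] (Λ : RightCovariantCalculus H)

/-- The map `h ↦ ∑ σ(h₂) d h₁`, where `σ(h₂)` acts from the side `s`. It generalizes `eta`, which
is the case of `S⁻¹` acting from the left. -/
def etaSide (s : Side) (σ : H →ₗ[ℂ] H) : H →ₗ[ℂ] Λ.carrier :=
  TensorProduct.lift ((sideMul ℂ s).compl₁₂ (Λ.incl.toLinearMap ∘ₗ σ) Λ.dB) ∘ₗ
    (TensorProduct.comm ℂ H H).toLinearMap ∘ₗ comul

theorem etaSide_repr (s : Side) (σ : H →ₗ[ℂ] H) {h : H} {ι : Type*} (r : Repr ℂ h ι) :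
    Λ.etaSide s σ h = ∑ m ∈ r.index, sideMul ℂ s (Λ.incl (σ (r.right m))) (Λ.dB (r.left m)) := by
  simp [etaSide, ← r.eq]

variable (hS : Function.Bijective (antipode ℂ : H →ₗ[ℂ] H))

theorem etaSide_left_antipodeInv : Λ.etaSide .left (antipodeInv hS) = Λ.eta hS := by
  ext h
  rw [Λ.etaSide_repr _ _ (ℛ ℂ h)]
  simp [eta, ← (ℛ ℂ h).eq]

-- Apply `d` to `∑ h₁ S(h₂) = ε(h)`.
theorem etaSide_right_antipode (h : H) :
    Λ.etaSide .right (antipode ℂ) h = -Λ.eta hS (antipode ℂ h) := by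
  have comul_antipode := LinearMap.congr_fun (comul_comp_antipode (k := ℂ) (H := H)) h
  rw [LinearMap.comp_apply] at comul_antipode
  have eta_antipode : Λ.eta hS (antipode ℂ h) = ∑ m ∈ (ℛ ℂ h).index,
      Λ.incl ((ℛ ℂ h).left m) * Λ.dB (antipode ℂ ((ℛ ℂ h).right m)) := by
    simp [eta, comul_antipode, ← (ℛ ℂ h).eq]
  have d_counit := congr(Λ.dB $(sum_mul_antipode_eq_algebraMap_counit (ℛ ℂ h)))
  rw [map_sum, Algebra.algebraMap_eq_smul_one, map_smul, dB_one, smul_zero] at d_counit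
  rw [Λ.etaSide_repr _ _ (ℛ ℂ h), eta_antipode, eq_neg_iff_add_eq_zero, ← Finset.sum_add_distrib,
    ← d_counit]
  simp only [dB_mul, sideMul_right]

variable (H) in
/-- The map `σ` for which `etaSide s σ` cuts out the kernel condition of the connections of the
side `s`. -/
def sideAntipode : Side → H →ₗ[ℂ] H
  | .left => antipodeInv hS
  | .right => antipode ℂ

theorem counit_sideAntipode (s : Side) (h : H) :
    counit (R := ℂ) (sideAntipode H hS s h) = counit (R := ℂ) h := by
  cases s
  · exact counit_antipodeInv hS h
  · exact counit_antipode h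

theorem etaSide_sideAntipode_one (s : Side) : Λ.etaSide s (sideAntipode H hS s) 1 = 0 := by
  simp [etaSide, Bialgebra.comul_one, Algebra.TensorProduct.one_def]

end RightCovariantCalculus

namespace DifferentialStructure

open Coalgebra HopfAlgebra DifferentialCalculus RightCovariantCalculus

variable {I H B P : Type*} [Ring H] [HopfAlgebra ℂ H] [Ring B] [Algebra ℂ B]
  [Ring P] [Algebra ℂ P] {X : LocallyTrivialQPFB I H B P} (D : DifferentialStructure X)

section SideKernel

variable (hS : Function.Bijective (antipode ℂ : H →ₗ[ℂ] H))

/-- The kernel condition for the local connection maps of the connections of the side `s`. -/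
def SideKernel (s : Side) (A : ∀ i, H →ₗ[ℂ] (D.ΓB i).carrier) : Prop :=
  ∀ i h, D.ΓH.etaSide s (sideAntipode H hS s) h = 0 → counit (R := ℂ) h = 0 → A i h = 0

theorem sideKernel_left (A : ∀ i, H →ₗ[ℂ] (D.ΓB i).carrier) :
    D.SideKernel hS .left A ↔ D.LeftKernel hS A := by
  refine forall₂_congr fun i h => ?_
  rw [sideAntipode, etaSide_left_antipodeInv, rightIdeal, Submodule.mem_inf, LinearMap.mem_ker,
    LinearMap.mem_ker, LinearMap.mem_ker, and_imp]

theorem sideKernel_right (A : ∀ i, H →ₗ[ℂ] (D.ΓB i).carrier) :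
    D.SideKernel hS .right A ↔ D.RightKernel hS A := by
  refine forall_congr' fun i => ?_
  rw [Submodule.map_le_iff_le_comap, SetLike.le_def]
  conv_rhs => rw [hS.2.forall]
  refine forall_congr' fun h => ?_
  rw [sideAntipode, D.ΓH.etaSide_right_antipode hS, rightIdeal, Submodule.mem_inf,
    LinearMap.mem_ker, LinearMap.mem_ker, Submodule.mem_comap, LinearMap.mem_ker,
    antipodeInv_antipode, counit_antipode, and_imp, neg_eq_zero]

end SideKernel

/-- The left or right connections. -/
structure IsConnection (s : Side) (hor : D.forms →ₗ[ℂ] D.forms) : Prop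
    extends D.IsProjection hor where
  map_sideAct : ∀ p γ, hor (D.sideAct s p γ) = D.sideAct s p (hor γ)

/-- The map `g` of the local calculus over `i` is induced by the map `hor` of the one-forms on the
total space. It is unconstrained on the forms that are not of degree one. -/
def IsLocalMap (hor : D.forms →ₗ[ℂ] D.forms) (i : I) (g : D.Local i →ₗ[ℂ] D.Local i) : Prop :=
  ∀ γ, g (D.χc i γ) = D.χc i (hor γ)

theorem mem_horForms {γ : D.forms} : γ ∈ D.horForms ↔
    ∀ i, D.χc i γ ∈ horizontal (D.ΓB i) D.ΓH.toDifferentialCalculus := by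
  simp [horForms]

variable {D} {s : Side} {hor : D.forms →ₗ[ℂ] D.forms}

theorem IsProjection.apply_of_mem (h : D.IsProjection hor) {γ : D.forms} (hγ : γ ∈ D.horForms) :
    hor γ = γ := by
  obtain ⟨δ, rfl⟩ := h.range_eq ▸ hγ
  exact h.idem δ

theorem IsProjection.χc_apply_mem (h : D.IsProjection hor) (i : I) (γ : D.forms) :
    D.χc i (hor γ) ∈ horizontal (D.ΓB i) D.ΓH.toDifferentialCalculus :=
  D.mem_horForms.1 (h.range_eq ▸ LinearMap.mem_range_self hor γ) i

theorem IsProjection.exists_isLocalMap (h : D.IsProjection hor) (i : I) :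
    ∃ g, D.IsLocalMap hor i g := by
  obtain ⟨g, hg⟩ :=
    exists_comp_eq_of_ker_le (f := D.χc i) (g := D.χc i ∘ₗ hor) fun γ hγ => h.ker_le i γ hγ
  exact ⟨g, LinearMap.congr_fun hg⟩

variable {i : I} {g : D.Local i →ₗ[ℂ] D.Local i}

theorem IsLocalMap.apply_inR_dB (hg : D.IsLocalMap hor i g) (h : H) :
    g (D.inR i (D.ΓH.dB h)) = D.χc i (hor (D.dP (liftH X i h))) := by
  rw [← hg, χc_dP_liftH]
  rfl

theorem IsLocalMap.localMap_eq (hg : D.IsLocalMap hor i g) :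
    D.localMap hor i = -(D.idCounit i ∘ₗ g ∘ₗ (D.inR i).toLinearMap ∘ₗ D.ΓH.dB) := by
  ext h
  simp [localMap, hg.apply_inR_dB]

theorem IsLocalMap.rTensor_localCoact (hg : D.IsLocalMap hor i g) (h : D.IsProjection hor)
    (γ : D.forms) : g.rTensor H (D.localCoact i (D.χc i γ)) = D.localCoact i (g (D.χc i γ)) := by
  have comp_eq : g ∘ₗ D.χc i = D.χc i ∘ₗ hor := LinearMap.ext hg
  obtain ⟨t, ht, hor_t⟩ := h.covariant γ
  rw [hg, ← ht i, ← hor_t i, ← LinearMap.rTensor_comp_apply, ← LinearMap.rTensor_comp_apply,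
    comp_eq]

variable (D) in
theorem localCoact_inR_dB (i : I) (h : H) : D.localCoact i (D.inR i (D.ΓH.dB h)) =
    ((D.inR i).toLinearMap ∘ₗ D.ΓH.dB).rTensor H (comul (R := ℂ) h) := by
  have coact_dB : D.ΓH.coact (D.ΓH.dB h) = D.ΓH.dB.rTensor H (comul (R := ℂ) h) := D.ΓH.coact_d h
  have inR_coact := D.localCoact_mul i 1 (D.ΓH.dB h)
  rwa [map_one, one_mul, coact_dB, ← Algebra.TensorProduct.one_def, one_mul,
    ← LinearMap.rTensor_comp_apply] at inR_coact

-- Horizontal forms are recovered from `id ⊗ ε` by covariance.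
theorem IsLocalMap.comp_inR_dB (hg : D.IsLocalMap hor i g) (h : D.IsProjection hor) :
    g ∘ₗ (D.inR i).toLinearMap ∘ₗ D.ΓH.dB =
      -convolve ((D.inL i).toLinearMap ∘ₗ D.localMap hor i) (D.inH i).toLinearMap := by
  ext k
  have hor_mem := h.χc_apply_mem i (D.dP (liftH X i k))
  have recover := D.horIncl_rTensor_idCounit_localCoact hor_mem
  have coact_eq := hg.rTensor_localCoact h (D.dP (liftH X i k))
  rw [hg] at coact_eq
  have inR_eq : D.χc i (D.dP (liftH X i k)) = D.inR i (D.ΓH.dB k) := D.χc_dP_liftH i k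
  rw [← coact_eq, inR_eq, localCoact_inR_dB, ← LinearMap.rTensor_comp_apply,
    ← LinearMap.rTensor_comp_apply, ← hg.apply_inR_dB, ← (ℛ ℂ k).eq] at recover
  rw [hg.localMap_eq, LinearMap.neg_apply, convolve_repr (ℛ ℂ k)]
  refine recover.symm.trans ?_
  simp [horIncl_tmul]

theorem IsLocalMap.map_sideMul (hg : D.IsLocalMap hor i g) (h : D.IsConnection s hor)
    (x : X.Loc i ⊗[ℂ] H) (γ : D.forms) :
    g (sideMul ℂ s (D.inZero i x) (D.χc i γ)) = sideMul ℂ s (D.inZero i x) (g (D.χc i γ)) := by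
  obtain ⟨p, rfl⟩ := X.χ_surjective i x
  rw [← χc_sideAct, hg, hg, h.map_sideAct, χc_sideAct]

variable (D) in
theorem inZero_one_tmul (i : I) (h : H) : D.inZero i (1 ⊗ₜ h) = D.inH i h := by
  rw [inZero_tmul, map_one, map_one, one_mul]

variable (D) in
theorem inZero_tmul_one (i : I) (a : X.Loc i) :
    D.inZero i (a ⊗ₜ 1) = D.inL i ((D.ΓB i).incl a) := by
  rw [inZero_tmul, map_one, mul_one]

variable (D) in
theorem sideMul_inH_inL (s : Side) (i : I) (h : H) (γ : (D.ΓB i).carrier) :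
    sideMul ℂ s (D.inH i h) (D.inL i γ) = D.inL i γ * D.inH i h := by
  cases s
  · exact (commute_inRight_incl_inLeft _ _ h γ).eq
  · rfl

variable (D) in
theorem sideMul_inL_incl_inR (s : Side) (i : I) (a : X.Loc i) (ω : D.ΓH.carrier) :
    sideMul ℂ s (D.inL i ((D.ΓB i).incl a)) (D.inR i ω) =
      D.inL i ((D.ΓB i).incl a) * D.inR i ω := by
  cases s
  · rfl
  · exact (commute_inRight_inLeft_incl _ _ ω a).eq

theorem IsProjection.map_dP_ι (h : D.IsProjection hor) (b : B) :
    hor (D.dP (X.ι b)) = D.dP (X.ι b) := by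
  refine h.apply_of_mem (D.mem_horForms.2 fun j => D.mem_horizontal.2
    ⟨(D.ΓB j).dB (Ideal.Quotient.mk _ b) ⊗ₜ 1, ?_⟩)
  rw [horIncl_tmul, χc_dP, X.χ_ι, dLoc_tmul, dB_one, map_zero, mul_zero, add_zero]

theorem IsLocalMap.apply_dLoc (hg : D.IsLocalMap hor i g) (h : D.IsConnection s hor)
    (z : X.Loc i ⊗[ℂ] H) : g (D.dLoc i z) = D.connForm s i (D.localMap hor i) z := by
  induction z with
  | zero => simp only [map_zero]
  | add x y hx hy => simp only [map_add, hx, hy]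
  | tmul a k =>
    obtain ⟨b, rfl⟩ := Ideal.Quotient.mk_surjective a
    have χ_b : D.χc i (D.dP (X.ι b)) = D.inL i ((D.ΓB i).dB (Ideal.Quotient.mk _ b)) := by
      rw [χc_dP, X.χ_ι, dLoc_tmul, dB_one, map_one, map_zero, mul_one, mul_zero, add_zero]
    have base_part := hg.map_sideMul h (1 ⊗ₜ k) (D.dP (X.ι b))
    rw [hg, h.map_dP_ι, χ_b, inZero_one_tmul, sideMul_inH_inL] at base_part
    have fibre_part := hg.map_sideMul h (Ideal.Quotient.mk _ b ⊗ₜ 1) (D.dP (liftH X i k))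
    have inR_eq : D.χc i (D.dP (liftH X i k)) = D.inR i (D.ΓH.dB k) := D.χc_dP_liftH i k
    have vertical := LinearMap.congr_fun (hg.comp_inR_dB h.toIsProjection) k
    simp only [LinearMap.comp_apply, AlgHom.toLinearMap_apply, LinearMap.neg_apply] at vertical
    rw [inR_eq, inZero_tmul_one, sideMul_inL_incl_inR, vertical, map_neg] at fibre_part
    rw [dLoc_tmul, map_add, base_part, fibre_part, ← sub_eq_add_neg, connForm, horDiff_tmul]
    rfl

theorem IsConnection.χc_dP (h : D.IsConnection s hor) (i : I) (p : P) :
    D.χc i (hor (D.dP p)) = D.connForm s i (D.localMap hor i) (X.χ i p) := by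
  obtain ⟨g, hg⟩ := h.exists_isLocalMap i
  rw [← hg.apply_dLoc h, ← hg, DifferentialStructure.χc_dP]

variable (D) in
theorem eqOn_χΓ_deg_one (s : Side) (i : I) {V : Type*} [AddCommGroup V] [Module ℂ V]
    {f f' : D.Local i →ₗ[ℂ] V} (h : ∀ z z', f (sideMul ℂ s (D.inZero i z) (D.dLoc i z')) =
      f' (sideMul ℂ s (D.inZero i z) (D.dLoc i z'))) {y : D.ΓP.carrier} (hy : y ∈ D.ΓP.deg 1) :
    f (D.χΓ i y) = f' (D.χΓ i y) := by
  suffices hle : D.ΓP.exactSpan s ≤ LinearMap.eqLocus (f ∘ₗ (D.χΓ i).toLinearMap)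
      (f' ∘ₗ (D.χΓ i).toLinearMap) from hle (D.ΓP.deg_one_le_exactSpan s hy)
  refine Submodule.span_le.2 ?_
  rintro _ ⟨p, q, rfl⟩
  change f (D.χΓ i _) = f' (D.χΓ i _)
  rw [_root_.map_sideMul, D.χΓ_incl, χΓ_dB]
  exact h _ _

theorem IsConnection.eq_of_localMap_eq {hor' : D.forms →ₗ[ℂ] D.forms} (h : D.IsConnection s hor)
    (h' : D.IsConnection s hor') (eq : D.localMap hor = D.localMap hor') : hor = hor' := by
  refine LinearMap.ext fun γ => D.forms_ext fun i => ?_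
  obtain ⟨g, hg⟩ := h.exists_isLocalMap i
  obtain ⟨g', hg'⟩ := h'.exists_isLocalMap i
  obtain ⟨y, hy, hγ⟩ := D.exists_lift γ i
  rw [← hg, ← hg', ← hγ]
  refine D.eqOn_χΓ_deg_one s i (fun z z' => ?_) hy
  obtain ⟨p, rfl⟩ := X.χ_surjective i z'
  rw [← D.χc_dP, hg.map_sideMul h, hg'.map_sideMul h', hg, hg', h.χc_dP, h'.χc_dP, eq]

variable (D) in
theorem idCounit_skewProj_one_mem (i : I) (w : D.Local i) :
    D.idCounit i (skewProj _ _ 1 w) ∈ (D.ΓB i).deg 1 := by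
  induction w using skew_induction with
  | add x y hx hy => rw [map_add, map_add]; exact add_mem hx hy
  | mul γ ω =>
    have split : skewProj (D.ΓB i) D.ΓH.toDifferentialCalculus 1 (D.inL i γ * D.inR i ω) =
        D.inL i (GradedAlgebra.proj (D.ΓB i).deg 0 γ) *
            D.inR i (GradedAlgebra.proj D.ΓH.deg 1 ω) +
          D.inL i (GradedAlgebra.proj (D.ΓB i).deg 1 γ) *
            D.inR i (GradedAlgebra.proj D.ΓH.deg 0 ω) := by
      simp [skewProj_apply, skewGradingHom_inLeft, skewGradingHom_inRight,
        Polynomial.mul_coeff_one, coeff_gradingHom]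
    rw [split, map_add, idCounit_mul, idCounit_mul, D.counitΓ_of_mem (gradedProj_mem _ _ _),
      zero_smul, zero_add]
    exact Submodule.smul_mem _ _ (gradedProj_mem _ _ _)

variable (D) in
theorem localMap_mem (hor : D.forms →ₗ[ℂ] D.forms) (i : I) (k : H) :
    D.localMap hor i k ∈ (D.ΓB i).deg 1 := by
  obtain ⟨y, hy, eq⟩ := D.exists_lift (hor (D.dP (liftH X i k))) i
  rw [← gradedProj_of_mem D.ΓP.deg hy, χΓ_proj] at eq
  have mem := neg_mem (D.idCounit_skewProj_one_mem i (D.χΓ i y))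
  rwa [eq] at mem

theorem IsProjection.localMap_one (h : D.IsProjection hor) (i : I) : D.localMap hor i 1 = 0 := by
  rw [D.localMap_eq h i 1 0, map_zero, map_zero, map_zero, neg_zero]
  rw [map_zero, map_one, D.ΓH.d_one, map_zero]

theorem IsProjection.isNormalized (h : D.IsProjection hor) : D.IsNormalized (D.localMap hor) :=
  ⟨D.localMap_mem hor, h.localMap_one⟩

theorem IsConnection.isCompatible {τ : ∀ i j, H →ₐ[ℂ] X.Overlap i j} (hτ : X.IsTransition τ)
    (h : D.IsConnection s hor) : D.IsCompatible τ (D.localMap hor) := by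
  refine (D.isCompatible_iff_connForm hτ s _).2 fun i j p => ?_
  obtain ⟨y, _, hi, hj⟩ := D.exists_common_lift (hor (D.dP p)) i j
  rw [← h.χc_dP, ← h.χc_dP, ← hi, ← hj, projLeft_χΓ, projRight_χΓ]

variable (D) in
theorem idCounit_sideMul_inH (s : Side) (i : I) (h : H) {w : D.Local i}
    (hw : w ∈ horizontal (D.ΓB i) D.ΓH.toDifferentialCalculus) :
    D.idCounit i (sideMul ℂ s (D.inH i h) w) = counit (R := ℂ) h • D.idCounit i w := by
  obtain ⟨z, rfl⟩ := D.mem_horizontal.1 hw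
  rw [← inZero_one_tmul, sideMul_inZero_horIncl, idCounit_horIncl, idCounit_horIncl]
  clear hw
  induction z with
  | zero => simp only [map_zero, smul_zero]
  | add x y hx hy => simp only [map_add, smul_add, hx, hy]
  | tmul γ k => cases s <;> simp [mul_smul, mul_comm]

theorem IsConnection.sideKernel (hS : Function.Bijective (antipode ℂ : H →ₗ[ℂ] H))
    (h : D.IsConnection s hor) : D.SideKernel hS s (D.localMap hor) := by
  intro i k eta_eq_zero _
  obtain ⟨g, hg⟩ := h.exists_isLocalMap i
  have counit_g (l m : H) : D.idCounit i (g (D.inR i (sideMul ℂ s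
      (D.ΓH.incl l) (D.ΓH.dB m)))) = -(counit (R := ℂ) l • D.localMap hor i m) := by
    have inR_eq : D.χc i (D.dP (liftH X i m)) = D.inR i (D.ΓH.dB m) := D.χc_dP_liftH i m
    rw [_root_.map_sideMul, inR_incl, ← inZero_one_tmul, ← inR_eq, hg.map_sideMul h,
      inZero_one_tmul, hg, D.idCounit_sideMul_inH s i l (h.χc_apply_mem i _), ← smul_neg]
    exact congrArg _ (neg_neg _).symm
  have eq := congr(D.idCounit i (g (D.inR i $eta_eq_zero)))
  rw [map_zero, map_zero, map_zero, etaSide_repr _ _ _ (ℛ ℂ k), map_sum, map_sum, map_sum] at eq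
  simp only [counit_g, counit_sideAntipode, Finset.sum_neg_distrib, neg_eq_zero, ← map_smul,
    ← map_sum] at eq
  rwa [sum_counit_smul_left] at eq

theorem LeftConnection.isConnection (ω : D.LeftConnection) : D.IsConnection .left ω.hor :=
  ⟨ω.isProjection, ω.map_leftMul⟩

theorem RightConnection.isConnection (ω : D.RightConnection) : D.IsConnection .right ω.hor :=
  ⟨ω.isProjection, ω.map_rightMul⟩

end DifferentialStructure

/-! ### Covariance of the local connection forms -/

namespace RightCovariantCalculus

open Coalgebra HopfAlgebra DifferentialCalculus

variable {H : Type*} [Ring H] [HopfAlgebra ℂ H] (Λ : RightCovariantCalculus H)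
  (hS : Function.Bijective (antipode ℂ : H →ₗ[ℂ] H))

theorem sideAntipode_sideMul (s : Side) (x y : H) : sideAntipode H hS s (sideMul ℂ s x y) =
    sideMul ℂ s (sideAntipode H hS s y) (sideAntipode H hS s x) := by
  cases s
  · exact antipodeInv_mul hS x y
  · exact antipode_mul_antidistrib y x

theorem sum_sideMul_sideAntipode (s : Side) {h : H} {ι : Type*} (r : Repr ℂ h ι) :
    ∑ m ∈ r.index, sideMul ℂ s (sideAntipode H hS s (r.right m)) (r.left m) =
      algebraMap ℂ H (counit h) := by
  cases s
  · exact sum_antipodeInv_mul hS r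
  · exact sum_mul_antipode_eq_algebraMap_counit r

theorem coact_sideMul_dB (s : Side) {h k : H} {ι κ : Type*} (r : Repr ℂ h ι) (t : Repr ℂ k κ) :
    Λ.coact (sideMul ℂ s (Λ.incl h) (Λ.dB k)) = ∑ n ∈ t.index, ∑ m ∈ r.index,
      sideMul ℂ s (Λ.incl (r.left m)) (Λ.dB (t.left n)) ⊗ₜ
        sideMul ℂ s (r.right m) (t.right n) := by
  have coact_dB : Λ.coact (Λ.dB k) = Λ.dB.rTensor H (comul (R := ℂ) k) := Λ.coact_d k
  rw [map_sideMul, Λ.coact_incl, coact_dB, ← r.eq, ← t.eq]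
  simp only [map_sum, LinearMap.sum_apply, LinearMap.rTensor_tmul, sideMul_tmul_tmul,
    AlgHom.toLinearMap_apply]

/-- The map `ω ↦ ∑ σ(ω₁) ω₀`, where `σ(ω₁)` acts from the side `s`; it projects the forms onto the
coinvariant forms. -/
def coinvariantPart (s : Side) : Λ.carrier →ₗ[ℂ] Λ.carrier :=
  TensorProduct.lift (sideMul ℂ s ∘ₗ Λ.incl.toLinearMap ∘ₗ sideAntipode H hS s).flip ∘ₗ
    Λ.coact.toLinearMap

theorem coinvariantPart_sideMul_dB (s : Side) (h k : H) :
    Λ.coinvariantPart hS s (sideMul ℂ s (Λ.incl h) (Λ.dB k)) =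
      counit (R := ℂ) h • Λ.etaSide s (sideAntipode H hS s) k := by
  have cancel (m l : H) : ∑ n ∈ (ℛ ℂ h).index,
      sideMul ℂ s (Λ.incl (sideAntipode H hS s (sideMul ℂ s ((ℛ ℂ h).right n) l)))
        (sideMul ℂ s (Λ.incl ((ℛ ℂ h).left n)) (Λ.dB m)) =
      counit (R := ℂ) h • sideMul ℂ s (Λ.incl (sideAntipode H hS s l)) (Λ.dB m) := by
    simp only [← sideMul_sideMul _ _ _ (Λ.dB m), ← map_sideMul, sideAntipode_sideMul]
    simp only [sideMul_sideMul]
    rw [← LinearMap.sum_apply, ← map_sum, ← map_sum, ← map_sum,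
      sum_sideMul_sideAntipode hS s (ℛ ℂ h), Algebra.algebraMap_eq_smul_one, map_smul, sideMul_one,
      map_smul, map_smul, LinearMap.smul_apply]
  rw [coinvariantPart, LinearMap.comp_apply, AlgHom.toLinearMap_apply,
    Λ.coact_sideMul_dB s (ℛ ℂ h) (ℛ ℂ k), map_sum, etaSide_repr _ _ _ (ℛ ℂ k), Finset.smul_sum]
  refine Finset.sum_congr rfl fun n _ => ?_
  rw [map_sum, ← cancel]
  rfl

end RightCovariantCalculus

namespace DifferentialStructure

open Coalgebra HopfAlgebra DifferentialCalculus RightCovariantCalculus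

variable {I H B P : Type*} [Ring H] [HopfAlgebra ℂ H] [Ring B] [Algebra ℂ B]
  [Ring P] [Algebra ℂ P] {X : LocallyTrivialQPFB I H B P} (D : DifferentialStructure X)

section ConnForm

variable (s : Side) (i : I) (A : H →ₗ[ℂ] (D.ΓB i).carrier)

/-- The map `a ⊗ h ↦ ε(h) d a - a A(h)`, where `a` acts from the side `s`. By covariance it
determines `connForm`. -/
def baseConnForm : X.Loc i ⊗[ℂ] H →ₗ[ℂ] (D.ΓB i).carrier :=
  (D.ΓB i).dB ∘ₗ contract counit -
    TensorProduct.lift ((sideMul ℂ s).compl₁₂ (D.ΓB i).incl.toLinearMap A)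

theorem connForm_eq (z : X.Loc i ⊗[ℂ] H) : D.connForm s i A z =
    D.horIncl i ((D.baseConnForm s i A).rTensor H (cofreeCoact ℂ H (X.Loc i) z)) := by
  induction z with
  | zero => simp only [map_zero]
  | add x y hx hy => simp only [map_add, hx, hy]
  | tmul a h =>
    rw [connForm, horDiff_tmul, convolve_repr (ℛ ℂ h), cofreeCoact_tmul a (ℛ ℂ h)]
    simp only [baseConnForm, map_sum, LinearMap.rTensor_tmul, LinearMap.sub_apply,
      LinearMap.comp_apply, contract_tmul, TensorProduct.lift.tmul, LinearMap.compl₁₂_apply,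
      TensorProduct.sub_tmul, map_sub, horIncl_tmul, AlgHom.toLinearMap_apply,
      Finset.sum_sub_distrib, map_smul, smul_mul_assoc]
    congr 1
    · simp only [← mul_smul_comm, ← Finset.mul_sum, ← map_smul, ← map_sum, sum_counit_smul]
    · refine Finset.sum_congr rfl fun m _ => ?_
      have act := D.sideMul_inZero_horIncl s i (a ⊗ₜ 1) (A ((ℛ ℂ h).left m) ⊗ₜ (ℛ ℂ h).right m)
      rwa [inZero_tmul_one, LinearMap.rTensor_tmul, sideMul_tmul_tmul, horIncl_tmul, horIncl_tmul,
        one_sideMul] at act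

theorem idCounit_connForm (z : X.Loc i ⊗[ℂ] H) :
    D.idCounit i (D.connForm s i A z) = D.baseConnForm s i A z := by
  rw [connForm_eq, idCounit_horIncl, contract_rTensor, contract_counit_cofreeCoact]

theorem connForm_mem_horizontal (z : X.Loc i ⊗[ℂ] H) :
    D.connForm s i A z ∈ horizontal (D.ΓB i) D.ΓH.toDifferentialCalculus :=
  D.mem_horizontal.2 ⟨_, (D.connForm_eq s i A z).symm⟩

theorem localCoact_connForm (z : X.Loc i ⊗[ℂ] H) : D.localCoact i (D.connForm s i A z) =
    (D.connForm s i A).rTensor H (cofreeCoact ℂ H (X.Loc i) z) := by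
  have comp_eq : D.connForm s i A = (D.horIncl i).toLinearMap ∘ₗ
      (D.baseConnForm s i A).rTensor H ∘ₗ cofreeCoact ℂ H (X.Loc i) :=
    LinearMap.ext (D.connForm_eq s i A)
  rw [connForm_eq, localCoact_horIncl, ← rTensor_rTensor_cofreeCoact, comp_eq,
    LinearMap.rTensor_comp_apply, LinearMap.rTensor_comp_apply, cofreeCoact_cofreeCoact]

variable {A}

theorem skewProj_horIncl (n : ℕ) (z : (D.ΓB i).carrier ⊗[ℂ] H) :
    skewProj _ _ n (D.horIncl i z) =
      D.horIncl i ((GradedAlgebra.proj (D.ΓB i).deg n).rTensor H z) := by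
  induction z with
  | zero => simp only [map_zero]
  | add x y hx hy => simp only [map_add, hx, hy]
  | tmul γ h =>
    rw [horIncl_tmul, LinearMap.rTensor_tmul, horIncl_tmul, ← coeff_gradingHom, ← inR_incl,
      skewProj_apply, map_mul, skewGradingHom_inLeft, skewGradingHom_inRight,
      gradingHom_of_mem _ (D.ΓH.incl_mem h)]
    simp

theorem skewProj_one_connForm (hA : ∀ h, A h ∈ (D.ΓB i).deg 1) (z : X.Loc i ⊗[ℂ] H) :
    skewProj _ _ 1 (D.connForm s i A z) = D.connForm s i A z := by
  have proj_base : GradedAlgebra.proj (D.ΓB i).deg 1 ∘ₗ D.baseConnForm s i A =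
      D.baseConnForm s i A := by
    refine TensorProduct.ext' fun a h => gradedProj_of_mem (D.ΓB i).deg ?_
    exact sub_mem ((D.ΓB i).dB_mem _) ((D.ΓB i).sideMul_incl_mem s (hA h) a)
  rw [connForm_eq, skewProj_horIncl, ← LinearMap.rTensor_comp_apply, proj_base]

end ConnForm

end DifferentialStructure

/-! ### Local projections -/

namespace DifferentialStructure

open Coalgebra HopfAlgebra DifferentialCalculus RightCovariantCalculus

variable {I H B P : Type*} [Ring H] [HopfAlgebra ℂ H] [Ring B] [Algebra ℂ B]
  [Ring P] [Algebra ℂ P] {X : LocallyTrivialQPFB I H B P} (D : DifferentialStructure X)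

section Products

variable (s : Side) (i : I)

theorem sideMul_inH_inL_mul (h : H) (γ : (D.ΓB i).carrier) (w : D.Local i) :
    sideMul ℂ s (D.inH i h) (D.inL i γ * w) = D.inL i γ * sideMul ℂ s (D.inH i h) w := by
  cases s
  · exact (commute_inRight_incl_inLeft _ _ h γ).left_comm w
  · exact mul_assoc _ _ _

theorem sideMul_inZero_inL_incl (a c : X.Loc i) (h : H) :
    sideMul ℂ s (D.inZero i (a ⊗ₜ h)) (D.inL i ((D.ΓB i).incl c)) =
      sideMul ℂ s (D.inL i ((D.ΓB i).incl (sideMul ℂ s a c))) (D.inH i h) := by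
  have inH_comm (γ : (D.ΓB i).carrier) : D.inH i h * D.inL i γ = D.inL i γ * D.inH i h :=
    (commute_inRight_incl_inLeft _ _ h γ).eq
  cases s
  · rw [sideMul_left, sideMul_left, sideMul_left, inZero_tmul, mul_assoc, inH_comm, map_mul,
      map_mul, mul_assoc]
  · rw [sideMul_right, sideMul_right, sideMul_right, inZero_tmul, inH_comm, map_mul, map_mul,
      mul_assoc]

theorem sideMul_inZero_inL_incl_mul_inR (a c : X.Loc i) (h : H) (ω : D.ΓH.carrier) :
    sideMul ℂ s (D.inZero i (a ⊗ₜ h)) (D.inL i ((D.ΓB i).incl c) * D.inR i ω) =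
      D.inL i ((D.ΓB i).incl (sideMul ℂ s a c)) *
        D.inR i (sideMul ℂ s (D.ΓH.incl h) ω) := by
  rw [← D.sideMul_inL_incl_inR s, ← D.sideMul_inL_incl_inR s, ← sideMul_sideMul,
    sideMul_inZero_inL_incl, sideMul_sideMul, map_sideMul s (D.inR i), inR_incl]

theorem sideMul_inZero_mem_horizontal (x : X.Loc i ⊗[ℂ] H) {w : D.Local i}
    (hw : w ∈ horizontal (D.ΓB i) D.ΓH.toDifferentialCalculus) :
    sideMul ℂ s (D.inZero i x) w ∈ horizontal (D.ΓB i) D.ΓH.toDifferentialCalculus := by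
  obtain ⟨z, rfl⟩ := D.mem_horizontal.1 hw
  exact D.mem_horizontal.2 ⟨_, (D.sideMul_inZero_horIncl s i x z).symm⟩

end Products

section LocalProjection

variable (hS : Function.Bijective (antipode ℂ : H →ₗ[ℂ] H)) (s : Side) (i : I)
  (F : D.ΓH.carrier →ₗ[ℂ] (D.ΓB i).carrier)

/-- The vertical part of the local connection whose connection form is `F` on the coinvariant
one-forms: it maps `h d k` to `∑ h F(η(k₁)) k₂`, where `h` acts from the side `s` and `η` is
`etaSide`. -/
def verticalPart : D.ΓH.carrier →ₗ[ℂ] D.Local i :=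
  LinearMap.mul' ℂ (D.Local i) ∘ₗ
    TensorProduct.map ((D.inL i).toLinearMap ∘ₗ F ∘ₗ D.ΓH.coinvariantPart hS s)
      (D.inH i).toLinearMap ∘ₗ D.ΓH.coact.toLinearMap ∘ₗ GradedAlgebra.proj D.ΓH.deg 1

theorem verticalPart_incl (h : H) : D.verticalPart hS s i F (D.ΓH.incl h) = 0 := by
  simp only [verticalPart, LinearMap.comp_apply,
    gradedProj_of_mem_ne D.ΓH.deg (D.ΓH.incl_mem h) zero_ne_one, map_zero]

theorem verticalPart_sideMul_dB (h k : H) :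
    D.verticalPart hS s i F (sideMul ℂ s (D.ΓH.incl h) (D.ΓH.dB k)) = sideMul ℂ s (D.inH i h)
      (convolve ((D.inL i).toLinearMap ∘ₗ F ∘ₗ D.ΓH.etaSide s (sideAntipode H hS s))
        (D.inH i).toLinearMap k) := by
  have proj_eq : GradedAlgebra.proj D.ΓH.deg 1 (sideMul ℂ s (D.ΓH.incl h) (D.ΓH.dB k)) =
      sideMul ℂ s (D.ΓH.incl h) (D.ΓH.dB k) :=
    gradedProj_of_mem D.ΓH.deg (D.ΓH.sideMul_incl_mem s (D.ΓH.dB_mem k) h)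
  have cancel (γ : (D.ΓB i).carrier) (l : H) : ∑ m ∈ (ℛ ℂ h).index,
      counit (R := ℂ) ((ℛ ℂ h).left m) •
        (D.inL i γ * D.inH i (sideMul ℂ s ((ℛ ℂ h).right m) l)) =
      sideMul ℂ s (D.inH i h) (D.inL i γ * D.inH i l) := by
    rw [sideMul_inH_inL_mul, ← map_sideMul s (D.inH i)]
    conv_rhs => rw [← sum_counit_smul (ℛ ℂ h)]
    simp only [map_sum, LinearMap.sum_apply, map_smul, LinearMap.smul_apply, Finset.mul_sum,
      mul_smul_comm]
  simp only [verticalPart, LinearMap.comp_apply, proj_eq, AlgHom.toLinearMap_apply,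
    D.ΓH.coact_sideMul_dB s (ℛ ℂ h) (ℛ ℂ k), map_sum, TensorProduct.map_tmul,
    coinvariantPart_sideMul_dB, map_smul, LinearMap.mul'_apply, smul_mul_assoc, cancel,
    convolve_repr (ℛ ℂ k)]

/-- The map `g` is a projection of the local calculus over `i` onto its horizontal forms, with local
connection map `A`. It is unconstrained on the forms that are not of degree one. -/
structure IsLocalProjection (A : H →ₗ[ℂ] (D.ΓB i).carrier) (g : D.Local i →ₗ[ℂ] D.Local i) :
    Prop where
  apply_of_mem : ∀ w ∈ horizontal (D.ΓB i) D.ΓH.toDifferentialCalculus, g w = w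
  apply_sideMul : ∀ x y, g (sideMul ℂ s (D.inZero i x) (D.dLoc i y)) =
    sideMul ℂ s (D.inZero i x) (D.connForm s i A y)

/-- The projection of the local calculus onto its horizontal forms with the vertical part
`verticalPart`. -/
def localProjection : D.Local i →ₗ[ℂ] D.Local i :=
  (LinearMap.mul' ℂ (D.Local i) ∘ₗ TensorProduct.map (D.inL i).toLinearMap
      ((D.inR i).toLinearMap ∘ₗ GradedAlgebra.proj D.ΓH.deg 0) -
    TensorProduct.lift ((sideMul ℂ s).compl₁₂ (D.inL i).toLinearMap
      (D.verticalPart hS s i F))) ∘ₗ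
    (GradedTensorProduct.of ℂ (D.ΓB i).deg D.ΓH.deg).symm.toLinearMap

theorem localProjection_mul (γ : (D.ΓB i).carrier) (ω : D.ΓH.carrier) :
    D.localProjection hS s i F (D.inL i γ * D.inR i ω) =
      D.inL i γ * D.inR i (GradedAlgebra.proj D.ΓH.deg 0 ω) -
        sideMul ℂ s (D.inL i γ) (D.verticalPart hS s i F ω) := by
  rw [localProjection, LinearMap.comp_apply, LinearEquiv.coe_coe, of_symm_mul]
  rfl

theorem localProjection_of_mem_horizontal {w : D.Local i}
    (hw : w ∈ horizontal (D.ΓB i) D.ΓH.toDifferentialCalculus) :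
    D.localProjection hS s i F w = w := by
  obtain ⟨z, rfl⟩ := D.mem_horizontal.1 hw
  clear hw
  induction z with
  | zero => simp only [map_zero]
  | add x y hx hy => simp only [map_add, hx, hy]
  | tmul γ h =>
    rw [horIncl_tmul, ← inR_incl, localProjection_mul, verticalPart_incl, map_zero, sub_zero,
      gradedProj_of_mem D.ΓH.deg (D.ΓH.incl_mem h)]

theorem localProjection_sideMul (x y : X.Loc i ⊗[ℂ] H) :
    D.localProjection hS s i F (sideMul ℂ s (D.inZero i x) (D.dLoc i y)) =
      sideMul ℂ s (D.inZero i x)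
        (D.connForm s i (F ∘ₗ D.ΓH.etaSide s (sideAntipode H hS s)) y) := by
  induction x with
  | zero => simp only [map_zero, LinearMap.zero_apply]
  | add x x' hx hx' => simp only [map_add, LinearMap.add_apply, hx, hx']
  | tmul a h =>
    induction y with
    | zero => simp only [map_zero]
    | add y y' hy hy' => simp only [map_add, hy, hy']
    | tmul c k =>
      have proj_zero : GradedAlgebra.proj D.ΓH.deg 0
          (sideMul ℂ s (D.ΓH.incl h) (D.ΓH.dB k)) = 0 := by
        have proj_dB := gradedProj_of_mem_ne D.ΓH.deg (D.ΓH.dB_mem k) one_ne_zero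
        cases s
        · rw [sideMul_left, gradedProj_zero_mul, proj_dB, mul_zero]
        · rw [sideMul_right, gradedProj_zero_mul, proj_dB, zero_mul]
      have fixed := D.localProjection_of_mem_horizontal hS s i F
        (D.sideMul_inZero_mem_horizontal s i (a ⊗ₜ h) (D.mem_horizontal.2
          ⟨(D.ΓB i).dB c ⊗ₜ k, D.horIncl_tmul i _ k⟩))
      rw [dLoc_tmul, connForm, horDiff_tmul, map_add, map_sub, map_add, fixed, sub_eq_add_neg,
        sideMul_inZero_inL_incl_mul_inR, localProjection_mul, proj_zero, map_zero, mul_zero,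
        zero_sub, verticalPart_sideMul_dB]
      congr 2
      rw [← sideMul_sideMul, ← sideMul_inZero_inL_incl, sideMul_sideMul]
      rfl

variable {s i}

theorem exists_isLocalProjection {A : ∀ i, H →ₗ[ℂ] (D.ΓB i).carrier} (hA : D.SideKernel hS s A)
    (hA₁ : A i 1 = 0) : ∃ g, D.IsLocalProjection s i (A i) g := by
  have ker_le : LinearMap.ker (D.ΓH.etaSide s (sideAntipode H hS s)) ≤ LinearMap.ker (A i) := by
    intro h (eta_eq_zero : D.ΓH.etaSide s _ h = 0)
    have eq_zero := hA i (h - counit (R := ℂ) h • 1)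
      (by rw [map_sub, map_smul, etaSide_sideAntipode_one, smul_zero, sub_zero, eta_eq_zero])
      (by rw [map_sub, map_smul, Bialgebra.counit_one, smul_eq_mul, mul_one, sub_self])
    rwa [map_sub, map_smul, hA₁, smul_zero, sub_zero] at eq_zero
  obtain ⟨F, hF⟩ := exists_comp_eq_of_ker_le ker_le
  exact ⟨D.localProjection hS s i F,
    fun _ => D.localProjection_of_mem_horizontal hS s i F,
    fun x y => hF ▸ D.localProjection_sideMul hS s i F x y⟩

end LocalProjection

end DifferentialStructure

/-! ### Connections from local connection maps -/

namespace DifferentialStructure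

open Coalgebra HopfAlgebra DifferentialCalculus RightCovariantCalculus

variable {I H B P : Type*} [Ring H] [HopfAlgebra ℂ H] [Ring B] [Algebra ℂ B]
  [Ring P] [Algebra ℂ P] {X : LocallyTrivialQPFB I H B P} (D : DifferentialStructure X)
  {s : Side}

section Gluing

variable {D} {i : I} {A : H →ₗ[ℂ] (D.ΓB i).carrier} {g : D.Local i →ₗ[ℂ] D.Local i}

theorem inR_dB (i : I) (h : H) : D.inR i (D.ΓH.dB h) = D.dLoc i (1 ⊗ₜ h) := by
  rw [dLoc_tmul, dB_one, map_zero, zero_mul, zero_add, map_one, map_one, one_mul]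

theorem IsLocalProjection.apply_dLoc (hg : D.IsLocalProjection s i A g) (y : X.Loc i ⊗[ℂ] H) :
    g (D.dLoc i y) = D.connForm s i A y := by
  have apply_one := hg.apply_sideMul (1 ⊗ₜ 1) y
  rwa [inZero_one_tmul, map_one, one_sideMul, one_sideMul] at apply_one

theorem IsLocalProjection.apply_mem_horizontal (hg : D.IsLocalProjection s i A g)
    {y : D.ΓP.carrier} (hy : y ∈ D.ΓP.deg 1) :
    g (D.χΓ i y) ∈ horizontal (D.ΓB i) D.ΓH.toDifferentialCalculus := by
  rw [← Submodule.Quotient.mk_eq_zero]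
  refine D.eqOn_χΓ_deg_one s i (f' := 0)
    (f := (horizontal (D.ΓB i) D.ΓH.toDifferentialCalculus).mkQ ∘ₗ g) (fun p q => ?_) hy
  rw [LinearMap.comp_apply, hg.apply_sideMul, LinearMap.zero_apply, Submodule.mkQ_apply,
    Submodule.Quotient.mk_eq_zero]
  exact D.sideMul_inZero_mem_horizontal s i _ (D.connForm_mem_horizontal s i _ _)

theorem IsLocalProjection.rTensor_localCoact (hg : D.IsLocalProjection s i A g)
    {y : D.ΓP.carrier} (hy : y ∈ D.ΓP.deg 1) :
    g.rTensor H (D.localCoact i (D.χΓ i y)) = D.localCoact i (g (D.χΓ i y)) := by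
  refine D.eqOn_χΓ_deg_one s i (f := g.rTensor H ∘ₗ D.localCoact i)
    (f' := D.localCoact i ∘ₗ g) (fun p q => ?_) hy
  rw [LinearMap.comp_apply, LinearMap.comp_apply, hg.apply_sideMul, localCoact_sideMul,
    localCoact_sideMul, localCoact_inZero, localCoact_dLoc, localCoact_connForm,
    rTensor_sideMul hg.apply_sideMul]

theorem IsLocalProjection.map_sideMul (hg : D.IsLocalProjection s i A g)
    (x : X.Loc i ⊗[ℂ] H) {y : D.ΓP.carrier} (hy : y ∈ D.ΓP.deg 1) :
    g (sideMul ℂ s (D.inZero i x) (D.χΓ i y)) = sideMul ℂ s (D.inZero i x) (g (D.χΓ i y)) := by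
  refine D.eqOn_χΓ_deg_one s i (f := g ∘ₗ sideMul ℂ s (D.inZero i x))
    (f' := sideMul ℂ s (D.inZero i x) ∘ₗ g) (fun p q => ?_) hy
  have inZero_sideMul : D.inZero i (sideMul ℂ s x p) =
      sideMul ℂ s (D.inZero i x) (D.inZero i p) := by
    cases s
    · exact skewIncl_mul _ _ x p
    · exact skewIncl_mul _ _ p x
  rw [LinearMap.comp_apply, LinearMap.comp_apply, hg.apply_sideMul, ← sideMul_sideMul,
    ← sideMul_sideMul, ← inZero_sideMul, hg.apply_sideMul]

theorem IsLocalProjection.localMap_eq (hg : D.IsLocalProjection s i A g)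
    {hor : D.forms →ₗ[ℂ] D.forms} (hhor : D.IsLocalMap hor i g) : D.localMap hor i = A := by
  ext h
  rw [hhor.localMap_eq, LinearMap.neg_apply, LinearMap.comp_apply, LinearMap.comp_apply,
    LinearMap.comp_apply, AlgHom.toLinearMap_apply, inR_dB, hg.apply_dLoc, idCounit_connForm,
    neg_eq_iff_eq_neg]
  simp [baseConnForm, one_sideMul]

theorem exists_of_projLeft_eq_projRight {j : I} {u : D.Local i} {v : D.Local j}
    (h : D.projLeft i j u = D.projRight i j v) : ∃ y, D.χΓ i y = u ∧ D.χΓ j y = v := by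
  obtain ⟨x, rfl⟩ := D.χΓ_surjective i u
  obtain ⟨z, rfl⟩ := D.χΓ_surjective j v
  rw [projLeft_χΓ, projRight_χΓ] at h
  obtain ⟨k, hk, l, hl, eq⟩ := Submodule.mem_sup.1 (Ideal.Quotient.eq.1 h)
  rw [RingHom.mem_ker] at hk hl
  refine ⟨x - k, by rw [map_sub, hk, sub_zero], ?_⟩
  have sub_eq : x - k = z + l := by rw [sub_eq_iff_eq_add, add_assoc, add_comm l, eq]; abel
  rw [sub_eq, map_add, hl, add_zero]

end Gluing

section Family

variable {A : ∀ i, H →ₗ[ℂ] (D.ΓB i).carrier} {g : ∀ i, D.Local i →ₗ[ℂ] D.Local i}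
  {τ : ∀ i j, H →ₐ[ℂ] X.Overlap i j}

theorem exists_χΓ_eq_connForm (hτ : X.IsTransition τ) (hA : D.IsNormalized A)
    (hc : D.IsCompatible τ A) (i j : I) (p : P) : ∃ y ∈ D.ΓP.deg 1,
      D.χΓ i y = D.connForm s i (A i) (X.χ i p) ∧ D.χΓ j y = D.connForm s j (A j) (X.χ j p) := by
  obtain ⟨y, hi, hj⟩ :=
    exists_of_projLeft_eq_projRight ((D.isCompatible_iff_connForm hτ s A).1 hc i j p)
  refine ⟨_, gradedProj_mem D.ΓP.deg 1 y, ?_, ?_⟩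
  · rw [χΓ_proj, hi, skewProj_one_connForm _ _ _ (hA.1 i)]
  · rw [χΓ_proj, hj, skewProj_one_connForm _ _ _ (hA.1 j)]

theorem exists_χΓ_eq (hτ : X.IsTransition τ) (hA : D.IsNormalized A) (hc : D.IsCompatible τ A)
    (hg : ∀ i, D.IsLocalProjection s i (A i) (g i)) (i j : I) {y : D.ΓP.carrier}
    (hy : y ∈ D.ΓP.deg 1) : ∃ y' ∈ D.ΓP.deg 1,
      D.χΓ i y' = g i (D.χΓ i y) ∧ D.χΓ j y' = g j (D.χΓ j y) := by
  suffices hle : D.ΓP.exactSpan s ≤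
      ((D.ΓP.deg 1).map ((D.χΓ i).toLinearMap.prod (D.χΓ j).toLinearMap)).comap
        ((g i ∘ₗ (D.χΓ i).toLinearMap).prod (g j ∘ₗ (D.χΓ j).toLinearMap)) by
    obtain ⟨y', hy', eq⟩ := hle (D.ΓP.deg_one_le_exactSpan s hy)
    exact ⟨y', hy', congrArg Prod.fst eq, congrArg Prod.snd eq⟩
  refine Submodule.span_le.2 ?_
  rintro _ ⟨p, q, rfl⟩
  obtain ⟨z, hz, hi, hj⟩ := D.exists_χΓ_eq_connForm (s := s) hτ hA hc i j q
  have glued (k : I) (hk : D.χΓ k z = D.connForm s k (A k) (X.χ k q)) :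
      D.χΓ k (sideMul ℂ s (D.ΓP.incl p) z) =
        g k (D.χΓ k (sideMul ℂ s (D.ΓP.incl p) (D.ΓP.dB q))) := by
    rw [_root_.map_sideMul, _root_.map_sideMul, D.χΓ_incl, χΓ_dB, (hg k).apply_sideMul, hk]
  exact ⟨_, D.ΓP.sideMul_incl_mem s hz p, Prod.ext (glued i hi) (glued j hj)⟩

theorem exists_forall_isLocalMap (hτ : X.IsTransition τ) (hA : D.IsNormalized A)
    (hc : D.IsCompatible τ A) (hg : ∀ i, D.IsLocalProjection s i (A i) (g i)) :
    ∃ hor, ∀ i, D.IsLocalMap hor i (g i) := by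
  have exists_image (γ : D.forms) : ∃ δ : D.forms, ∀ i, D.χc i δ = g i (D.χc i γ) := by
    refine D.exists_forms _ fun i j => ?_
    obtain ⟨y, hy, hi, hj⟩ := D.exists_common_lift γ i j
    rw [← hi, ← hj]
    exact D.exists_χΓ_eq hτ hA hc hg i j hy
  choose f hf using exists_image
  exact ⟨{
    toFun := f
    map_add' := fun γ δ => D.forms_ext fun i => by simp only [map_add, hf]
    map_smul' := fun c γ => D.forms_ext fun i => by simp only [map_smul, hf, RingHom.id_apply] },
    fun i γ => (hf γ i).symm⟩

variable {D} {hor : D.forms →ₗ[ℂ] D.forms}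

theorem isProjection_of_isLocalMap [Finite I] (hg : ∀ i, D.IsLocalProjection s i (A i) (g i))
    (hhor : ∀ i, D.IsLocalMap hor i (g i)) : D.IsProjection hor := by
  have hor_mem (γ : D.forms) : hor γ ∈ D.horForms := D.mem_horForms.2 fun i => by
    obtain ⟨y, hy, hγ⟩ := D.exists_lift γ i
    rw [← hhor i, ← hγ]
    exact (hg i).apply_mem_horizontal hy
  have hor_of_mem (γ : D.forms) (hγ : γ ∈ D.horForms) : hor γ = γ := D.forms_ext fun i => by
    rw [← hhor i, (hg i).apply_of_mem _ (D.mem_horForms.1 hγ i)]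
  refine ⟨le_antisymm ?_ fun γ hγ => ⟨γ, hor_of_mem γ hγ⟩, fun γ => hor_of_mem _ (hor_mem γ),
    fun γ => ?_, fun i γ hγ => ?_⟩
  · rintro _ ⟨γ, rfl⟩
    exact hor_mem γ
  · obtain ⟨t, ht⟩ := D.exists_isCoactionOf γ
    refine ⟨t, ht, fun i => ?_⟩
    obtain ⟨y, hy, hγ⟩ := D.exists_lift γ i
    have comp_eq : D.χc i ∘ₗ hor = g i ∘ₗ D.χc i := LinearMap.ext fun γ => (hhor i γ).symm
    rw [← LinearMap.rTensor_comp_apply, comp_eq, LinearMap.rTensor_comp_apply, ht i, ← hhor i,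
      ← hγ, (hg i).rTensor_localCoact hy]
  · rw [← hhor i, hγ, map_zero]

theorem isConnection_of_isLocalMap [Finite I] (hg : ∀ i, D.IsLocalProjection s i (A i) (g i))
    (hhor : ∀ i, D.IsLocalMap hor i (g i)) : D.IsConnection s hor := by
  refine ⟨isProjection_of_isLocalMap hg hhor, fun p γ => D.forms_ext fun i => ?_⟩
  obtain ⟨y, hy, hγ⟩ := D.exists_lift γ i
  rw [← hhor i, χc_sideAct, χc_sideAct, ← hhor i, ← hγ, (hg i).map_sideMul _ hy]

end Family

section Classification

variable [Finite I] (hS : Function.Bijective (antipode ℂ : H →ₗ[ℂ] H))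

theorem exists_isConnection_iff {τ : ∀ i j, H →ₐ[ℂ] X.Overlap i j} (hτ : X.IsTransition τ)
    (s : Side) (A : ∀ i, H →ₗ[ℂ] (D.ΓB i).carrier) :
    (∃ hor, D.IsConnection s hor ∧ D.localMap hor = A) ↔
      D.IsNormalized A ∧ D.IsCompatible τ A ∧ D.SideKernel hS s A := by
  constructor
  · rintro ⟨hor, h, rfl⟩
    exact ⟨h.isNormalized, h.isCompatible hτ, h.sideKernel hS⟩
  · rintro ⟨hA, hc, hk⟩
    choose g hg using fun i => D.exists_isLocalProjection hS hk (hA.2 i)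
    obtain ⟨hor, hhor⟩ := D.exists_forall_isLocalMap hτ hA hc hg
    exact ⟨hor, isConnection_of_isLocalMap hg hhor, funext fun i => (hg i).localMap_eq (hhor i)⟩

theorem exists_leftConnection_iff {τ : ∀ i j, H →ₐ[ℂ] X.Overlap i j} (hτ : X.IsTransition τ)
    (A : ∀ i, H →ₗ[ℂ] (D.ΓB i).carrier) : (∃ ω : D.LeftConnection, D.localMap ω.hor = A) ↔
      D.IsNormalized A ∧ D.IsCompatible τ A ∧ D.LeftKernel hS A := by
  rw [← sideKernel_left, ← D.exists_isConnection_iff hS hτ .left]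
  constructor
  · rintro ⟨ω, hω⟩
    exact ⟨ω.hor, ω.isConnection, hω⟩
  · rintro ⟨hor, h, hor_eq⟩
    exact ⟨⟨hor, h.toIsProjection, h.map_sideAct⟩, hor_eq⟩

theorem exists_rightConnection_iff {τ : ∀ i j, H →ₐ[ℂ] X.Overlap i j} (hτ : X.IsTransition τ)
    (A : ∀ i, H →ₗ[ℂ] (D.ΓB i).carrier) : (∃ ω : D.RightConnection, D.localMap ω.hor = A) ↔
      D.IsNormalized A ∧ D.IsCompatible τ A ∧ D.RightKernel hS A := by
  rw [← sideKernel_right, ← D.exists_isConnection_iff hS hτ .right]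
  constructor
  · rintro ⟨ω, hω⟩
    exact ⟨ω.hor, ω.isConnection, hω⟩
  · rintro ⟨hor, h, hor_eq⟩
    exact ⟨⟨hor, h.toIsProjection, h.map_sideAct⟩, hor_eq⟩

include hS in
theorem existsUnique_connection_equiv : ∃! Φ : D.LeftConnection ≃ D.RightConnection,
    ∀ ω : D.LeftConnection, D.localMap (Φ ω).hor = D.negAntipode (D.localMap ω.hor) := by
  obtain ⟨τ, hτ, -⟩ := LocallyTrivialQPFB.existsUnique_isTransition X
  refine existsUnique_equiv_of_mem_range_iff (f := fun ω : D.LeftConnection => D.localMap ω.hor)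
    (g := fun ω : D.RightConnection => D.localMap ω.hor) ?_ ?_ (D.negAntipode_bijective hS)
    fun A => ?_
  · rintro ⟨hor, h, act⟩ ⟨hor', h', act'⟩ eq
    obtain rfl := IsConnection.eq_of_localMap_eq (s := .left) ⟨h, act⟩ ⟨h', act'⟩ eq
    rfl
  · rintro ⟨hor, h, act⟩ ⟨hor', h', act'⟩ eq
    obtain rfl := IsConnection.eq_of_localMap_eq (s := .right) ⟨h, act⟩ ⟨h', act'⟩ eq
    rfl
  · rw [Set.mem_range, Set.mem_range, D.exists_leftConnection_iff hS hτ,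
      D.exists_rightConnection_iff hS hτ, D.isNormalized_negAntipode hS,
      D.isCompatible_negAntipode hS hτ, D.leftKernel_iff_rightKernel hS]

end Classification

end DifferentialStructure

end

theorem proposition13 {I H B P : Type*} [Finite I] [Ring H] [HopfAlgebra ℂ H]
    [Ring B] [Algebra ℂ B] [Ring P] [Algebra ℂ P]
    (hS : Function.Bijective (HopfAlgebra.antipode ℂ : H →ₗ[ℂ] H))
    (X : LocallyTrivialQPFB I H B P) (D : DifferentialStructure X) :
    (∃! Φ : D.LeftConnection ≃ D.RightConnection, ∀ ω : D.LeftConnection,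
      D.localMap (Φ ω).hor = D.negAntipode (D.localMap ω.hor)) ∧
    (∃! τ : ∀ i j, H →ₐ[ℂ] X.Overlap i j, X.IsTransition τ) ∧
    ∀ τ : ∀ i j, H →ₐ[ℂ] X.Overlap i j, X.IsTransition τ →
      (∀ A : ∀ i, H →ₗ[ℂ] (D.ΓB i).carrier,
        (∃ ω : D.LeftConnection, D.localMap ω.hor = A) ↔
          D.IsNormalized A ∧ D.IsCompatible τ A ∧ D.LeftKernel hS A) ∧
      (∀ A : ∀ i, H →ₗ[ℂ] (D.ΓB i).carrier,
        (∃ ω : D.RightConnection, D.localMap ω.hor = A) ↔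
          D.IsNormalized A ∧ D.IsCompatible τ A ∧ D.RightKernel hS A) ∧
      (∀ A : ∀ i, H →ₗ[ℂ] (D.ΓB i).carrier,
        (D.IsNormalized A ↔ D.IsNormalized (D.negAntipode A)) ∧
        (D.IsCompatible τ A ↔ D.IsCompatible τ (D.negAntipode A)) ∧
        (D.LeftKernel hS A ↔ D.RightKernel hS (D.negAntipode A))) :=
  ⟨D.existsUnique_connection_equiv hS, X.existsUnique_isTransition, fun _ hτ =>
    ⟨D.exists_leftConnection_iff hS hτ, D.exists_rightConnection_iff hS hτ, fun A =>
      ⟨D.isNormalized_negAntipode hS A, D.isCompatible_negAntipode hS hτ A,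
        D.leftKernel_iff_rightKernel hS A⟩⟩⟩
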